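/- **Setting.** Let $d\ge 1$, $\lambda>0$, and let $(k_x)_{x\in\mathbb Z^d}$ be i.i.d. random variables whose common law is absolutely continuous with a bounded density $\nu$ with $\operatorname{supp}\nu=[0,k_{\max}]$, $k_{\max}<\infty$; $\mathbb E$ is the expectation. Write $|\cdot|$ for the $1$-norm. For a finite rectangular box $\Lambda\subset\mathbb Z^d$ consider on $\mathcal H_\Lambda=L^2(\mathbb R^\Lambda)$ the Hamiltonian $$H_\Lambda=\sum_{x\in\Lambda}\Big(p_x^2+\frac{k_x}{2}q_x^2\Big)+\sum_{\{x,y\}\subset\Lambda:\,|x-y|=1}\lambda(q_x-q_y)^2,$$ where $q_x$ and $p_x=-i\partial_{q_x}$ are the position and momentum operators, and on $\ell^2(\Lambda)$ the effective Hamiltonian $h_\Lambda=\lambda h_{0,\Lambda}+\frac12 k$, where $h_{0,\Lambda}$ is the negative discrete (graph) Laplacian of $\Lambda$. For a state (density operator) $\rho$ on $\mathcal H_\Lambda$ in which all $q_x,p_x$ have finite second moments, and with $\langle A\rangle_\rho=\operatorname{Tr}[A\rho]$, let $$\Gamma_\rho=\Big\langle\binom{q}{p}(q^T,p^T)\Big\rangle_\rho-\Big\langle\binom{q}{p}\Big\rangle_\rho\big\langle(q^T,p^T)\big\rangle_\rho,\qquad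 \tilde\Gamma_\rho(t)=\Gamma_{\rho_t},\qquad \rho_t=e^{-itH_\Lambda}\rho\,e^{itH_\Lambda}.$$ For $x,y\in\Lambda$ let $M_{xy}$ be the $2\times2$ matrix formed from the $(x,y)$ entries of the four $\Lambda\times\Lambda$ blocks of a $2|\Lambda|\times2|\Lambda|$ matrix $M$, and let $\|M_{xy}\|$ be its Euclidean operator norm. **Theorem.** Assume that there are constants $C<\infty$, $\eta>0$ and $0<s\le1$ such that, for all finite rectangular boxes $\Lambda$ and all $x,y\in\Lambda$, $$\mathbb E\Big(\sup_{g:\mathbb R\to\mathbb C,\ |g|\le1}\big|\langle\delta_x,h_\Lambda^{-1/2}g(h_\Lambda)\delta_y\rangle\big|^s\Big)\le C e^{-\eta|x-y|}.$$ Let a finite rectangular box $\Lambda$ be the disjoint union of rectangular sub-boxes $\Lambda_1,\dots,\Lambda_M$, and let $\rho_\ell$, $\ell=1,\dots,M$, be (possibly random) states on $\mathcal H_{\Lambda_\ell}$ in which, almost surely, all positions and momenta have finite second moments, with (measurable) correlation matrices satisfying, for some $0\le C'<\infty$ and $\eta'>0$, $$\mathbb E\big(\|(\Gamma_{\rho_\ell})_{xy}\|^s\big)\le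 C'e^{-\eta'|x-y|}\qquad\text{for all }\ell\text{ and all }x,y\in\Lambda_\ell.$$ Let $\rho=\bigotimes_{\ell=1}^M\rho_\ell$ and $\tilde\eta=\frac16\min\{\eta,\eta'\}$. Then almost surely all positions and momenta have finite second moments in $\rho_t$ for every $t\in\mathbb R$, and there is a constant $C''<\infty$ such that $$\mathbb E\Big(\sup_{t\in\mathbb R}\|(\tilde\Gamma_\rho(t))_{xy}\|^{s/3}\Big)\le (C')^{1/3}\,C''\,e^{-\tilde\eta|x-y|}\qquad\text{for all }x,y\in\Lambda.$$ The constant $C''$ depends only on $d$, $\lambda$, $s$, $k_{\max}$, $\tilde\eta$ and $C$; in particular it is independent of $\Lambda$ and of the number $M$ of subsystems. -/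

import Mathlib

open MeasureTheory ProbabilityTheory
open scoped InnerProductSpace SchwartzMap LineDeriv ENNReal

namespace QuenchedOscillators

noncomputable section

/-! ### Lattice geometry and the effective one-particle Hamiltonian -/

/-- The `1`-norm distance `|x - y|` on `ℤ^d`. -/
def l1dist {d : ℕ} (x y : Fin d → ℤ) : ℤ := ∑ i, |x i - y i|

/-- Finite rectangular boxes `([a₁, b₁] × ⋯ × [a_d, b_d]) ∩ ℤ^d`. -/
def IsBox {d : ℕ} (Λ : Finset (Fin d → ℤ)) : Prop :=
  ∃ a b : Fin d → ℤ, Λ = Finset.Icc a b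

/-- The nearest neighbour graph on a finite `Λ ⊂ ℤ^d`: `x ~ y` iff `|x - y| = 1`. -/
def nnGraph {d : ℕ} (Λ : Finset (Fin d → ℤ)) : SimpleGraph Λ where
  Adj x y := l1dist x.1 y.1 = 1
  symm := ⟨fun x y h => by simpa only [l1dist, abs_sub_comm] using h⟩
  loopless := ⟨fun x h => by simp [l1dist] at h⟩

instance {d : ℕ} (Λ : Finset (Fin d → ℤ)) : DecidableRel (nnGraph Λ).Adj :=
  fun x y => inferInstanceAs (Decidable (l1dist x.1 y.1 = 1))

/-- The finite volume Anderson model `h_Λ = λ h_{0,Λ} + k/2`, where `h_{0,Λ}` is the negative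
discrete (graph) Laplacian of `Λ`. -/
def effHam {d : ℕ} (lam : ℝ) (k : (Fin d → ℤ) → ℝ) (Λ : Finset (Fin d → ℤ)) : Matrix Λ Λ ℝ :=
  lam • (nnGraph Λ).lapMatrix ℝ + Matrix.diagonal (fun x : Λ => k x / 2)

theorem effHam_isHermitian {d : ℕ} (lam : ℝ) (k : (Fin d → ℤ) → ℝ) (Λ : Finset (Fin d → ℤ)) :
    (effHam lam k Λ).IsHermitian := by
  have h : (effHam lam k Λ).IsSymm :=
    (((nnGraph Λ).isSymm_lapMatrix (R := ℝ)).smul lam).add (Matrix.isSymm_diagonal _)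
  rw [Matrix.IsHermitian, Matrix.conjTranspose_eq_transpose_of_trivial]
  exact h

/-- Functional calculus of a real symmetric matrix `A`: if `A = O diag(e) Oᵀ` with an orthonormal
basis of eigenvectors as the columns of `O`, then `g(A) = O diag(g(e)) Oᵀ`. -/
def symmFun {n : Type*} [Fintype n] [DecidableEq n] {A : Matrix n n ℝ} (hA : A.IsHermitian)
    (g : ℝ → ℂ) : Matrix n n ℂ :=
  fun x y => ∑ j, (hA.eigenvectorBasis j x : ℂ) * g (hA.eigenvalues j) *
    (hA.eigenvectorBasis j y : ℂ)

/-- `sup_{|g| ≤ 1} |⟨δ_x, h_Λ^{-1/2} g(h_Λ) δ_y⟩|^s`, as an element of `[0, ∞]`. -/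
def singularCorrelator {d : ℕ} (lam s : ℝ) (k : (Fin d → ℤ) → ℝ) (Λ : Finset (Fin d → ℤ))
    (x y : Λ) : ℝ≥0∞ :=
  ⨆ g : {g : ℝ → ℂ // ∀ u, ‖g u‖ ≤ 1},
    ENNReal.ofReal (‖symmFun (effHam_isHermitian lam k Λ)
      (fun u => ((u ^ (-(1 / 2) : ℝ) : ℝ) : ℂ) * g.1 u) x y‖ ^ s)

/-! ### Position, momentum and the oscillator Hamiltonian on `L²(ℝ^ι)` -/

/-- The Hilbert space `L²(ℝ^ι)`. -/
abbrev L2 (ι : Type*) [Fintype ι] := Lp ℂ 2 (volume : Measure (ι → ℝ))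

/-- Multiplication by the coordinate `u_x` on Schwartz functions. -/
def posS {ι : Type*} [Fintype ι] (x : ι) : 𝓢(ι → ℝ, ℂ) →L[ℂ] 𝓢(ι → ℝ, ℂ) :=
  SchwartzMap.smulLeftCLM ℂ (fun u : ι → ℝ => (u x : ℂ))

theorem posS_apply {ι : Type*} [Fintype ι] (x : ι) (η : 𝓢(ι → ℝ, ℂ)) (u : ι → ℝ) :
    posS x η u = (u x : ℂ) * η u := by
  have h : Function.HasTemperateGrowth (fun u : ι → ℝ => (u x : ℂ)) :=
    (Complex.ofRealCLM ∘L
      ContinuousLinearMap.proj (R := ℝ) (φ := fun _ : ι => ℝ) x).hasTemperateGrowth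
  rw [posS, SchwartzMap.smulLeftCLM_apply_apply h, smul_eq_mul]

/-- `-i ∂/∂u_x` on Schwartz functions. -/
def momS {ι : Type*} [Fintype ι] [DecidableEq ι] (x : ι) : 𝓢(ι → ℝ, ℂ) →L[ℂ] 𝓢(ι → ℝ, ℂ) :=
  (-Complex.I) • LineDeriv.lineDerivOpCLM ℂ 𝓢(ι → ℝ, ℂ) (Pi.single x 1 : ι → ℝ)

theorem momS_apply {ι : Type*} [Fintype ι] [DecidableEq ι] (x : ι) (η : 𝓢(ι → ℝ, ℂ))
    (u : ι → ℝ) :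
    momS x η u = -Complex.I * lineDeriv ℝ η u (Pi.single x 1 : ι → ℝ) := by
  simp [momS, SchwartzMap.lineDerivOp_apply]

/-- The Hamiltonian `∑_x (p_x² + k_x/2 q_x²) + ∑_{{x,y} ⊂ Λ, |x-y| = 1} λ (q_x - q_y)²` on Schwartz
functions. The sum over undirected edges is half the sum over ordered pairs. -/
def hamS {d : ℕ} (lam : ℝ) (k : (Fin d → ℤ) → ℝ) (Λ : Finset (Fin d → ℤ)) :
    𝓢(Λ → ℝ, ℂ) →L[ℂ] 𝓢(Λ → ℝ, ℂ) :=
  ∑ x : Λ, (momS x ^ 2 + ((k x / 2 : ℝ) : ℂ) • posS x ^ 2) +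
    (1 / 2 : ℂ) • ∑ x : Λ, ∑ y : Λ,
      if (nnGraph Λ).Adj x y then (lam : ℂ) • (posS x - posS y) ^ 2 else 0

/-- The graph of the `L²`-adjoint of a symmetric operator `A` on Schwartz functions: all `(ψ, χ)`
with `⟨η, χ⟩ = ⟨A η, ψ⟩` for every Schwartz function `η`, i.e. `A ψ = χ` in the weak sense. -/
def weakGraph {ι : Type*} [Fintype ι] (A : 𝓢(ι → ℝ, ℂ) →L[ℂ] 𝓢(ι → ℝ, ℂ)) :
    Submodule ℂ (L2 ι × L2 ι) where
  carrier := {z | ∀ η : 𝓢(ι → ℝ, ℂ), ⟪η.toLp 2, z.2⟫_ℂ = ⟪(A η).toLp 2, z.1⟫_ℂ}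
  add_mem' := fun {a b} ha hb η => by
    simp only [Set.mem_ofPred_eq] at ha hb
    simp only [Prod.fst_add, Prod.snd_add, inner_add_right, ha η, hb η]
  zero_mem' := fun η => by simp
  smul_mem' := fun c a ha η => by
    simp only [Set.mem_ofPred_eq] at ha
    simp only [Prod.smul_fst, Prod.smul_snd, inner_smul_right, ha η]

/-- The realization in `L²(ℝ^ι)` of a differential operator with domain all `ψ ∈ L²` whose weak image
is in `L²`. For an operator that is essentially self-adjoint on Schwartz functions (such as `q_x`,
`p_x` and `H_Λ`) this is its unique self-adjoint extension. -/
def realization {ι : Type*} [Fintype ι] (A : 𝓢(ι → ℝ, ℂ) →L[ℂ] 𝓢(ι → ℝ, ℂ)) :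
    L2 ι →ₗ.[ℂ] L2 ι :=
  (weakGraph A).toLinearPMap

/-- The column `(q, p)` of the position operators (`Sum.inl x`) and the momentum operators
(`Sum.inr x`). -/
def qp {ι : Type*} [Fintype ι] [DecidableEq ι] : ι ⊕ ι → (L2 ι →ₗ.[ℂ] L2 ι) :=
  Sum.elim (fun x => realization (posS x)) (fun x => realization (momS x))

/-- The many-body Hamiltonian `H_Λ` as an unbounded operator on `L²(ℝ^Λ)`. -/
def ham {d : ℕ} (lam : ℝ) (k : (Fin d → ℤ) → ℝ) (Λ : Finset (Fin d → ℤ)) :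
    L2 Λ →ₗ.[ℂ] L2 Λ :=
  realization (hamS lam k Λ)

/-! ### The unitary group of an unbounded operator -/

section Hilbert

variable {E : Type*} [NormedAddCommGroup E] [InnerProductSpace ℂ E] [CompleteSpace E]

/-- `U` is the strongly continuous unitary group with generator `H`, that is `U t = e^{-itH}`
(such a `U` exists, and is unique, precisely for self-adjoint `H`). -/
structure IsUnitaryGroup (H : E →ₗ.[ℂ] E) (U : ℝ → E →L[ℂ] E) : Prop where
  zero : U 0 = 1
  add : ∀ t t', U (t + t') = U t * U t'
  unitary : ∀ t, U t ∈ _root_.unitary (E →L[ℂ] E)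
  continuous : ∀ ψ, Continuous fun t => U t ψ
  generator : ∀ ψ χ, (ψ, χ) ∈ H.graph ↔ HasDerivAt (fun t => U t ψ) (-Complex.I • χ) 0

open Classical in
/-- `e^{-itH}` (the value `1` is only a convention for operators that are not self-adjoint). -/
def expGroup (H : E →ₗ.[ℂ] E) (t : ℝ) : E →L[ℂ] E :=
  if h : ∃ U, IsUnitaryGroup H U then h.choose t else 1

/-! ### States and expectations -/

/-- Index set of a fixed orthonormal (Hilbert) basis of `E`. -/
def basisIndex (E : Type*) [NormedAddCommGroup E] [InnerProductSpace ℂ E] [CompleteSpace E] :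
    Set E :=
  (exists_hilbertBasis ℂ E).choose

/-- A fixed orthonormal basis of `E`, used to write down traces. -/
def basis (E : Type*) [NormedAddCommGroup E] [InnerProductSpace ℂ E] [CompleteSpace E] :
    HilbertBasis (basisIndex E) ℂ E :=
  (exists_hilbertBasis ℂ E).choose_spec.choose

/-- States, given by density operators: non-negative operators with trace `1`. -/
def IsState (ρ : E →L[ℂ] E) : Prop :=
  ρ.IsPositive ∧ HasSum (fun i => ⟪basis E i, ρ (basis E i)⟫_ℂ) 1

open Classical in
/-- `A ψ`, with value `0` outside the domain of `A`. -/
def app (A : E →ₗ.[ℂ] E) (ψ : E) : E := if h : ψ ∈ A.domain then A ⟨ψ, h⟩ else 0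

/-- `Tr[A² ρ] < ∞`, for self-adjoint `A`: the operator `A √ρ` is everywhere defined and
Hilbert-Schmidt. -/
def HasSecondMoment (A : E →ₗ.[ℂ] E) (ρ : E →L[ℂ] E) : Prop :=
  (∀ ψ, CFC.sqrt ρ ψ ∈ A.domain) ∧ Summable fun i => ‖app A (CFC.sqrt ρ (basis E i))‖ ^ 2

/-- `⟨A⟩_ρ = Tr[A ρ] = Tr[√ρ (A √ρ)]`. -/
def expect (ρ : E →L[ℂ] E) (A : E →ₗ.[ℂ] E) : ℂ :=
  ∑' i, ⟪CFC.sqrt ρ (basis E i), app A (CFC.sqrt ρ (basis E i))⟫_ℂ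

/-- `⟨A B⟩_ρ = Tr[A B ρ] = Tr[(A √ρ)^* (B √ρ)]` for self-adjoint `A` and `B` with second moments
in `ρ`. -/
def expectMul (ρ : E →L[ℂ] E) (A B : E →ₗ.[ℂ] E) : ℂ :=
  ∑' i, ⟪app A (CFC.sqrt ρ (basis E i)), app B (CFC.sqrt ρ (basis E i))⟫_ℂ

end Hilbert

/-- All positions and momenta have finite second moments in `ρ`, so that its correlation matrix is
well-defined. -/
def HasSecondMoments {ι : Type*} [Fintype ι] [DecidableEq ι] (ρ : L2 ι →L[ℂ] L2 ι) : Prop :=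
  ∀ a : ι ⊕ ι, HasSecondMoment (qp a) ρ

/-- The static position-momentum correlation matrix
`Γ_ρ = ⟨(q, p)ᵀ (q, p)⟩_ρ - ⟨(q, p)ᵀ⟩_ρ ⟨(q, p)⟩_ρ`. -/
def corrMatrix {ι : Type*} [Fintype ι] [DecidableEq ι] (ρ : L2 ι →L[ℂ] L2 ι) :
    Matrix (ι ⊕ ι) (ι ⊕ ι) ℂ :=
  fun a b => expectMul ρ (qp a) (qp b) - expect ρ (qp a) * expect ρ (qp b)

/-- The `2 × 2` sub-matrix `M_{xy}` of a block matrix. -/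
def block {ι : Type*} (M : Matrix (ι ⊕ ι) (ι ⊕ ι) ℂ) (x y : ι) : Matrix (Fin 2) (Fin 2) ℂ :=
  !![M (Sum.inl x) (Sum.inl y), M (Sum.inl x) (Sum.inr y);
     M (Sum.inr x) (Sum.inl y), M (Sum.inr x) (Sum.inr y)]

/-- `‖M_{xy}‖`, the Euclidean operator norm. -/
def blockNorm {ι : Type*} (M : Matrix (ι ⊕ ι) (ι ⊕ ι) ℂ) (x y : ι) : ℝ :=
  ‖Matrix.toEuclideanCLM (n := Fin 2) (𝕜 := ℂ) (block M x y)‖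

/-- The Schrödinger evolution `ρ_t = e^{-itH_Λ} ρ e^{itH_Λ}`. -/
def evolve {d : ℕ} (lam : ℝ) (k : (Fin d → ℤ) → ℝ) (Λ : Finset (Fin d → ℤ))
    (ρ : L2 Λ →L[ℂ] L2 Λ) (t : ℝ) : L2 Λ →L[ℂ] L2 Λ :=
  expGroup (ham lam k Λ) t * ρ * expGroup (ham lam k Λ) (-t)

/-! ### Decompositions into sub-boxes and product states -/

/-- A decomposition of `Λ` into `M` pairwise disjoint rectangular sub-boxes. -/
structure BoxDecomposition {d : ℕ} (Λ : Finset (Fin d → ℤ)) (M : ℕ) where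
  part : Fin M → Finset (Fin d → ℤ)
  isBox : ∀ l, IsBox (part l)
  disjoint : Pairwise fun l l' => Disjoint (part l) (part l')
  union : Finset.univ.biUnion part = Λ

namespace BoxDecomposition

variable {d : ℕ} {Λ : Finset (Fin d → ℤ)} {M : ℕ} (D : BoxDecomposition Λ M)

theorem part_subset (l : Fin M) : D.part l ⊆ Λ :=
  (Finset.subset_biUnion_of_mem D.part (Finset.mem_univ l)).trans D.union.subset

/-- `Ψ = ⨂_l ψ_l` in `L²(ℝ^Λ) = ⨂_l L²(ℝ^{Λ_l})`: `Ψ(u) = ∏_l ψ_l(u|_{Λ_l})` almost everywhere. -/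
def IsTensor (ψ : ∀ l, L2 (D.part l)) (Ψ : L2 Λ) : Prop :=
  ∀ᵐ u : Λ → ℝ, Ψ u = ∏ l, ψ l (Finset.restrict₂ (π := fun _ => ℝ) (D.part_subset l) u)

/-- `T = ⨂_l T_l`: `T (⨂_l ψ_l) = ⨂_l T_l ψ_l` for all `ψ_l`. -/
def IsTensorOp (T : ∀ l, L2 (D.part l) →L[ℂ] L2 (D.part l)) (S : L2 Λ →L[ℂ] L2 Λ) : Prop :=
  ∀ (ψ : ∀ l, L2 (D.part l)) (Ψ Ψ' : L2 Λ),
    D.IsTensor ψ Ψ → D.IsTensor (fun l => T l (ψ l)) Ψ' → S Ψ = Ψ'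

open Classical in
/-- The operator `⨂_l T_l` on `L²(ℝ^Λ)`: the unique bounded operator with
`T (⨂_l ψ_l) = ⨂_l T_l ψ_l` for all `ψ_l`. -/
def tensorOp (T : ∀ l, L2 (D.part l) →L[ℂ] L2 (D.part l)) : L2 Λ →L[ℂ] L2 Λ :=
  if h : ∃ S, D.IsTensorOp T S then h.choose else 0

end BoxDecomposition

end

end QuenchedOscillators

/-!
The Hamiltonian is quadratic, so the Heisenberg equations for positions and momenta are linear and are
solved by the real matrix `flowMatrix`, with blocks `cos (2t√h)`, `h^{-1/2} sin (2t√h)` and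
`-√h sin (2t√h)` for the effective Hamiltonian `h`. Hence the correlation matrix evolves by
`Γ ↦ M(t) Γ M(t)ᵀ` (`corrMatrix_evolve`). On the spectrum of `h`, which is contained in a fixed
interval `(0, e]` almost surely, all entries of `M(t)` are of the form `u^{-1/2} g(u)` with `g` bounded
uniformly in `t`, so that the singular eigenfunction correlators dominate `sup_t ‖M(t)_{xz}‖^s`
(`ofReal_blockNorm_flowMatrix_le`). The initial product state has no correlations between different
sub-boxes (`corrMatrix_tensorOp_of_ne`) and those of its factors within a sub-box
(`corrMatrix_tensorOp_self`). As `s / 3 ≤ 1`, the `s / 3`-th power of `‖(M Γ Mᵀ)_{xy}‖` is at most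
`∑_{z,w} ‖M_{xz}‖^{s/3} ‖Γ_{zw}‖^{s/3} ‖(Mᵀ)_{wy}‖^{s/3}`, and Hölder's inequality with three exponents
`1/3` reduces the expectation to the assumed decay; half of the decay rate pays for the sums over `z`
and `w` (`lintegral_sum_sum_le`).

The operator theory behind `corrMatrix_evolve` rests on Gaussian wave packets
`exp (-½ u·Bu + z·u)`, which are total in `L²` (`total_gauss`). Multiplication by `e^{isq}`,
translations and, for `B = √h`, the Schrödinger evolution permute them up to scalar factors. A symmetric
operator with such an invariant total family generates a unitary group whose generator is its maximal
weak realization, and the weak equation may be tested on the family only (`CoreFlow.exists_group`,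
`CoreFlow.weak_iff_hasDerivAt`, `CoreFlow.weak_of_core`). The Heisenberg equations (`heisenberg`) thus
have to be verified on wave packets, where they follow by differentiating the explicit evolution in the
parameter `z`. Second moments are Hilbert-Schmidt norms of the operators `A √ρ`, which are independent
of the basis and unitarily invariant; in particular `√(UρU^*) = U √ρ U^*`. For product states,
`√(⨂ ρ_l) = ⨂ √ρ_l`, and Hilbert-Schmidt inner products of tensor products of operators factorize
(`IsTensorMap.hsInner_map`).
-/

namespace QuenchedOscillators

noncomputable section

set_option linter.unusedSectionVars false

/-! ### Unitary groups generated by symmetric operators with an invariant total family -/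

section AbstractGroup

variable {E F : Type*} [NormedAddCommGroup E] [InnerProductSpace ℂ E] [CompleteSpace E]
  [NormedAddCommGroup F] [InnerProductSpace ℂ F] [CompleteSpace F]

/-- The linear span of the family `v` is dense. -/
def Total {X : Type*} (v : X → E) : Prop :=
  Dense (Submodule.span ℂ (Set.range v) : Set E)

theorem Total.eq_zero {X : Type*} {v : X → E} (hv : Total v) {ψ : E}
    (h : ∀ x, ⟪v x, ψ⟫_ℂ = 0) : ψ = 0 := by
  refine hv.eq_zero_of_inner_right (𝕜 := ℂ) fun w hw => ?_
  induction hw using Submodule.span_induction with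
  | mem x hx => obtain ⟨y, rfl⟩ := hx; exact h y
  | zero => simp
  | add x y _ _ hx hy => rw [inner_add_left, hx, hy, add_zero]
  | smul a x _ hx => rw [inner_smul_left, hx, mul_zero]

theorem Total.ext_inner {X : Type*} {v : X → E} (hv : Total v) {ψ χ : E}
    (h : ∀ x, ⟪v x, ψ⟫_ℂ = ⟪v x, χ⟫_ℂ) : ψ = χ :=
  sub_eq_zero.1 <| hv.eq_zero fun x => by rw [inner_sub_right, h, sub_self]

theorem Total.of_forall_eq_zero {X : Type*} {v : X → E}
    (h : ∀ ψ, (∀ x, ⟪v x, ψ⟫_ℂ = 0) → ψ = 0) : Total v := by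
  rw [Total, Submodule.dense_iff_topologicalClosure_eq_top,
    Submodule.topologicalClosure_eq_top_iff, Submodule.eq_bot_iff]
  intro ψ hψ
  exact h ψ fun x => (Submodule.mem_orthogonal _ _).1 hψ _
    (Submodule.subset_span (Set.mem_range_self x))

theorem Total.clm_ext {X : Type*} {v : X → E} (hv : Total v) {S T : E →L[ℂ] F}
    (h : ∀ x, S (v x) = T (v x)) : S = T :=
  ContinuousLinearMap.ext_on hv (by rintro _ ⟨x, rfl⟩; exact h x)

/-- A bounded operator can be prescribed on a total family if the norm bound holds on finite linear
combinations. -/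
theorem Total.exists_clm {X : Type*} {v : X → E} (hv : Total v) (w : X → F) (K : ℝ)
    (h : ∀ f : X →₀ ℂ, ‖Finsupp.linearCombination ℂ w f‖ ≤
      K * ‖Finsupp.linearCombination ℂ v f‖) :
    ∃ T : E →L[ℂ] F, ∀ x, T (v x) = w x := by
  have hd : DenseRange (Finsupp.linearCombination ℂ v) := by
    have := hv
    rw [Total, ← Finsupp.range_linearCombination] at this
    exact this
  refine ⟨(Finsupp.linearCombination ℂ w).extendOfNorm (Finsupp.linearCombination ℂ v), fun x => ?_⟩
  have := LinearMap.extendOfNorm_eq (f := Finsupp.linearCombination ℂ w) hd ⟨K, h⟩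
    (Finsupp.single x 1)
  simpa using this

theorem norm_sq_linearCombination {X : Type*} (v : X → E) (f : X →₀ ℂ) :
    ((‖Finsupp.linearCombination ℂ v f‖ ^ 2 : ℝ) : ℂ) =
      ∑ x ∈ f.support, ∑ y ∈ f.support, (starRingEnd ℂ (f x)) * f y * ⟪v x, v y⟫_ℂ := by
  have := inner_self_eq_norm_sq_to_K (𝕜 := ℂ) (Finsupp.linearCombination ℂ v f)
  rw [Complex.ofReal_pow]
  refine this.symm.trans ?_
  rw [Finsupp.linearCombination_apply, Finsupp.sum, sum_inner]
  refine Finset.sum_congr rfl fun x _ => ?_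
  rw [inner_sum]
  refine Finset.sum_congr rfl fun y _ => ?_
  rw [inner_smul_left, inner_smul_right]; ring

theorem Total.exists_isometry {X : Type*} {v : X → E} (hv : Total v) (w : X → F)
    (h : ∀ x y, ⟪w x, w y⟫_ℂ = ⟪v x, v y⟫_ℂ) :
    ∃ T : E →L[ℂ] F, (∀ x, T (v x) = w x) ∧ ∀ ψ χ, ⟪T ψ, T χ⟫_ℂ = ⟪ψ, χ⟫_ℂ := by
  obtain ⟨T, hT⟩ := hv.exists_clm w 1 fun f => by
    have h1 := norm_sq_linearCombination w f
    simp only [h] at h1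
    rw [← norm_sq_linearCombination v f] at h1
    have h2 := Complex.ofReal_injective h1
    rw [one_mul, (sq_eq_sq₀ (norm_nonneg _) (norm_nonneg _)).1 h2]
  refine ⟨T, hT, fun ψ χ => ?_⟩
  have key : T.adjoint ∘L T = ContinuousLinearMap.id ℂ E := by
    refine hv.clm_ext fun y => hv.ext_inner fun x => ?_
    simp [ContinuousLinearMap.adjoint_inner_right, hT, h]
  calc ⟪T ψ, T χ⟫_ℂ = ⟪ψ, (T.adjoint ∘L T) χ⟫_ℂ := by
        simp [ContinuousLinearMap.adjoint_inner_right]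
    _ = _ := by rw [key]; rfl

theorem IsUnitaryGroup.inner_map_map {H : E →ₗ.[ℂ] E} {U : ℝ → E →L[ℂ] E}
    (hU : IsUnitaryGroup H U) (t : ℝ) (ψ χ : E) : ⟪U t ψ, U t χ⟫_ℂ = ⟪ψ, χ⟫_ℂ := by
  have h : (U t).adjoint * U t = 1 := (hU.unitary t).1
  calc ⟪U t ψ, U t χ⟫_ℂ = ⟪ψ, ((U t).adjoint * U t) χ⟫_ℂ := by
        simp [ContinuousLinearMap.adjoint_inner_right]
    _ = _ := by rw [h]; rfl

theorem IsUnitaryGroup.neg_apply_apply {H : E →ₗ.[ℂ] E} {U : ℝ → E →L[ℂ] E}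
    (hU : IsUnitaryGroup H U) (t : ℝ) (ψ : E) : U (-t) (U t ψ) = ψ := by
  have := hU.add (-t) t
  rw [neg_add_cancel, hU.zero] at this
  exact (DFunLike.congr_fun this ψ).symm

theorem IsUnitaryGroup.inner_left {H : E →ₗ.[ℂ] E} {U : ℝ → E →L[ℂ] E}
    (hU : IsUnitaryGroup H U) (t : ℝ) (ψ χ : E) : ⟪ψ, U t χ⟫_ℂ = ⟪U (-t) ψ, χ⟫_ℂ := by
  have := hU.inner_map_map t (U (-t) ψ) χ
  rw [← this]
  congr 1
  simpa using (hU.neg_apply_apply (-t) ψ).symm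

theorem IsUnitaryGroup.adjoint_eq {H : E →ₗ.[ℂ] E} {U : ℝ → E →L[ℂ] E}
    (hU : IsUnitaryGroup H U) (t : ℝ) : (U t).adjoint = U (-t) := by
  refine ContinuousLinearMap.ext fun χ => ext_inner_right ℂ fun ψ => ?_
  rw [ContinuousLinearMap.adjoint_inner_left, hU.inner_left]

theorem IsUnitaryGroup.hasDerivAt {H : E →ₗ.[ℂ] E} {U : ℝ → E →L[ℂ] E}
    (hU : IsUnitaryGroup H U) {ψ χ : E} (h : (ψ, χ) ∈ H.graph) (t : ℝ) :
    HasDerivAt (fun t => U t ψ) (-Complex.I • U t χ) t := by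
  have h0 := (hU.generator ψ χ).1 h
  have h1 : HasDerivAt (fun s => U (s - t) ψ) (-Complex.I • χ) t := by
    have := HasDerivAt.scomp (𝕜 := ℝ) (g₁ := fun t => U t ψ) (h := fun s => s - t) t (by
      simpa using h0) ((hasDerivAt_id t).sub_const t)
    simpa [Function.comp_def] using this
  have h2 := ((U t).restrictScalars ℝ).hasFDerivAt.comp_hasDerivAt t h1
  have h3 : (((U t).restrictScalars ℝ) ∘ fun s => U (s - t) ψ) = fun s => U s ψ := by
    funext s
    have := DFunLike.congr_fun (hU.add t (s - t)) ψ
    rw [add_sub_cancel] at this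
    exact this.symm
  rw [h3] at h2
  simpa using h2

/-- A unitary group is determined by its generator. -/
theorem IsUnitaryGroup.unique {H : E →ₗ.[ℂ] E} (hd : Dense (H.domain : Set E))
    {U V : ℝ → E →L[ℂ] E} (hU : IsUnitaryGroup H U) (hV : IsUnitaryGroup H V) : U = V := by
  funext t
  refine ContinuousLinearMap.ext_on (s := (H.domain : Set E)) (by simpa using hd) fun ψ hψ => ?_
  refine ext_inner_left ℂ fun ξ => ?_
  obtain ⟨χ, hχ⟩ : ∃ χ, (ψ, χ) ∈ H.graph := ⟨H ⟨ψ, hψ⟩, H.mem_graph ⟨ψ, hψ⟩⟩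
  refine hd.induction (P := fun ξ => ⟪ξ, U t ψ⟫_ℂ = ⟪ξ, V t ψ⟫_ℂ) ?_ ?_ ξ
  · intro ξ hξ
    obtain ⟨ζ, hζ⟩ : ∃ ζ, (ξ, ζ) ∈ H.graph := ⟨H ⟨ξ, hξ⟩, H.mem_graph ⟨ξ, hξ⟩⟩
    -- `s ↦ ⟪U (s - t) ξ, V s ψ⟫` is constant
    have symm : ∀ {a b a' b' : E}, (a, b) ∈ H.graph → (a', b') ∈ H.graph →
        ⟪b, a'⟫_ℂ = ⟪a, b'⟫_ℂ := by
      intro a b a' b' h h'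
      have h1 := (hU.hasDerivAt h 0).inner ℂ (hU.hasDerivAt h' 0)
      simp only [hU.inner_map_map] at h1
      have h2 := h1.unique (hasDerivAt_const _ _)
      simp only [inner_smul_right, inner_smul_left, hU.inner_map_map] at h2
      have : Complex.I * (⟪b, a'⟫_ℂ - ⟪a, b'⟫_ℂ) = 0 := by
        rw [← h2]; simp; ring
      exact sub_eq_zero.1 ((mul_eq_zero.1 this).resolve_left Complex.I_ne_zero)
    have gr : ∀ {a b : E} (s : ℝ), (a, b) ∈ H.graph → (V s a, V s b) ∈ H.graph := by
      intro a b s h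
      rw [hV.generator]
      have h1 := (hV.hasDerivAt h s)
      have h2 : HasDerivAt (fun r => V (r + s) a) (-Complex.I • V s b) 0 := by
        have := HasDerivAt.scomp (𝕜 := ℝ) (g₁ := fun t => V t a) (h := fun r => r + s) 0 (by
          simpa using h1) ((hasDerivAt_id 0).add_const s)
        simpa [Function.comp_def] using this
      simpa only [hV.add, mul_apply_eq_comp] using h2
    have hder : ∀ s, HasDerivAt (fun s => ⟪ξ, U (t - s) (V s ψ)⟫_ℂ) 0 s := by
      intro s
      have e : (fun s => ⟪ξ, U (t - s) (V s ψ)⟫_ℂ) = fun s => ⟪U (s - t) ξ, V s ψ⟫_ℂ := by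
        funext s
        rw [hU.inner_left, neg_sub]
      rw [e]
      have h1 : HasDerivAt (fun s => U (s - t) ξ) (-Complex.I • U (s - t) ζ) s := by
        have := HasDerivAt.scomp (𝕜 := ℝ) (g₁ := fun t => U t ξ) (h := fun s => s - t) s
          (hU.hasDerivAt hζ (s - t)) ((hasDerivAt_id s).sub_const t)
        simpa [Function.comp_def] using this
      have h2 := h1.inner ℂ (hV.hasDerivAt hχ s)
      convert! h2 using 1
      rw [inner_smul_left, inner_smul_right]
      have grU : (U (s - t) ξ, U (s - t) ζ) ∈ H.graph := by
        rw [hU.generator]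
        have h1 := (hU.hasDerivAt hζ (s - t))
        have h2 : HasDerivAt (fun r => U (r + (s - t)) ξ) (-Complex.I • U (s - t) ζ) 0 := by
          have := HasDerivAt.scomp (𝕜 := ℝ) (g₁ := fun t => U t ξ) (h := fun r => r + (s - t)) 0 (by
            simpa using h1) ((hasDerivAt_id 0).add_const (s - t))
          simpa [Function.comp_def] using this
        simpa only [hU.add, mul_apply_eq_comp] using h2
      rw [symm grU (gr s hχ)]
      simp
    have hc := is_const_of_deriv_eq_zero (f := fun s => ⟪ξ, U (t - s) (V s ψ)⟫_ℂ)
      (fun s => (hder s).differentiableAt) (fun s => (hder s).deriv) 0 t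
    simpa [hU.zero, hV.zero] using hc
  · exact isClosed_eq (by fun_prop) (by fun_prop)

/-- The weak form of `A ψ = χ`, for an operator `A` on a space `S` of test vectors embedded by `j`
into a Hilbert space. -/
def WeakPair {S : Type*} [AddCommGroup S] [Module ℂ S] (j : S →ₗ[ℂ] E) (A : S →ₗ[ℂ] S)
    (ψ χ : E) : Prop :=
  ∀ η : S, ⟪j η, χ⟫_ℂ = ⟪j (A η), ψ⟫_ℂ

/-- A symmetric operator `A` on test vectors and a total family `c` of test vectors that is permuted,
up to scalar factors, by the solutions `κ t x • c (φ t x)` of the Schrödinger equation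
`i ∂ₜ w = A w`. -/
structure CoreFlow {S X : Type*} [AddCommGroup S] [Module ℂ S] (j : S →ₗ[ℂ] E) (A : S →ₗ[ℂ] S)
    (c : X → S) (φ : ℝ → X → X) (κ : ℝ → X → ℂ) : Prop where
  total : Total fun x => j (c x)
  symm : ∀ η ξ, ⟪j (A η), j ξ⟫_ℂ = ⟪j η, j (A ξ)⟫_ℂ
  φ_zero : ∀ x, φ 0 x = x
  φ_add : ∀ s t x, φ (s + t) x = φ s (φ t x)
  κ_zero : ∀ x, κ 0 x = 1
  κ_add : ∀ s t x, κ (s + t) x = κ s (φ t x) * κ t x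
  deriv : ∀ x, HasDerivAt (fun t => κ t x • j (c (φ t x))) (-Complex.I • j (A (c x))) 0

namespace CoreFlow

variable {S X : Type*} [AddCommGroup S] [Module ℂ S] {j : S →ₗ[ℂ] E} {A : S →ₗ[ℂ] S}
    {c : X → S} {φ : ℝ → X → X} {κ : ℝ → X → ℂ}

theorem hasDerivAt (h : CoreFlow j A c φ κ) (x : X) (t : ℝ) :
    HasDerivAt (fun t => κ t x • j (c (φ t x))) (-Complex.I • j (A (κ t x • c (φ t x)))) t := by
  have h1 : HasDerivAt (fun s => κ (s - t) (φ t x) • j (c (φ (s - t) (φ t x))))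
      (-Complex.I • j (A (c (φ t x)))) t := by
    have := HasDerivAt.scomp (𝕜 := ℝ) (g₁ := fun s => κ s (φ t x) • j (c (φ s (φ t x))))
      (h := fun s => s - t) t (by simpa using h.deriv (φ t x)) ((hasDerivAt_id t).sub_const t)
    simpa [Function.comp_def] using this
  have h2 := h1.const_smul (κ t x)
  refine (h2.congr_deriv ?_).congr_of_eventuallyEq (Filter.Eventually.of_forall fun s => ?_)
  · simp only [map_smul, smul_comm (κ t x)]
  · simp only [Pi.smul_apply, smul_smul]
    rw [mul_comm, ← h.κ_add, ← h.φ_add, sub_add_cancel]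

theorem inner_flow (h : CoreFlow j A c φ κ) (t : ℝ) (x y : X) :
    ⟪κ t x • j (c (φ t x)), κ t y • j (c (φ t y))⟫_ℂ = ⟪j (c x), j (c y)⟫_ℂ := by
  have hder : ∀ t, HasDerivAt (fun t => ⟪κ t x • j (c (φ t x)), κ t y • j (c (φ t y))⟫_ℂ) 0 t := by
    intro t
    have h2 := (h.hasDerivAt x t).inner ℂ (h.hasDerivAt y t)
    convert! h2 using 1
    rw [← map_smul j (κ t x), ← map_smul j (κ t y)]
    generalize κ t x • c (φ t x) = a
    generalize κ t y • c (φ t y) = b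
    rw [inner_smul_right, inner_smul_left, h.symm]
    simp
  have hc := is_const_of_deriv_eq_zero
    (fun s => (hder s).differentiableAt) (fun s => (hder s).deriv) t 0
  simpa [h.κ_zero, h.φ_zero] using hc

/-- The solution operators of the Schrödinger equation on the total family extend to a unitary
group; the group law and strong continuity are checked on the family. -/
theorem exists_group (h : CoreFlow j A c φ κ) :
    ∃ U : ℝ → E →L[ℂ] E, U 0 = 1 ∧ (∀ t t', U (t + t') = U t * U t') ∧
      (∀ t, U t ∈ unitary (E →L[ℂ] E)) ∧ (∀ ψ, Continuous fun t => U t ψ) ∧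
      ∀ t x, U t (j (c x)) = κ t x • j (c (φ t x)) := by
  choose U hU hiso using fun t => h.total.exists_isometry
    (fun x => κ t x • j (c (φ t x))) (h.inner_flow t)
  have hadd : ∀ t t', U (t + t') = U t * U t' := fun t t' => by
    refine h.total.clm_ext fun x => ?_
    simp only [mul_apply_eq_comp, hU, map_smul, h.κ_add, h.φ_add, smul_smul]
    rw [mul_comm]
  have hzero : U 0 = 1 := h.total.clm_ext fun x => by simp [hU, h.κ_zero, h.φ_zero]
  have hnorm : ∀ t ψ, ‖U t ψ‖ = ‖ψ‖ := fun t ψ => by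
    have := hiso t ψ ψ
    rw [inner_self_eq_norm_sq_to_K, inner_self_eq_norm_sq_to_K] at this
    exact (sq_eq_sq₀ (norm_nonneg _) (norm_nonneg _)).1 (by exact_mod_cast this)
  have hadj : ∀ t, (U t).adjoint * U t = 1 := fun t =>
    ContinuousLinearMap.ext fun χ => ext_inner_left ℂ fun ψ => by
      simp [ContinuousLinearMap.adjoint_inner_right, hiso]
  refine ⟨U, hzero, hadd, fun t => ?_, fun ψ => ?_, hU⟩
  · rw [Unitary.mem_iff]
    have hinv : U t * U (-t) = 1 := by rw [← hadd, add_neg_cancel, hzero]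
    have : (U t).adjoint = U (-t) := by
      calc (U t).adjoint = (U t).adjoint * (U t * U (-t)) := by rw [hinv, mul_one]
        _ = _ := by rw [← mul_assoc, hadj, one_mul]
    exact ⟨hadj t, by rw [ContinuousLinearMap.star_eq_adjoint, this, hinv]⟩
  · -- the set of `ψ` with continuous orbit is a closed subspace
    refine h.total.induction (P := fun ψ => Continuous fun t => U t ψ) ?_ ?_ ψ
    · intro ψ hψ
      induction hψ using Submodule.span_induction with
      | mem x hx =>
        obtain ⟨y, rfl⟩ := hx
        simp only [hU]
        exact continuous_iff_continuousAt.2 fun t => (h.hasDerivAt y t).continuousAt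
      | zero => simpa using continuous_const
      | add x y _ _ hx hy => simp only [map_add]; exact hx.add hy
      | smul a x _ hx => simp only [map_smul]; exact hx.const_smul a
    · rw [← isSeqClosed_iff_isClosed]
      intro u ψ hu hψ
      refine TendstoUniformly.continuous (F := fun n t => U t (u n)) (p := Filter.atTop) ?_
        (Filter.Eventually.of_forall hu).frequently
      rw [Metric.tendstoUniformly_iff]
      intro ε hε
      filter_upwards [(Metric.tendsto_nhds.1 hψ) ε hε] with n hn t
      rw [dist_comm, dist_eq_norm, ← map_sub, hnorm, ← dist_eq_norm]
      exact hn

/-- The generator of the group is the maximal weak realization of `A`, and testing the weak equation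
on the total family suffices. -/
theorem weak_iff_hasDerivAt (h : CoreFlow j A c φ κ) {U : ℝ → E →L[ℂ] E} (hzero : U 0 = 1)
    (hadd : ∀ t t', U (t + t') = U t * U t') (huni : ∀ t, U t ∈ unitary (E →L[ℂ] E))
    (hcont : ∀ ψ, Continuous fun t => U t ψ)
    (hU : ∀ t x, U t (j (c x)) = κ t x • j (c (φ t x))) (ψ χ : E) :
    (WeakPair j A ψ χ ↔ HasDerivAt (fun t => U t ψ) (-Complex.I • χ) 0) ∧
    ((∀ x, ⟪j (c x), χ⟫_ℂ = ⟪j (A (c x)), ψ⟫_ℂ) → WeakPair j A ψ χ) := by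
  have hiso : ∀ t ψ χ, ⟪U t ψ, U t χ⟫_ℂ = ⟪ψ, χ⟫_ℂ := fun t ψ χ => by
    have h : (U t).adjoint * U t = 1 := (huni t).1
    calc ⟪U t ψ, U t χ⟫_ℂ = ⟪ψ, ((U t).adjoint * U t) χ⟫_ℂ := by
          simp [ContinuousLinearMap.adjoint_inner_right]
      _ = _ := by rw [h]; rfl
  have hleft : ∀ t ψ χ, ⟪ψ, U t χ⟫_ℂ = ⟪U (-t) ψ, χ⟫_ℂ := fun t ψ χ => by
    rw [← hiso t (U (-t) ψ) χ, ← mul_apply_eq_comp, ← hadd, add_neg_cancel, hzero]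
    rfl
  have core : ∀ ψ χ, (∀ x, ⟪j (c x), χ⟫_ℂ = ⟪j (A (c x)), ψ⟫_ℂ) →
      HasDerivAt (fun t => U t ψ) (-Complex.I • χ) 0 := by
    intro ψ χ hw
    have hint : ∀ t, U t ψ = ψ + -Complex.I • ∫ s in (0 : ℝ)..t, U s χ := by
      intro t
      refine h.total.ext_inner fun x => ?_
      have h1 : ∀ t, HasDerivAt (fun t => ⟪j (c x), ψ + -Complex.I • ∫ s in (0 : ℝ)..t, U s χ⟫_ℂ)
          ⟪j (c x), -Complex.I • U t χ⟫_ℂ t := fun t => by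
        have h1 := ((hcont χ).integral_hasStrictDerivAt 0 t).hasDerivAt
        have h2 := (h1.const_smul (-Complex.I)).const_add ψ
        refine ((hasDerivAt_const t (j (c x))).inner ℂ h2).congr_deriv ?_
        rw [inner_zero_left, add_zero]
      have h2 : ∀ t, HasDerivAt (fun t => ⟪j (c x), U t ψ⟫_ℂ) ⟪j (c x), -Complex.I • U t χ⟫_ℂ t := by
        intro t
        have e : (fun t => ⟪j (c x), U t ψ⟫_ℂ) = fun t => ⟪κ (-t) x • j (c (φ (-t) x)), ψ⟫_ℂ := by
          funext t; rw [hleft, hU]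
        rw [e]
        have h3 : HasDerivAt (fun t => κ (-t) x • j (c (φ (-t) x)))
            (Complex.I • j (A (κ (-t) x • c (φ (-t) x)))) t := by
          have := HasDerivAt.scomp (𝕜 := ℝ) (h := fun s : ℝ => -s) t (h.hasDerivAt x (-t))
            (hasDerivAt_neg t)
          simpa [Function.comp_def] using this
        have h4 := h3.inner ℂ (hasDerivAt_const t ψ)
        convert! h4 using 1
        rw [inner_smul_right, hleft, hU, inner_zero_right, zero_add, inner_smul_left, map_smul,
          map_smul, inner_smul_left, inner_smul_left, hw, Complex.conj_I]
      have h3 := fun t => (h2 t).sub (h1 t)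
      have hc := is_const_of_deriv_eq_zero
        (fun s => (h3 s).differentiableAt) (fun s => by simpa using (h3 s).deriv) t 0
      simp only [Pi.sub_apply, intervalIntegral.integral_same, smul_zero, add_zero, hzero,
        one_apply_eq_self, sub_self] at hc
      exact sub_eq_zero.1 hc
    have h1 := ((hcont χ).integral_hasStrictDerivAt 0 0).hasDerivAt
    have h2 := (h1.const_smul (-Complex.I)).const_add ψ
    rw [hzero] at h2
    exact h2.congr_of_eventuallyEq (Filter.Eventually.of_forall hint)
  have symm : ∀ {a b a' b' : E}, HasDerivAt (fun t => U t a) (-Complex.I • b) 0 →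
      HasDerivAt (fun t => U t a') (-Complex.I • b') 0 → ⟪b, a'⟫_ℂ = ⟪a, b'⟫_ℂ := by
    intro a b a' b' h h'
    have h1 := h.inner ℂ h'
    simp only [hiso, hzero] at h1
    have h2 := h1.unique (hasDerivAt_const _ _)
    simp only [inner_smul_right, inner_smul_left, one_apply_eq_self] at h2
    have : Complex.I * (⟪b, a'⟫_ℂ - ⟪a, b'⟫_ℂ) = 0 := by
      rw [← h2]; simp; ring
    exact sub_eq_zero.1 ((mul_eq_zero.1 this).resolve_left Complex.I_ne_zero)
  have back : HasDerivAt (fun t => U t ψ) (-Complex.I • χ) 0 → WeakPair j A ψ χ := fun hd η =>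
    (symm (core (j η) (j (A η)) fun x => (h.symm _ _).symm) hd).symm
  exact ⟨⟨fun hw => core ψ χ fun x => hw (c x), back⟩, fun hw => back (core ψ χ hw)⟩

theorem weak_of_core (h : CoreFlow j A c φ κ) {ψ χ : E}
    (hw : ∀ x, ⟪j (c x), χ⟫_ℂ = ⟪j (A (c x)), ψ⟫_ℂ) : WeakPair j A ψ χ := by
  obtain ⟨U, h0, h1, h2, h3, h4⟩ := h.exists_group
  exact (h.weak_iff_hasDerivAt h0 h1 h2 h3 h4 ψ χ).2 hw

theorem weak_symm (h : CoreFlow j A c φ κ) {ψ χ ψ' χ' : E} (hw : WeakPair j A ψ χ)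
    (hw' : WeakPair j A ψ' χ') : ⟪χ, ψ'⟫_ℂ = ⟪ψ, χ'⟫_ℂ := by
  obtain ⟨U, hzero, h1, h2, h3, h4⟩ := h.exists_group
  have d := ((h.weak_iff_hasDerivAt hzero h1 h2 h3 h4 ψ χ).1.1 hw).inner ℂ
    ((h.weak_iff_hasDerivAt hzero h1 h2 h3 h4 ψ' χ').1.1 hw')
  have hiso : ∀ t ψ χ, ⟪U t ψ, U t χ⟫_ℂ = ⟪ψ, χ⟫_ℂ := fun t ψ χ => by
    have h : (U t).adjoint * U t = 1 := (h2 t).1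
    calc ⟪U t ψ, U t χ⟫_ℂ = ⟪ψ, ((U t).adjoint * U t) χ⟫_ℂ := by
          simp [ContinuousLinearMap.adjoint_inner_right]
      _ = _ := by rw [h]; rfl
  simp only [hiso, hzero] at d
  have h2 := d.unique (hasDerivAt_const _ _)
  simp only [inner_smul_right, inner_smul_left, one_apply_eq_self] at h2
  have : Complex.I * (⟪χ, ψ'⟫_ℂ - ⟪ψ, χ'⟫_ℂ) = 0 := by
    rw [← h2]; simp; ring
  exact sub_eq_zero.1 ((mul_eq_zero.1 this).resolve_left Complex.I_ne_zero)

end CoreFlow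

end AbstractGroup

/-! ### Gaussian wave packets -/

section Gaussian

variable {ι : Type*} [Fintype ι]

/-- The quadratic form of `B` is bounded below by a positive multiple of `∑ x, u x ^ 2`. -/
def Coercive (B : Matrix ι ι ℝ) : Prop :=
  ∃ ε > 0, ∀ u : ι → ℝ, ε * ∑ x, u x ^ 2 ≤ ∑ x, ∑ y, B x y * u x * u y

/-- The exponent `-½ u·Bu + z·u` of a Gaussian wave packet. -/
def gaussExp (B : Matrix ι ι ℝ) (z : ι → ℂ) (u : ι → ℝ) : ℂ :=
  -(1 / 2) * ∑ x, ∑ y, (B x y : ℂ) * u x * u y + ∑ x, z x * u x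

theorem gaussExp_hasTemperateGrowth (B : Matrix ι ι ℝ) (z : ι → ℂ) :
    Function.HasTemperateGrowth (gaussExp B z) := by
  have h : ∀ x, Function.HasTemperateGrowth (fun u : ι → ℝ => (u x : ℂ)) := fun x =>
    (Complex.ofRealCLM ∘L
      ContinuousLinearMap.proj (R := ℝ) (φ := fun _ : ι => ℝ) x).hasTemperateGrowth
  unfold gaussExp
  refine .add (.mul (.const _) (.sum fun x _ => .sum fun y _ => ?_)) (.sum fun x _ => ?_)
  · exact ((Function.HasTemperateGrowth.const _).mul (h x)).mul (h y)
  · exact (Function.HasTemperateGrowth.const _).mul (h x)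

theorem norm_iteratedFDeriv_cexp_le (n : ℕ) (w : ℂ) :
    ‖iteratedFDeriv ℝ n Complex.exp w‖ ≤ ‖Complex.exp w‖ := by
  induction n with
  | zero => simp
  | succ n ih =>
    have h : fderiv ℝ Complex.exp = (ContinuousLinearMap.mul ℝ ℂ) ∘ Complex.exp := by
      funext w
      have := (Complex.hasDerivAt_exp w).hasFDerivAt.restrictScalars ℝ
      rw [this.fderiv]
      ext v
      simp [mul_comm]
    rw [← norm_iteratedFDeriv_fderiv, h]
    refine (ContinuousLinearMap.norm_iteratedFDeriv_comp_left (N := n) _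
      Complex.contDiff_exp.contDiffAt le_rfl).trans ?_
    refine (mul_le_mul (ContinuousLinearMap.opNorm_mul_le ℝ ℂ) ih (norm_nonneg _) zero_le_one).trans ?_
    rw [one_mul]

theorem norm_sq_le_sum_sq (u : ι → ℝ) : ‖u‖ ^ 2 ≤ ∑ x, u x ^ 2 := by
  have h0 : 0 ≤ ∑ x, u x ^ 2 := Finset.sum_nonneg fun x _ => sq_nonneg _
  refine (Real.le_sqrt (norm_nonneg _) h0).1 ((pi_norm_le_iff_of_nonneg (Real.sqrt_nonneg _)).2
    fun x => ?_)
  rw [Real.norm_eq_abs]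
  refine Real.abs_le_sqrt (Finset.single_le_sum (f := fun x => u x ^ 2)
    (fun x _ => sq_nonneg _) (Finset.mem_univ x))

theorem gaussExp_re (B : Matrix ι ι ℝ) (z : ι → ℂ) (u : ι → ℝ) :
    (gaussExp B z u).re = -(1 / 2) * ∑ x, ∑ y, B x y * u x * u y + ∑ x, (z x).re * u x := by
  have e : gaussExp B z u = ((-(1 / 2) * ∑ x, ∑ y, B x y * u x * u y : ℝ) : ℂ) +
      ∑ x, z x * u x := by
    simp [gaussExp]
  rw [e, Complex.add_re, Complex.ofReal_re, Complex.re_sum]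
  simp

theorem gaussExp_decay {B : Matrix ι ι ℝ} (hB : Coercive B) (z : ι → ℂ) (m : ℕ) :
    ∃ K, 0 ≤ K ∧ ∀ u, (1 + ‖u‖) ^ m * ‖Complex.exp (gaussExp B z u)‖ ≤ K := by
  obtain ⟨ε, hε, hB⟩ := hB
  set b : ℝ := ∑ x, |(z x).re| with hb
  refine ⟨m.factorial * Real.exp (1 + (b + 1) ^ 2 / (2 * ε)), by positivity, fun u => ?_⟩
  have h1 : (gaussExp B z u).re ≤ -(ε / 2) * ‖u‖ ^ 2 + b * ‖u‖ := by
    rw [gaussExp_re]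
    have h2 : ∑ x, (z x).re * u x ≤ b * ‖u‖ := by
      rw [hb, Finset.sum_mul]
      refine Finset.sum_le_sum fun x _ => (le_abs_self _).trans ?_
      rw [abs_mul]
      exact mul_le_mul_of_nonneg_left (norm_le_pi_norm u x) (abs_nonneg _)
    have h3 := hB u
    have h4 := mul_le_mul_of_nonneg_left (norm_sq_le_sum_sq u) hε.le
    linarith
  have h2 : (1 + ‖u‖) ^ m ≤ m.factorial * Real.exp (1 + ‖u‖) := by
    have := Real.pow_div_factorial_le_exp (x := 1 + ‖u‖) (by positivity) m
    rwa [div_le_iff₀' (by positivity)] at this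
  rw [Complex.norm_exp]
  calc (1 + ‖u‖) ^ m * Real.exp (gaussExp B z u).re
      ≤ (m.factorial * Real.exp (1 + ‖u‖)) * Real.exp (-(ε / 2) * ‖u‖ ^ 2 + b * ‖u‖) := by
        gcongr
    _ = m.factorial * Real.exp (1 + ‖u‖ + (-(ε / 2) * ‖u‖ ^ 2 + b * ‖u‖)) := by
        rw [mul_assoc, ← Real.exp_add]
    _ ≤ _ := by
        refine mul_le_mul_of_nonneg_left (Real.exp_le_exp.2 ?_) (by positivity)
        have : 1 + ‖u‖ + (-(ε / 2) * ‖u‖ ^ 2 + b * ‖u‖) =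
            1 + (b + 1) ^ 2 / (2 * ε) - ε / 2 * (‖u‖ - (b + 1) / ε) ^ 2 := by
          field_simp; ring
        rw [this]
        have := mul_nonneg (half_pos hε).le (sq_nonneg (‖u‖ - (b + 1) / ε))
        linarith

/-- The Gaussian wave packet `u ↦ exp (-½ u·Bu + z·u)` as a Schwartz function. -/
def gauss {B : Matrix ι ι ℝ} (hB : Coercive B) (z : ι → ℂ) : 𝓢(ι → ℝ, ℂ) where
  toFun := Complex.exp ∘ gaussExp B z
  smooth' := Complex.contDiff_exp.comp (gaussExp_hasTemperateGrowth B z).1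
  decay' := fun k n => by
    obtain ⟨l, K, hK, hg⟩ := (gaussExp_hasTemperateGrowth B z).norm_iteratedFDeriv_le_uniform n
    obtain ⟨K', hK', hd⟩ := gaussExp_decay hB z (k + l * n)
    refine ⟨n.factorial * (K + 1) ^ n * K', fun u => ?_⟩
    have h1 : (1 : ℝ) ≤ 1 + ‖u‖ := by linarith [norm_nonneg u]
    have h2 : 1 ≤ (K + 1) * (1 + ‖u‖) ^ l := by
      have := one_le_pow₀ h1 (n := l)
      nlinarith
    have := norm_iteratedFDeriv_comp_le (n := n) (N := n) (𝕜 := ℝ)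
      (Complex.contDiff_exp (𝕜 := ℝ))
      ((gaussExp_hasTemperateGrowth B z).1.of_le (by exact_mod_cast le_top)) le_rfl u
      (fun i _ => norm_iteratedFDeriv_cexp_le i (gaussExp B z u))
      (D := (K + 1) * (1 + ‖u‖) ^ l) (fun i hi hin => by
        refine (hg i hin u).trans ?_
        calc K * (1 + ‖u‖) ^ l ≤ (K + 1) * (1 + ‖u‖) ^ l := by gcongr; linarith
          _ ≤ _ := le_self_pow₀ h2 (by omega))
    calc ‖u‖ ^ k * ‖iteratedFDeriv ℝ n (Complex.exp ∘ gaussExp B z) u‖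
        ≤ (1 + ‖u‖) ^ k * (n.factorial * ‖Complex.exp (gaussExp B z u)‖ *
          ((K + 1) * (1 + ‖u‖) ^ l) ^ n) := by
          gcongr; linarith
      _ = n.factorial * (K + 1) ^ n *
          ((1 + ‖u‖) ^ (k + l * n) * ‖Complex.exp (gaussExp B z u)‖) := by
          rw [mul_pow, ← pow_mul, pow_add]; ring
      _ ≤ _ := by gcongr; exact hd u

theorem gauss_apply {B : Matrix ι ι ℝ} (hB : Coercive B) (z : ι → ℂ) (u : ι → ℝ) :
    gauss hB z u = Complex.exp (gaussExp B z u) := rfl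

theorem gaussExp_add (B : Matrix ι ι ℝ) (z w : ι → ℂ) (u : ι → ℝ) :
    gaussExp B (z + w) u = gaussExp B z u + ∑ x, w x * u x := by
  simp only [gaussExp, Pi.add_apply, add_mul, Finset.sum_add_distrib]; ring

theorem coercive_sub_smul_one [DecidableEq ι] {B : Matrix ι ι ℝ} (hB : Coercive B) :
    ∃ δ : ℝ, δ > 0 ∧ Coercive (B - δ • (1 : Matrix ι ι ℝ)) := by
  obtain ⟨ε, hε, hB⟩ := hB
  refine ⟨(ε / 2 : ℝ), half_pos hε, (ε / 2 : ℝ), half_pos hε, fun u => ?_⟩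
  have e : ∑ x, ∑ y, (B - (ε / 2) • (1 : Matrix ι ι ℝ)) x y * u x * u y =
      ∑ x, ∑ y, B x y * u x * u y - ε / 2 * ∑ x, u x ^ 2 := by
    rw [Finset.mul_sum, ← Finset.sum_sub_distrib]
    refine Finset.sum_congr rfl fun x _ => ?_
    simp only [Matrix.sub_apply, Matrix.smul_apply, smul_eq_mul, sub_mul, Finset.sum_sub_distrib]
    congr 1
    rw [Finset.sum_eq_single x]
    · simp; ring
    · intro y _ hy; simp [Matrix.one_apply_ne hy.symm]
    · simp
  rw [e]; linarith [hB u]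

theorem norm_exp_sub_one_sub_self_le (w : ℂ) :
    ‖Complex.exp w - 1 - w‖ ≤ ‖w‖ ^ 2 * Real.exp ‖w‖ := by
  have := Complex.norm_exp_sub_sum_le_norm_mul_exp w 2
  simpa [Finset.sum_range_succ, sub_sub] using this

/-- The embedding of Schwartz functions into `L²`. -/
def emb : 𝓢(ι → ℝ, ℂ) →ₗ[ℂ] L2 ι :=
  (SchwartzMap.toLpCLM ℂ (E := ι → ℝ) ℂ 2 volume).toLinearMap

theorem coeFn_emb (η : 𝓢(ι → ℝ, ℂ)) : emb η =ᵐ[volume] η := η.coeFn_toLp 2 volume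

/-- Complex-linear directional derivative of a wave packet with respect to its parameter. -/
def gaussDeriv {B : Matrix ι ι ℝ} (hB : Coercive B) (z : ι → ℂ) : (ι → ℂ) →L[ℂ] L2 ι :=
  ∑ x, (ContinuousLinearMap.proj (R := ℂ) (φ := fun _ : ι => ℂ) x).smulRight
    (emb (posS x (gauss hB z)))

theorem gaussDeriv_apply {B : Matrix ι ι ℝ} (hB : Coercive B) (z w : ι → ℂ) :
    gaussDeriv hB z w = emb (∑ x, w x • posS x (gauss hB z)) := by
  simp [gaussDeriv, map_sum]

theorem hasFDerivAt_gauss {B : Matrix ι ι ℝ} (hB : Coercive B) (z : ι → ℂ) :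
    HasFDerivAt (fun z => emb (gauss hB z)) (gaussDeriv hB z) z := by
  classical
  obtain ⟨δ, hδ, hB'⟩ := coercive_sub_smul_one hB
  -- `|w·u|² e^{|w·u|} |gauss B z u|` is dominated by a multiple of a wider Gaussian
  set N : ℝ := (Fintype.card ι : ℝ)
  set K : ℝ := 2 * Real.exp (2 * N / δ) with hK
  have key : ∀ w : ι → ℂ, ‖w‖ ≤ 1 →
      ‖emb (gauss hB (z + w)) - emb (gauss hB z) - gaussDeriv hB z w‖ ≤
        (K * ‖w‖ ^ 2) * ‖emb (gauss hB' z)‖ := by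
    intro w hw
    rw [gaussDeriv_apply]
    rw [← map_sub, ← map_sub]
    refine Lp.norm_le_mul_norm_of_ae_le_mul ?_
    filter_upwards [coeFn_emb (gauss hB (z + w) - gauss hB z - ∑ x, w x • posS x (gauss hB z)),
      coeFn_emb (gauss hB' z)] with u h1 h2
    rw [h1, h2]
    set q : ℂ := ∑ x, w x * u x with hq
    have h3 : (gauss hB (z + w) - gauss hB z - ∑ x, w x • posS x (gauss hB z)) u =
        (Complex.exp q - 1 - q) * gauss hB z u := by
      have : (∑ x, w x • posS x (gauss hB z)) u = q * gauss hB z u := by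
        rw [sum_apply, hq, Finset.sum_mul]
        refine Finset.sum_congr rfl fun x _ => ?_
        rw [smul_apply, posS_apply, smul_eq_mul]; ring
      rw [sub_apply, sub_apply, this, gauss_apply, gauss_apply,
        gaussExp_add, Complex.exp_add]
      ring
    rw [h3, norm_mul]
    set r : ℝ := ∑ x, |u x| with hr
    have hr0 : 0 ≤ r := Finset.sum_nonneg fun x _ => abs_nonneg _
    have hqr : ‖q‖ ≤ ‖w‖ * r := by
      rw [hr, Finset.mul_sum]
      refine (norm_sum_le _ _).trans (Finset.sum_le_sum fun x _ => ?_)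
      rw [norm_mul, Complex.norm_real, Real.norm_eq_abs]
      exact mul_le_mul_of_nonneg_right (norm_le_pi_norm w x) (abs_nonneg _)
    have hqr' : ‖q‖ ≤ r := hqr.trans (mul_le_of_le_one_left hr0 hw)
    have h4 : ‖Complex.exp q - 1 - q‖ ≤ ‖w‖ ^ 2 * (2 * Real.exp (2 * r)) := by
      calc _ ≤ ‖q‖ ^ 2 * Real.exp ‖q‖ := norm_exp_sub_one_sub_self_le q
        _ ≤ (‖w‖ * r) ^ 2 * Real.exp r := by gcongr
        _ = ‖w‖ ^ 2 * (r ^ 2 * Real.exp r) := by ring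
        _ ≤ ‖w‖ ^ 2 * ((2 * Real.exp r) * Real.exp r) := by
          gcongr
          have := Real.quadratic_le_exp_of_nonneg hr0
          linarith
        _ = _ := by rw [two_mul r, Real.exp_add]; ring
    have h5 : 2 * r ≤ 2 * N / δ + δ / 2 * ∑ x, u x ^ 2 := by
      have : 2 * N / δ + δ / 2 * ∑ x, u x ^ 2 - 2 * r =
          ∑ x, δ / 2 * (|u x| - 2 / δ) ^ 2 := by
        have : ∀ x, δ / 2 * (|u x| - 2 / δ) ^ 2 = 2 / δ + δ / 2 * u x ^ 2 - 2 * |u x| := by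
          intro x
          rw [sub_sq, sq_abs]
          field_simp
          ring
        simp only [this, Finset.sum_sub_distrib, Finset.sum_add_distrib, ← Finset.mul_sum, hr]
        simp [N]; ring
      have : 0 ≤ ∑ x, δ / 2 * (|u x| - 2 / δ) ^ 2 := Finset.sum_nonneg fun x _ => by positivity
      linarith
    have h6 : ‖gauss hB' z u‖ = Real.exp (δ / 2 * ∑ x, u x ^ 2) * ‖gauss hB z u‖ := by
      rw [gauss_apply, gauss_apply, Complex.norm_exp, Complex.norm_exp, ← Real.exp_add]
      congr 1
      rw [gaussExp_re, gaussExp_re]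
      have e : ∑ x, ∑ y, (B - δ • (1 : Matrix ι ι ℝ)) x y * u x * u y =
          ∑ x, ∑ y, B x y * u x * u y - δ * ∑ x, u x ^ 2 := by
        rw [Finset.mul_sum, ← Finset.sum_sub_distrib]
        refine Finset.sum_congr rfl fun x _ => ?_
        simp only [Matrix.sub_apply, Matrix.smul_apply, smul_eq_mul, sub_mul,
          Finset.sum_sub_distrib]
        congr 1
        rw [Finset.sum_eq_single x]
        · simp; ring
        · intro y _ hy; simp [Matrix.one_apply_ne hy.symm]
        · simp
      rw [e]; ring
    rw [h6]
    calc ‖Complex.exp q - 1 - q‖ * ‖gauss hB z u‖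
        ≤ (‖w‖ ^ 2 * (2 * Real.exp (2 * N / δ + δ / 2 * ∑ x, u x ^ 2))) * ‖gauss hB z u‖ := by
          gcongr
          exact h4.trans (by gcongr)
      _ = _ := by rw [Real.exp_add, hK]; ring
  rw [hasFDerivAt_iff_isLittleO_nhds_zero]
  have hO : (fun w : ι → ℂ => emb (gauss hB (z + w)) - emb (gauss hB z) -
      gaussDeriv hB z w) =O[nhds 0] fun w => ‖w‖ ^ 2 := by
    refine Asymptotics.IsBigO.of_bound
      (K * ‖emb (gauss hB' z)‖) ?_
    filter_upwards [Metric.ball_mem_nhds (0 : ι → ℂ) one_pos] with w hw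
    refine (key w (by simpa using (mem_ball_zero_iff.1 hw).le)).trans (le_of_eq ?_)
    rw [Real.norm_of_nonneg (by positivity)]; ring
  refine hO.trans_isLittleO ?_
  exact Asymptotics.isLittleO_norm_pow_id one_lt_two

theorem hasDerivAt_smul_gauss {B : Matrix ι ι ℝ} (hB : Coercive B) {κ : ℝ → ℂ} {κ' : ℂ}
    {z : ℝ → ι → ℂ} {z' : ι → ℂ} {t : ℝ} (hκ : HasDerivAt κ κ' t) (hz : HasDerivAt z z' t) :
    HasDerivAt (fun t => κ t • emb (gauss hB (z t)))
      (emb (κ' • gauss hB (z t) + κ t • ∑ x, z' x • posS x (gauss hB (z t)))) t := by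
  have h1 := ((hasFDerivAt_gauss hB (z t)).restrictScalars ℝ).comp_hasDerivAt t hz
  have h2 := hκ.smul h1
  refine h2.congr_deriv ?_
  rw [ContinuousLinearMap.coe_restrictScalars', gaussDeriv_apply]
  simp only [map_add, map_smul, Function.comp]
  rw [add_comm]

/-- Injectivity of the Fourier transform on integrable functions. -/
theorem ae_eq_zero_of_fourier_eq_zero [DecidableEq ι] {f : (ι → ℝ) → ℂ} (hf : Integrable f)
    (h : ∀ ξ : ι → ℝ, ∫ u, Complex.exp (Complex.I * ∑ x, (ξ x : ℂ) * u x) * f u = 0) : f =ᵐ[volume] 0 := by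
  have hchar : ∀ ξ : ι → ℝ, Continuous fun u : ι → ℝ =>
      Complex.exp (Complex.I * ∑ x, (ξ x : ℂ) * u x) := fun ξ => by fun_prop
  have hnorm : ∀ ξ u : ι → ℝ, ‖Complex.exp (Complex.I * ∑ x, (ξ x : ℂ) * u x)‖ = 1 := fun ξ u => by
    rw [mul_comm]
    have : (∑ x, (ξ x : ℂ) * u x) = ((∑ x, ξ x * u x : ℝ) : ℂ) := by simp
    rw [this, Complex.norm_exp_ofReal_mul_I]
  have hint : ∀ (g : (ι → ℝ) → ℂ), Integrable g → ∀ ξ : ι → ℝ,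
      Integrable fun u => Complex.exp (Complex.I * ∑ x, (ξ x : ℂ) * u x) * g u := fun g hg ξ =>
    hg.bdd_mul (c := 1) (hchar ξ).aestronglyMeasurable
      (Filter.Eventually.of_forall fun u => (hnorm ξ u).le)
  -- the real case, by comparing the measures with densities `f⁺` and `f⁻`
  have real : ∀ g : (ι → ℝ) → ℝ, Integrable g →
      (∀ ξ : ι → ℝ, ∫ u, Complex.exp (Complex.I * ∑ x, (ξ x : ℂ) * u x) * (g u : ℂ) = 0) →
      g =ᵐ[volume] 0 := by
    intro g hg h0
    let P : ((ι → ℝ) → ℝ) → Measure (ι → ℝ) := fun g => volume.withDensity fun u => ENNReal.ofReal (g u)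
    have fin : ∀ g : (ι → ℝ) → ℝ, Integrable g → IsFiniteMeasure (P g) := fun g hg =>
      isFiniteMeasure_withDensity_ofReal hg.2
    have := fin g hg
    have := fin (-g) hg.neg
    have hPint : ∀ g : (ι → ℝ) → ℝ, Integrable g → ∀ F : (ι → ℝ) → ℂ,
        ∫ u, F u ∂(P g) = ∫ u, F u * (max (g u) 0 : ℝ) := by
      intro g hg F
      have e := integral_withDensity_eq_integral_toReal_smul₀ (μ := (volume : Measure (ι → ℝ)))
        (f := fun u => ENNReal.ofReal (g u)) hg.1.aemeasurable.ennreal_ofReal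
        (Filter.Eventually.of_forall fun u => ENNReal.ofReal_lt_top) F
      refine e.trans (integral_congr_ae (Filter.Eventually.of_forall fun u => ?_))
      simp only [ENNReal.toReal_ofReal', Complex.real_smul]
      ring
    have hL : ∀ (L : StrongDual ℝ (ι → ℝ)) (u : ι → ℝ), Complex.exp (L u * Complex.I) =
        Complex.exp (Complex.I * ∑ x, ((L (Pi.single x 1) : ℝ) : ℂ) * u x) := by
      intro L u
      have : L u = ∑ x, L (Pi.single x 1) * u x := by
        conv_lhs => rw [pi_eq_sum_univ' u, map_sum]
        exact Finset.sum_congr rfl fun x _ => by rw [map_smul, smul_eq_mul, mul_comm]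
      rw [this, mul_comm]; simp
    have hP : P g = P (-g) := by
      refine Measure.ext_of_charFunDual (funext fun L => ?_)
      rw [charFunDual_apply, charFunDual_apply, hPint g hg, hPint (-g) hg.neg, ← sub_eq_zero,
        ← integral_sub]
      · rw [← h0 fun x => L (Pi.single x 1)]
        refine integral_congr_ae (Filter.Eventually.of_forall fun u => ?_)
        simp only [hL L u]
        rw [← mul_sub, ← Complex.ofReal_sub, Pi.neg_apply, max_zero_sub_eq_self]
      · simp only [hL L]; exact hint _ hg.pos_part.ofReal fun x => L (Pi.single x 1)
      · simp only [hL L]; exact hint _ hg.neg.pos_part.ofReal fun x => L (Pi.single x 1)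
    have h1 : ∀ᵐ u, ENNReal.ofReal (g u) = ENNReal.ofReal (-g u) :=
      (withDensity_eq_iff hg.1.aemeasurable.ennreal_ofReal hg.neg.1.aemeasurable.ennreal_ofReal
        hg.lintegral_lt_top.ne).1 hP
    filter_upwards [h1] with u hu
    rcases le_total (g u) 0 with h2 | h2
    · rw [ENNReal.ofReal_of_nonpos h2, eq_comm, ENNReal.ofReal_eq_zero] at hu
      exact le_antisymm h2 (by simpa using hu)
    · rw [ENNReal.ofReal_of_nonpos (by linarith : -g u ≤ 0), ENNReal.ofReal_eq_zero] at hu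
      exact le_antisymm hu h2
  have hconj : ∀ ξ : ι → ℝ,
      ∫ u, Complex.exp (Complex.I * ∑ x, (ξ x : ℂ) * u x) * (starRingEnd ℂ) (f u) = 0 := by
    intro ξ
    have := congrArg (starRingEnd ℂ) (h (-ξ))
    rw [← integral_conj, map_zero] at this
    rw [← this]
    refine integral_congr_ae (Filter.Eventually.of_forall fun u => ?_)
    simp [← Complex.exp_conj]
  have hre := real (fun u => (f u).re) hf.re fun ξ => by
    have h1 : ∀ u, Complex.exp (Complex.I * ∑ x, (ξ x : ℂ) * u x) * ((f u).re : ℂ) =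
        (1 / 2) * (Complex.exp (Complex.I * ∑ x, (ξ x : ℂ) * u x) * f u +
          Complex.exp (Complex.I * ∑ x, (ξ x : ℂ) * u x) * (starRingEnd ℂ) (f u)) := fun u => by
      rw [Complex.re_eq_add_conj]; ring
    simp only [h1]
    rw [integral_const_mul, integral_add (hint f hf ξ), h, hconj]
    · simp
    · exact hint (fun u => (starRingEnd ℂ) (f u))
        ((Complex.conjCLE : ℂ →L[ℝ] ℂ).integrable_comp hf) ξ
  have him := real (fun u => (f u).im) hf.im fun ξ => by
    have h1 : ∀ u, Complex.exp (Complex.I * ∑ x, (ξ x : ℂ) * u x) * ((f u).im : ℂ) =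
        (1 / (2 * Complex.I)) * (Complex.exp (Complex.I * ∑ x, (ξ x : ℂ) * u x) * f u -
          Complex.exp (Complex.I * ∑ x, (ξ x : ℂ) * u x) * (starRingEnd ℂ) (f u)) := fun u => by
      rw [Complex.im_eq_sub_conj]; ring
    simp only [h1]
    rw [integral_const_mul, integral_sub (hint f hf ξ), h, hconj]
    · simp
    · exact hint (fun u => (starRingEnd ℂ) (f u))
        ((Complex.conjCLE : ℂ →L[ℝ] ℂ).integrable_comp hf) ξ
  filter_upwards [hre, him] with u h1 h2
  exact Complex.ext h1 h2

/-- Gaussian wave packets are total in `L²`: with purely imaginary `z` the orthogonality relations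
say that a Fourier transform vanishes. -/
theorem total_gauss {B : Matrix ι ι ℝ} (hB : Coercive B) :
    Total fun z => emb (gauss hB z) := by
  classical
  refine Total.of_forall_eq_zero fun ψ hψ => ?_
  have hint : Integrable fun u => gauss hB 0 u * ψ u :=
    (Lp.memLp ψ).integrable_mul ((gauss hB 0).memLp 2 volume) |>.congr
      (Filter.Eventually.of_forall fun u => mul_comm _ _)
  have h0 := ae_eq_zero_of_fourier_eq_zero hint fun ξ => by
    have := hψ (fun x => -Complex.I * ξ x)
    rw [L2.inner_def] at this
    rw [← this]
    refine integral_congr_ae ?_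
    filter_upwards [coeFn_emb (gauss hB fun x => -Complex.I * ξ x)] with u hu
    rw [hu, RCLike.inner_apply, gauss_apply, gauss_apply, ← Complex.exp_conj, ← mul_assoc,
      ← Complex.exp_add, mul_comm (ψ u)]
    congr 2
    have h2 : ∑ x, -(-Complex.I * (ξ x : ℂ)) * (u x : ℂ) = Complex.I * ∑ x, (ξ x : ℂ) * u x := by
      rw [Finset.mul_sum]; exact Finset.sum_congr rfl fun x _ => by ring
    simp only [gaussExp, map_add, map_mul, map_neg, map_sum, Complex.conj_ofReal, Complex.conj_I,
      Pi.zero_apply, zero_mul, Finset.sum_const_zero, add_zero, map_div₀, map_one, map_ofNat]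
    rw [← h2]
    simp only [neg_mul, neg_neg]
    ring
  refine Lp.ext ?_
  filter_upwards [h0, Lp.coeFn_zero ℂ 2 (volume : Measure (ι → ℝ))] with u hu hz
  rw [hz]
  exact (mul_eq_zero.1 hu).resolve_left (by rw [gauss_apply]; exact Complex.exp_ne_zero _)

end Gaussian

/-! ### Position and momentum operators on Schwartz functions and in `L²` -/

section PositionMomentum

variable {ι : Type*} [Fintype ι]

theorem inner_emb (η ξ : 𝓢(ι → ℝ, ℂ)) :
    ⟪emb η, emb ξ⟫_ℂ = ∫ u, (starRingEnd ℂ) (η u) * ξ u := by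
  refine (SchwartzMap.inner_toL2_toL2_eq η ξ volume).trans ?_
  simp [RCLike.inner_apply, mul_comm]

theorem total_emb : Total (emb : 𝓢(ι → ℝ, ℂ) → L2 ι) := by
  classical
  have h1 : Coercive (1 : Matrix ι ι ℝ) :=
    ⟨1, one_pos, fun u => by simp [Matrix.one_apply, pow_two]⟩
  refine (total_gauss h1).mono (Submodule.span_mono ?_)
  rintro _ ⟨z, rfl⟩
  exact ⟨_, rfl⟩

/-- `A` is symmetric on Schwartz functions, as an operator in `L²`. -/
def SymmS (A : 𝓢(ι → ℝ, ℂ) →L[ℂ] 𝓢(ι → ℝ, ℂ)) : Prop :=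
  ∀ η ξ, ⟪emb (A η), emb ξ⟫_ℂ = ⟪emb η, emb (A ξ)⟫_ℂ

theorem SymmS.add {A B : 𝓢(ι → ℝ, ℂ) →L[ℂ] 𝓢(ι → ℝ, ℂ)} (hA : SymmS A) (hB : SymmS B) :
    SymmS (A + B) := fun η ξ => by
  simp only [add_apply, map_add, inner_add_left, inner_add_right, hA η ξ, hB η ξ]

theorem SymmS.zero : SymmS (0 : 𝓢(ι → ℝ, ℂ) →L[ℂ] 𝓢(ι → ℝ, ℂ)) := fun η ξ => by simp

theorem SymmS.sum {α : Type*} (s : Finset α) {A : α → 𝓢(ι → ℝ, ℂ) →L[ℂ] 𝓢(ι → ℝ, ℂ)}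
    (hA : ∀ a, SymmS (A a)) : SymmS (∑ a ∈ s, A a) := by
  classical
  induction s using Finset.induction_on with
  | empty => simpa using SymmS.zero
  | insert a s ha ih => rw [Finset.sum_insert ha]; exact (hA a).add ih

theorem SymmS.real_smul {A : 𝓢(ι → ℝ, ℂ) →L[ℂ] 𝓢(ι → ℝ, ℂ)} (hA : SymmS A) (r : ℝ) :
    SymmS ((r : ℂ) • A) := fun η ξ => by
  simp only [smul_apply, map_smul, inner_smul_left, inner_smul_right, hA η ξ, Complex.conj_ofReal]

theorem SymmS.sq {A : 𝓢(ι → ℝ, ℂ) →L[ℂ] 𝓢(ι → ℝ, ℂ)} (hA : SymmS A) : SymmS (A ^ 2) :=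
  fun η ξ => by simp only [pow_two, mul_apply_eq_comp, hA _ _]

theorem symmS_posS (x : ι) : SymmS (posS x) := fun η ξ => by
  rw [inner_emb, inner_emb]
  congr 1; funext u
  rw [posS_apply, posS_apply, map_mul, Complex.conj_ofReal]; ring

theorem SymmS.neg {A : 𝓢(ι → ℝ, ℂ) →L[ℂ] 𝓢(ι → ℝ, ℂ)} (hA : SymmS A) : SymmS (-A) := by
  have := hA.real_smul (-1)
  simpa using this

variable [DecidableEq ι]

theorem symmS_momS (x : ι) : SymmS (momS x) := fun η ξ => by
  have h := SchwartzMap.integral_bilinear_lineDerivOp_right_eq_neg_left (μ := volume) η ξ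
    ((ContinuousLinearMap.mul ℝ ℂ).comp (Complex.conjCLE : ℂ →L[ℝ] ℂ)) (Pi.single x 1 : ι → ℝ)
  simp only [ContinuousLinearMap.comp_apply, ContinuousLinearEquiv.coe_coe,
    ContinuousLinearMap.mul_apply', SchwartzMap.lineDerivOp_apply, Complex.conjCLE_apply] at h
  rw [inner_emb, inner_emb]
  simp only [momS_apply, map_mul, map_neg, Complex.conj_I, neg_neg]
  calc ∫ u, Complex.I * (starRingEnd ℂ) (lineDeriv ℝ η u (Pi.single x 1)) * ξ u
      = Complex.I * ∫ u, (starRingEnd ℂ) (lineDeriv ℝ η u (Pi.single x 1)) * ξ u := by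
        rw [← integral_const_mul]; simp only [mul_assoc]
    _ = -Complex.I * ∫ u, (starRingEnd ℂ) (η u) * lineDeriv ℝ ξ u (Pi.single x 1) := by
        rw [h]; ring
    _ = _ := by rw [← integral_const_mul]; congr 1; funext u; ring

/-- The canonical commutation relation on Schwartz functions. -/
theorem momS_posS (x y : ι) (η : 𝓢(ι → ℝ, ℂ)) :
    momS x (posS y η) = posS y (momS x η) - (if x = y then Complex.I else 0) • η := by
  ext u
  rw [sub_apply, smul_apply, posS_apply, momS_apply, momS_apply, smul_eq_mul]
  have h1 : HasDerivAt (fun t : ℝ => η (u + t • (Pi.single x 1 : ι → ℝ)))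
      (lineDeriv ℝ η u (Pi.single x 1)) 0 :=
    ((η.hasFDerivAt u).hasLineDerivAt (Pi.single x 1)).lineDifferentiableAt.hasLineDerivAt
  have h2 : HasDerivAt (fun t : ℝ => (((u + t • (Pi.single x 1 : ι → ℝ)) y : ℝ) : ℂ))
      (if x = y then 1 else 0) 0 := by
    have h3 : HasDerivAt (fun t : ℝ => u y + t * (Pi.single x 1 : ι → ℝ) y)
        ((Pi.single x 1 : ι → ℝ) y) 0 := by
      simpa using ((hasDerivAt_id (0 : ℝ)).mul_const ((Pi.single x 1 : ι → ℝ) y)).const_add (u y)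
    have h4 := h3.ofReal_comp
    refine (h4.congr_deriv ?_)
    by_cases h : x = y
    · subst h; simp
    · rw [if_neg h, Pi.single_eq_of_ne (Ne.symm h)]; simp
  have h3 := h2.fun_mul h1
  have h4 : lineDeriv ℝ (posS y η) u (Pi.single x 1) =
      (if x = y then 1 else 0) * η u + (u y : ℂ) * lineDeriv ℝ η u (Pi.single x 1) := by
    refine HasLineDerivAt.lineDeriv ?_
    rw [HasLineDerivAt]
    simp only [posS_apply]
    simpa using h3
  rw [h4]
  split_ifs <;> ring

theorem hasDerivAt_ofReal (s : ℝ) : HasDerivAt (fun s : ℝ => (s : ℂ)) 1 s :=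
  (Complex.ofRealCLM.hasDerivAt (x := s)).congr_deriv Complex.ofReal_one

theorem gaussExp_add_single {B : Matrix ι ι ℝ} (hs : B.IsSymm) (z : ι → ℂ) (u : ι → ℝ) (x : ι)
    (s : ℝ) : gaussExp B z (u + s • Pi.single x 1) = gaussExp B z u +
      s * (z x - ∑ y, (B x y : ℂ) * u y) - (1 / 2) * s ^ 2 * B x x := by
  have h1 : ∀ a b, (B a b : ℂ) * ((u + s • (Pi.single x 1 : ι → ℝ)) a : ℝ) *
      ((u + s • (Pi.single x 1 : ι → ℝ)) b : ℝ) = B a b * u a * u b +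
        (if a = x then (s * (B x b * u b) : ℂ) else 0) +
        (if b = x then (s * (B x a * u a) : ℂ) else 0) +
        (if a = x then if b = x then (s ^ 2 * B x x : ℂ) else 0 else 0) := by
    intro a b
    have := hs.apply a x
    by_cases ha : a = x <;> by_cases hb : b = x
    · subst ha; subst hb; simp; ring
    · subst ha; simp [hb]; ring
    · subst hb; simp [ha, ← this]; ring
    · simp [ha, hb]
  have h2 : ∀ a, z a * ((u + s • (Pi.single x 1 : ι → ℝ)) a : ℝ) = z a * u a +
      if a = x then s * z x else 0 := by
    intro a
    by_cases ha : a = x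
    · subst ha; simp; ring
    · simp [ha]
  simp only [gaussExp, h1, h2, Finset.sum_add_distrib]
  simp only [Finset.sum_ite_eq', Finset.mem_univ, if_true]
  have h3 : ∑ a, ∑ b, (if a = x then (s : ℂ) * (B x b * u b) else 0) =
      s * ∑ b, (B x b : ℂ) * u b := by
    rw [Finset.sum_comm]; simp [Finset.mul_sum]
  have h4 : ∑ a, ∑ b, (if a = x then if b = x then (s ^ 2 * B x x : ℂ) else 0 else 0) =
      s ^ 2 * B x x := by
    rw [Finset.sum_comm]; simp
  rw [h3, h4, ← Finset.mul_sum]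
  ring

theorem momS_gauss_apply {B : Matrix ι ι ℝ} (hB : Coercive B) (hs : B.IsSymm) (z : ι → ℂ) (x : ι)
    (u : ι → ℝ) : momS x (gauss hB z) u =
      -Complex.I * ((z x - ∑ y, (B x y : ℂ) * u y) * gauss hB z u) := by
  rw [momS_apply]
  congr 1
  refine HasLineDerivAt.lineDeriv ?_
  rw [HasLineDerivAt]
  simp only [gauss_apply, gaussExp_add_single hs]
  set c : ℂ := z x - ∑ y, (B x y : ℂ) * u y
  have h1 : HasDerivAt (fun w : ℂ => gaussExp B z u + w * c - 1 / 2 * w ^ 2 * B x x) c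
      ((0 : ℝ) : ℂ) := by
    have := ((((hasDerivAt_id (0 : ℂ)).mul_const c).const_add (gaussExp B z u)).fun_sub
      ((((hasDerivAt_id (0 : ℂ)).pow 2).const_mul (1 / 2)).mul_const (B x x : ℂ)))
    simpa using this
  have h2 := h1.cexp.comp_ofReal
  simpa [mul_comm] using h2

theorem momS_gauss {B : Matrix ι ι ℝ} (hB : Coercive B) (hs : B.IsSymm) (z : ι → ℂ) (x : ι) :
    momS x (gauss hB z) =
      -Complex.I • (z x • gauss hB z - ∑ y, (B x y : ℂ) • posS y (gauss hB z)) := by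
  ext u
  rw [momS_gauss_apply hB hs, smul_apply, sub_apply, smul_apply, sum_apply]
  simp only [smul_apply, posS_apply, smul_eq_mul, sub_mul, Finset.sum_mul, mul_assoc]

/-- Multiplication by `e^{-isq_x}` shifts the parameter of a wave packet. -/
theorem coreFlow_posS {B : Matrix ι ι ℝ} (hB : Coercive B) (x : ι) :
    CoreFlow (S := 𝓢(ι → ℝ, ℂ)) emb (posS x).toLinearMap (gauss hB)
      (fun s z => z + (-Complex.I * s) • Pi.single x 1) (fun _ _ => 1) where
  total := total_gauss hB
  symm := symmS_posS x
  φ_zero z := by simp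
  φ_add s t z := by
    push_cast
    rw [add_assoc, ← add_smul]; congr 2; ring
  κ_zero _ := rfl
  κ_add _ _ _ := by simp
  deriv z := by
    have h1 : HasDerivAt (fun s : ℝ => z + (-Complex.I * s) • (Pi.single x 1 : ι → ℂ))
        ((-Complex.I) • (Pi.single x 1 : ι → ℂ)) 0 := by
      simpa using (((hasDerivAt_ofReal 0).const_mul (-Complex.I)).smul_const
        (Pi.single x 1 : ι → ℂ)).const_add z
    have h2 := hasDerivAt_smul_gauss hB (hasDerivAt_const (0 : ℝ) (1 : ℂ)) h1
    refine h2.congr_deriv ?_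
    simp [Pi.single_apply]

/-- Translations act on wave packets by a shift of the parameter and a scalar factor. -/
theorem coreFlow_momS {B : Matrix ι ι ℝ} (hB : Coercive B) (hs : B.IsSymm) (x : ι) :
    CoreFlow (S := 𝓢(ι → ℝ, ℂ)) emb (momS x).toLinearMap (gauss hB)
      (fun s z => z + (s : ℂ) • fun y => (B x y : ℂ))
      (fun s z => Complex.exp (-(1 / 2) * B x x * (s : ℂ) ^ 2 - z x * s)) where
  total := total_gauss hB
  symm := symmS_momS x
  φ_zero z := by simp
  φ_add s t z := by
    push_cast
    rw [add_assoc, ← add_smul]; congr 2; ring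
  κ_zero _ := by simp
  κ_add s t z := by
    rw [← Complex.exp_add]
    congr 1
    push_cast
    simp only [Pi.add_apply, Pi.smul_apply, smul_eq_mul]
    ring
  deriv z := by
    have h1 : HasDerivAt (fun s : ℝ => z + (s : ℂ) • fun y => (B x y : ℂ))
        (fun y => (B x y : ℂ)) 0 := by
      simpa using ((hasDerivAt_ofReal 0).smul_const (fun y => (B x y : ℂ))).const_add z
    have h2 : HasDerivAt (fun s : ℝ => Complex.exp (-(1 / 2) * B x x * (s : ℂ) ^ 2 - z x * s))
        (-z x) 0 := by
      have h3 : HasDerivAt (fun s : ℂ => -(1 / 2) * B x x * s ^ 2 - z x * s)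
        (-z x) ((0 : ℝ) : ℂ) := by
        have := (((hasDerivAt_id ((0 : ℝ) : ℂ)).pow 2).const_mul (-(1 / 2) * (B x x : ℂ))).fun_sub
          ((hasDerivAt_id ((0 : ℝ) : ℂ)).const_mul (z x))
        simpa using this
      simpa using h3.cexp.comp_ofReal
    have h3 := hasDerivAt_smul_gauss hB h2 h1
    refine h3.congr_deriv ?_
    rw [← map_smul]
    congr 1
    show _ = -Complex.I • momS x (gauss hB z)
    rw [momS_gauss hB hs, smul_smul]
    simp [sub_eq_add_neg]

end PositionMomentum

section Realization

variable {ι : Type*} [Fintype ι]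

theorem weakGraph_iff {A : 𝓢(ι → ℝ, ℂ) →L[ℂ] 𝓢(ι → ℝ, ℂ)} {ψ χ : L2 ι} :
    (ψ, χ) ∈ weakGraph A ↔ WeakPair emb A.toLinearMap ψ χ := Iff.rfl

theorem realization_graph (A : 𝓢(ι → ℝ, ℂ) →L[ℂ] 𝓢(ι → ℝ, ℂ)) :
    (realization A).graph = weakGraph A := by
  refine Submodule.toLinearPMap_graph_eq _ fun z hz h0 => ?_
  refine total_emb.eq_zero fun η => ?_
  have := hz η
  rw [h0, inner_zero_right] at this
  exact this

theorem mem_graph_realization {A : 𝓢(ι → ℝ, ℂ) →L[ℂ] 𝓢(ι → ℝ, ℂ)} {ψ χ : L2 ι} :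
    (ψ, χ) ∈ (realization A).graph ↔ WeakPair emb A.toLinearMap ψ χ := by
  rw [realization_graph, weakGraph_iff]

theorem mem_graph_iff_app {E : Type*} [NormedAddCommGroup E] [InnerProductSpace ℂ E]
    [CompleteSpace E] {A : E →ₗ.[ℂ] E} {ψ χ : E} :
    (ψ, χ) ∈ A.graph ↔ ψ ∈ A.domain ∧ app A ψ = χ := by
  rw [LinearPMap.mem_graph_iff]
  constructor
  · rintro ⟨y, rfl, rfl⟩
    exact ⟨y.2, by simp [app, y.2]⟩
  · rintro ⟨h, rfl⟩
    exact ⟨⟨ψ, h⟩, rfl, by simp [app, h]⟩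

variable [DecidableEq ι]

/-- The position and momentum operators on Schwartz functions, indexed as in `qp`. -/
def qpS (a : ι ⊕ ι) : 𝓢(ι → ℝ, ℂ) →L[ℂ] 𝓢(ι → ℝ, ℂ) := Sum.elim posS momS a

theorem qp_eq (a : ι ⊕ ι) : qp a = realization (qpS a) := by
  cases a <;> rfl

/-- The span of the wave packets is a core for every position and momentum operator. -/
theorem mem_graph_qp_of_gauss {B : Matrix ι ι ℝ} (hB : Coercive B) (hs : B.IsSymm) (a : ι ⊕ ι)
    {ψ χ : L2 ι} (h : ∀ z, ⟪emb (gauss hB z), χ⟫_ℂ = ⟪emb (qpS a (gauss hB z)), ψ⟫_ℂ) :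
    (ψ, χ) ∈ (qp a).graph := by
  rw [qp_eq, mem_graph_realization]
  cases a with
  | inl x => exact (coreFlow_posS hB x).weak_of_core h
  | inr x => exact (coreFlow_momS hB hs x).weak_of_core h

theorem inner_emb_of_mem_graph_qp {a : ι ⊕ ι} {ψ χ : L2 ι} (h : (ψ, χ) ∈ (qp a).graph)
    (η : 𝓢(ι → ℝ, ℂ)) : ⟪emb η, χ⟫_ℂ = ⟪emb (qpS a η), ψ⟫_ℂ := by
  rw [qp_eq, mem_graph_realization] at h
  exact h η

theorem coercive_one : Coercive (1 : Matrix ι ι ℝ) :=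
  ⟨1, one_pos, fun u => by simp [Matrix.one_apply, pow_two]⟩

/-- Positions and momenta are symmetric on their full domains. -/
theorem qp_symm {a : ι ⊕ ι} {ψ χ ψ' χ' : L2 ι} (h : (ψ, χ) ∈ (qp a).graph)
    (h' : (ψ', χ') ∈ (qp a).graph) : ⟪χ, ψ'⟫_ℂ = ⟪ψ, χ'⟫_ℂ := by
  rw [qp_eq, mem_graph_realization] at h h'
  cases a with
  | inl x => exact (coreFlow_posS coercive_one x).weak_symm h h'
  | inr x => exact (coreFlow_momS coercive_one Matrix.isSymm_one x).weak_symm h h'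

/-- Position and momentum operators are closed. -/
theorem isClosed_graph_qp (a : ι ⊕ ι) : IsClosed ((qp a).graph : Set (L2 ι × L2 ι)) := by
  have : ((qp a).graph : Set (L2 ι × L2 ι)) =
      ⋂ η : 𝓢(ι → ℝ, ℂ), {p | ⟪emb η, p.2⟫_ℂ = ⟪emb (qpS a η), p.1⟫_ℂ} := by
    ext ⟨ψ, χ⟩
    rw [qp_eq, SetLike.mem_coe, mem_graph_realization]
    simp only [Set.mem_iInter]
    rfl
  rw [this]
  exact isClosed_iInter fun η => isClosed_eq (by fun_prop) (by fun_prop)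

end Realization

/-! ### Functional calculus of real symmetric matrices -/

section SymmFun

variable {n : Type*} [Fintype n] [DecidableEq n] {A : Matrix n n ℝ} (hA : A.IsHermitian)

/-- The orthogonal matrix of eigenvectors, with complex entries. -/
def eigMat : Matrix n n ℂ := fun x j => (hA.eigenvectorBasis j x : ℂ)

theorem eigMat_eq : eigMat hA = (hA.eigenvectorUnitary : Matrix n n ℝ).map Complex.ofReal := by
  ext x j
  simp [eigMat, Matrix.IsHermitian.eigenvectorUnitary_apply]

theorem eigMat_transpose_mul : (eigMat hA).transpose * eigMat hA = 1 := by
  have h := Matrix.mem_unitaryGroup_iff'.1 hA.eigenvectorUnitary.2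
  rw [Matrix.star_eq_conjTranspose, Matrix.conjTranspose_eq_transpose_of_trivial] at h
  rw [eigMat_eq, ← Matrix.transpose_map]
  have := congrArg (fun M : Matrix n n ℝ => M.map Complex.ofRealHom) h
  simp only [Matrix.map_mul] at this
  exact this.trans (by simp)

theorem eigMat_mul_transpose : eigMat hA * (eigMat hA).transpose = 1 :=
  mul_eq_one_comm.1 (eigMat_transpose_mul hA)

theorem symmFun_eq (g : ℝ → ℂ) : symmFun hA g =
    eigMat hA * Matrix.diagonal (fun j => g (hA.eigenvalues j)) * (eigMat hA).transpose := by
  ext x y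
  rw [Matrix.mul_apply]
  simp [symmFun, eigMat, Matrix.mul_diagonal]

theorem symmFun_mul (f g : ℝ → ℂ) :
    symmFun hA f * symmFun hA g = symmFun hA fun u => f u * g u := by
  rw [symmFun_eq, symmFun_eq, symmFun_eq]
  calc eigMat hA * Matrix.diagonal (fun j => f (hA.eigenvalues j)) * (eigMat hA).transpose *
      (eigMat hA * Matrix.diagonal (fun j => g (hA.eigenvalues j)) * (eigMat hA).transpose)
      = eigMat hA * (Matrix.diagonal (fun j => f (hA.eigenvalues j)) *
          ((eigMat hA).transpose * eigMat hA) * Matrix.diagonal (fun j => g (hA.eigenvalues j))) *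
          (eigMat hA).transpose := by
        simp only [Matrix.mul_assoc]
    _ = _ := by rw [eigMat_transpose_mul, Matrix.mul_one, Matrix.diagonal_mul_diagonal]

theorem symmFun_congr {f g : ℝ → ℂ} (h : ∀ j, f (hA.eigenvalues j) = g (hA.eigenvalues j)) :
    symmFun hA f = symmFun hA g := by
  rw [symmFun_eq, symmFun_eq]; simp only [h]

theorem symmFun_one : symmFun hA (fun _ => 1) = 1 := by
  rw [symmFun_eq, Matrix.diagonal_one, Matrix.mul_one, eigMat_mul_transpose]

theorem symmFun_add (f g : ℝ → ℂ) :
    symmFun hA (fun u => f u + g u) = symmFun hA f + symmFun hA g := by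
  ext x y
  simp only [symmFun, Matrix.add_apply, ← Finset.sum_add_distrib]
  exact Finset.sum_congr rfl fun j _ => by ring

theorem symmFun_sub (f g : ℝ → ℂ) :
    symmFun hA (fun u => f u - g u) = symmFun hA f - symmFun hA g := by
  ext x y
  simp only [symmFun, Matrix.sub_apply, ← Finset.sum_sub_distrib]
  exact Finset.sum_congr rfl fun j _ => by ring

theorem symmFun_const_mul (c : ℂ) (f : ℝ → ℂ) :
    symmFun hA (fun u => c * f u) = c • symmFun hA f := by
  ext x y
  simp only [symmFun, Matrix.smul_apply, smul_eq_mul, Finset.mul_sum]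
  exact Finset.sum_congr rfl fun j _ => by ring

theorem symmFun_transpose (f : ℝ → ℂ) : (symmFun hA f).transpose = symmFun hA f := by
  ext x y
  exact Finset.sum_congr rfl fun j _ => by ring

theorem symmFun_ofReal : symmFun hA (fun u => (u : ℂ)) = A.map Complex.ofReal := by
  have h := hA.spectral_theorem
  have h2 : A = (hA.eigenvectorUnitary : Matrix n n ℝ) *
      Matrix.diagonal hA.eigenvalues * (hA.eigenvectorUnitary : Matrix n n ℝ).transpose := by
    conv_lhs => rw [h]
    simp [Unitary.conjStarAlgAut_apply, Matrix.star_eq_conjTranspose,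
      Matrix.conjTranspose_eq_transpose_of_trivial]
  have := congrArg (fun M : Matrix n n ℝ => M.map Complex.ofRealHom) h2
  simp only [Matrix.map_mul] at this
  refine Eq.trans ?_ this.symm
  rw [symmFun_eq, eigMat_eq, ← Matrix.transpose_map, Matrix.diagonal_map (map_zero _)]
  rfl

theorem hasDerivAt_symmFun {f : ℝ → ℝ → ℂ} {f' : ℝ → ℂ} {t : ℝ}
    (h : ∀ j, HasDerivAt (fun s => f s (hA.eigenvalues j)) (f' (hA.eigenvalues j)) t) (x y : n) :
    HasDerivAt (fun s => symmFun hA (f s) x y) (symmFun hA f' x y) t := by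
  simp only [symmFun]
  exact HasDerivAt.fun_sum fun j _ => ((h j).const_mul _).mul_const _

/-- The real positive square root of a real symmetric matrix with non-negative spectrum. -/
def sqrtMat : Matrix n n ℝ :=
  fun x y => ∑ j, hA.eigenvectorBasis j x * √(hA.eigenvalues j) * hA.eigenvectorBasis j y

theorem sqrtMat_map : (sqrtMat hA).map Complex.ofReal = symmFun hA fun u => (√u : ℝ) := by
  ext x y
  simp [sqrtMat, symmFun]

theorem sqrtMat_isSymm : (sqrtMat hA).IsSymm := by
  ext x y
  exact Finset.sum_congr rfl fun j _ => by ring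

theorem sqrtMat_mul_self (hpos : ∀ j, 0 < hA.eigenvalues j) : sqrtMat hA * sqrtMat hA = A := by
  have h : (sqrtMat hA * sqrtMat hA).map Complex.ofRealHom = A.map Complex.ofRealHom := by
    rw [Matrix.map_mul]
    have e := sqrtMat_map hA
    change (sqrtMat hA).map Complex.ofRealHom = _ at e
    rw [e, symmFun_mul]
    refine Eq.trans (symmFun_congr hA fun j => ?_) (symmFun_ofReal hA)
    rw [← Complex.ofReal_mul, Real.mul_self_sqrt (hpos j).le]
  ext x y
  exact Complex.ofReal_injective (congrFun (congrFun h x) y)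

theorem sum_eigenvectorBasis_sq (u : n → ℝ) :
    ∑ j, (∑ x, hA.eigenvectorBasis j x * u x) ^ 2 = ∑ x, u x ^ 2 := by
  have h := hA.eigenvectorBasis.sum_sq_norm_inner_right (WithLp.toLp 2 u)
  rw [EuclideanSpace.norm_sq_eq] at h
  simp only [PiLp.inner_apply, Real.norm_eq_abs, sq_abs, RCLike.inner_apply, conj_trivial] at h
  rw [← h]
  simp only [mul_comm]

theorem sqrtMat_coercive (hpos : ∀ j, 0 < hA.eigenvalues j) : Coercive (sqrtMat hA) := by
  obtain ⟨m, hm, hle⟩ : ∃ m > 0, ∀ j, m ≤ √(hA.eigenvalues j) := by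
    rcases isEmpty_or_nonempty n with h | h
    · exact ⟨1, one_pos, fun j => h.elim j⟩
    · obtain ⟨j, hj⟩ := Finite.exists_min fun j => √(hA.eigenvalues j)
      exact ⟨_, Real.sqrt_pos.2 (hpos j), hj⟩
  refine ⟨m, hm, fun u => ?_⟩
  have e : ∑ x, ∑ y, sqrtMat hA x y * u x * u y =
      ∑ j, √(hA.eigenvalues j) * (∑ x, hA.eigenvectorBasis j x * u x) ^ 2 := by
    simp only [sqrtMat, Finset.sum_mul, pow_two]
    simp only [Finset.mul_sum]
    rw [Finset.sum_comm (s := Finset.univ (α := n)) (f := fun j x => ∑ y, √(hA.eigenvalues j) *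
      (hA.eigenvectorBasis j x * u x * (hA.eigenvectorBasis j y * u y)))]
    refine Finset.sum_congr rfl fun x _ => ?_
    rw [Finset.sum_comm]
    exact Finset.sum_congr rfl fun j _ => Finset.sum_congr rfl fun y _ => by ring
  rw [e, ← sum_eigenvectorBasis_sq hA, Finset.mul_sum]
  exact Finset.sum_le_sum fun j _ => mul_le_mul_of_nonneg_right (hle j) (sq_nonneg _)

end SymmFun

/-! ### The oscillator Hamiltonian -/

section Hamiltonian

variable {d : ℕ} (lam : ℝ) (k : (Fin d → ℤ) → ℝ) (Λ : Finset (Fin d → ℤ))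

theorem symmS_hamS : SymmS (hamS lam k Λ) := by
  unfold hamS
  refine SymmS.add (SymmS.sum _ fun x => ?_) ?_
  · exact (symmS_momS x).sq.add ((symmS_posS x).sq.real_smul _)
  · have h : SymmS (∑ x : Λ, ∑ y : Λ,
        if (nnGraph Λ).Adj x y then (lam : ℂ) • (posS x - posS y) ^ 2 else 0) := by
      refine SymmS.sum _ fun x => SymmS.sum _ fun y => ?_
      split_ifs
      · have := (symmS_posS x).add (symmS_posS y).neg
        rw [← sub_eq_add_neg] at this
        exact this.sq.real_smul lam
      · exact SymmS.zero
    simpa using h.real_smul (1 / 2)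

theorem effHam_quadratic (u : Λ → ℝ) :
    ∑ x : Λ, k x / 2 * u x ^ 2 + (1 / 2) * ∑ x : Λ, ∑ y : Λ,
      (if (nnGraph Λ).Adj x y then lam * (u x - u y) ^ 2 else 0) =
      ∑ x, ∑ y, effHam lam k Λ x y * u x * u y := by
  have h1 := (nnGraph Λ).lapMatrix_toLinearMap₂' (R := ℝ) u
  rw [Matrix.toLinearMap₂'_apply] at h1
  have h2 : ∀ x y, effHam lam k Λ x y * u x * u y =
      lam * (u x * u y * (nnGraph Λ).lapMatrix ℝ x y) +
        if x = y then k x / 2 * u x ^ 2 else 0 := by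
    intro x y
    rw [effHam, Matrix.add_apply, Matrix.smul_apply, Matrix.diagonal_apply, smul_eq_mul]
    split_ifs with h
    · subst h; ring
    · ring
  simp only [h2, Finset.sum_add_distrib, ← Finset.mul_sum, Finset.sum_ite_eq, Finset.mem_univ,
    if_true]
  simp only [smul_eq_mul] at h1
  simp only [mul_assoc] at h1 ⊢
  rw [h1]
  have h3 : ∀ x y : Λ, (if (nnGraph Λ).Adj x y then lam * (u x - u y) ^ 2 else 0) =
      lam * if (nnGraph Λ).Adj x y then (u x - u y) ^ 2 else 0 := fun x y => by
    split_ifs <;> simp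
  simp only [h3, ← Finset.mul_sum]
  ring

/-- The Hamiltonian maps a wave packet with matrix `B = √h` to a polynomial of degree one times the
same wave packet: the quadratic terms cancel because `B² = h`. -/
theorem hamS_gauss {B : Matrix Λ Λ ℝ} (hB : Coercive B) (hs : B.IsSymm)
    (hBB : B * B = effHam lam k Λ) (z : Λ → ℂ) :
    hamS lam k Λ (gauss hB z) = ((B.trace : ℂ) - ∑ x, z x ^ 2) • gauss hB z +
      ∑ x, (2 * ∑ y, (B x y : ℂ) * z y) • posS x (gauss hB z) := by
  ext u
  set G := gauss hB z u with hG
  set b : Λ → ℂ := fun x => ∑ y, (B x y : ℂ) * u y with hb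
  have hmom : ∀ x, (momS x ^ 2) (gauss hB z) u = (-(z x - b x) ^ 2 + B x x) * G := by
    intro x
    rw [pow_two, mul_apply_eq_comp, momS_gauss hB hs, map_smul, map_sub, map_smul, map_sum]
    simp only [map_smul, momS_posS, smul_apply, sub_apply, sum_apply, smul_eq_mul, posS_apply,
      momS_gauss_apply hB hs, ← hG, mul_sub, Finset.sum_sub_distrib, ite_mul, zero_mul, mul_ite,
      mul_zero, Finset.sum_ite_eq, Finset.mem_univ, if_true]
    have h1 : ∀ c : ℂ, ∑ y, (B x y : ℂ) * (u y * c) = b x * c := fun c => by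
      rw [hb, Finset.sum_mul]; exact Finset.sum_congr rfl fun y _ => by ring
    simp only [← mul_sub, h1]
    have hI : Complex.I ^ 2 = -1 := Complex.I_sq
    linear_combination ((z x - b x) ^ 2 * G + -(B x x : ℂ) * G) * hI
  have hpot : ∑ x : Λ, ((k x / 2 : ℝ) : ℂ) * (u x : ℂ) ^ 2 + (1 / 2) * ∑ x, ∑ y,
      (if (nnGraph Λ).Adj x y then (lam : ℂ) * ((u x : ℂ) - u y) ^ 2 else 0) = ∑ x, b x ^ 2 := by
    have h1 := congrArg Complex.ofReal (effHam_quadratic lam k Λ u)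
    have h2 : ∑ x, b x ^ 2 = ((∑ x, ∑ y, effHam lam k Λ x y * u x * u y : ℝ) : ℂ) := by
      have h3 : ∑ x, (∑ y, B x y * u y) ^ 2 = ∑ x, ∑ y, effHam lam k Λ x y * u x * u y := by
        have e1 : ∑ x, ∑ y, effHam lam k Λ x y * u x * u y = u ⬝ᵥ ((B * B).mulVec u) := by
          rw [hBB]
          simp only [dotProduct, Matrix.mulVec, Finset.mul_sum]
          exact Finset.sum_congr rfl fun x _ => Finset.sum_congr rfl fun y _ => by ring
        rw [e1, ← Matrix.mulVec_mulVec, Matrix.dotProduct_mulVec, ← Matrix.mulVec_transpose, hs.eq]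
        simp only [dotProduct, Matrix.mulVec, pow_two]
      rw [← h3]; simp [hb]
    rw [h2, ← h1]
    push_cast
    congr 3
    funext x
    refine Finset.sum_congr rfl fun y _ => ?_
    split_ifs <;> simp
  have hq : ∀ x, ∀ η : 𝓢(Λ → ℝ, ℂ), (posS x ^ 2) η u = (u x : ℂ) ^ 2 * η u := fun x η => by
    rw [pow_two, mul_apply_eq_comp, posS_apply, posS_apply]; ring
  have hqq : ∀ x y, ∀ η : 𝓢(Λ → ℝ, ℂ), ((posS x - posS y) ^ 2) η u =
      ((u x : ℂ) - u y) ^ 2 * η u := fun x y η => by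
    rw [pow_two, mul_apply_eq_comp, sub_apply, sub_apply, posS_apply, posS_apply, sub_apply,
      sub_apply, posS_apply, posS_apply]; ring
  have hL : hamS lam k Λ (gauss hB z) u = (∑ x, (-(z x - b x) ^ 2 + B x x)) * G +
      (∑ x : Λ, ((k x / 2 : ℝ) : ℂ) * (u x : ℂ) ^ 2 + (1 / 2) * ∑ x, ∑ y,
      (if (nnGraph Λ).Adj x y then (lam : ℂ) * ((u x : ℂ) - u y) ^ 2 else 0)) * G := by
    have hif : ∀ x y : Λ, ((if (nnGraph Λ).Adj x y then (lam : ℂ) • (posS x - posS y) ^ 2 else 0 :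
        𝓢(Λ → ℝ, ℂ) →L[ℂ] 𝓢(Λ → ℝ, ℂ)) (gauss hB z)) u =
        (if (nnGraph Λ).Adj x y then (lam : ℂ) * ((u x : ℂ) - u y) ^ 2 else 0) * G := by
      intro x y
      split_ifs
      · rw [smul_apply, smul_apply, hqq, smul_eq_mul, mul_assoc]
      · simp
    simp only [hamS, add_apply, sum_apply, smul_apply, hif, hmom, hq, smul_eq_mul, ← hG,
      Finset.sum_add_distrib, ← Finset.sum_mul, ← mul_assoc]
    ring
  rw [hL, hpot]
  have hR : (((B.trace : ℂ) - ∑ x, z x ^ 2) • gauss hB z +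
      ∑ x, (2 * ∑ y, (B x y : ℂ) * z y) • posS x (gauss hB z)) u =
      ((B.trace : ℂ) - ∑ x, z x ^ 2 + 2 * ∑ x, z x * b x) * G := by
    have h1 : ∑ x, z x * b x = ∑ x, (∑ y, (B x y : ℂ) * z y) * u x := by
      simp only [hb, Finset.mul_sum, Finset.sum_mul]
      rw [Finset.sum_comm]
      refine Finset.sum_congr rfl fun x _ => Finset.sum_congr rfl fun y _ => ?_
      rw [hs.apply]; ring
    simp only [add_apply, smul_apply, sum_apply, posS_apply, smul_eq_mul, ← hG, h1]
    rw [Finset.mul_sum, add_mul, Finset.sum_mul]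
    congr 1
    exact Finset.sum_congr rfl fun x _ => by ring
  rw [hR, ← add_mul]
  congr 1
  have h1 : (B.trace : ℂ) = ∑ x, (B x x : ℂ) := by simp [Matrix.trace]
  rw [h1, Finset.mul_sum, ← Finset.sum_add_distrib, ← Finset.sum_sub_distrib,
    ← Finset.sum_add_distrib]
  exact Finset.sum_congr rfl fun x _ => by ring

end Hamiltonian

/-! ### Schrödinger evolution of wave packets -/

section CoreFlowRealization

variable {ι : Type*} [Fintype ι]

theorem dense_domain_realization {A : 𝓢(ι → ℝ, ℂ) →L[ℂ] 𝓢(ι → ℝ, ℂ)} (hA : SymmS A) :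
    Dense ((realization A).domain : Set (L2 ι)) := by
  refine total_emb.mono (Submodule.span_le.2 ?_)
  rintro _ ⟨η, rfl⟩
  exact (mem_graph_iff_app.1 (mem_graph_realization.2
    (show WeakPair emb A.toLinearMap (emb η) (emb (A η)) from fun ξ => (hA ξ η).symm))).1

/-- The unitary group of the realization of an operator with an invariant family of wave packets. -/
theorem isUnitaryGroup_expGroup {A : 𝓢(ι → ℝ, ℂ) →L[ℂ] 𝓢(ι → ℝ, ℂ)} {X : Type*}
    {c : X → 𝓢(ι → ℝ, ℂ)} {φ : ℝ → X → X} {κ : ℝ → X → ℂ}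
    (h : CoreFlow emb A.toLinearMap c φ κ) :
    IsUnitaryGroup (realization A) (expGroup (realization A)) ∧
      ∀ t x, expGroup (realization A) t (emb (c x)) = κ t x • emb (c (φ t x)) := by
  obtain ⟨U, h0, h1, h2, h3, h4⟩ := h.exists_group
  have hU : IsUnitaryGroup (realization A) U :=
    ⟨h0, h1, h2, h3, fun ψ χ => mem_graph_realization.trans
      (h.weak_iff_hasDerivAt h0 h1 h2 h3 h4 ψ χ).1⟩
  have hex : ∃ U, IsUnitaryGroup (realization A) U := ⟨U, hU⟩
  have he : expGroup (realization A) = hex.choose := by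
    funext t; rw [expGroup, dif_pos hex]
  have hg : IsUnitaryGroup (realization A) (expGroup (realization A)) := he ▸ hex.choose_spec
  refine ⟨hg, fun t x => ?_⟩
  rw [IsUnitaryGroup.unique (dense_domain_realization h.symm) hg hU, h4]

end CoreFlowRealization

section HamiltonianFlow

variable {d : ℕ} (lam : ℝ) (k : (Fin d → ℤ) → ℝ) (Λ : Finset (Fin d → ℤ))

/-- Functional calculus of the effective Hamiltonian. -/
abbrev effFun (g : ℝ → ℂ) : Matrix Λ Λ ℂ := symmFun (effHam_isHermitian lam k Λ) g

/-- The parameter at time `t` of an evolving wave packet, `z ↦ e^{-2it√h} z`. -/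
def hamShift (t : ℝ) (z : Λ → ℂ) : Λ → ℂ :=
  (effFun lam k Λ fun u => Complex.exp (-2 * Complex.I * √u * t)).mulVec z

/-- The scalar factor at time `t` of an evolving wave packet. -/
def hamPhase (t : ℝ) (z : Λ → ℂ) : ℂ :=
  Complex.exp (-Complex.I * (sqrtMat (effHam_isHermitian lam k Λ)).trace * t + (1 / 4) * z ⬝ᵥ
    (effFun lam k Λ fun u => (√u : ℂ)⁻¹ * (1 - Complex.exp (-4 * Complex.I * √u * t))).mulVec z)

variable {lam k Λ}

theorem hamShift_zero (z : Λ → ℂ) : hamShift lam k Λ 0 z = z := by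
  simp [hamShift, effFun, symmFun_one]

theorem hamShift_add (s t : ℝ) (z : Λ → ℂ) :
    hamShift lam k Λ (s + t) z = hamShift lam k Λ s (hamShift lam k Λ t z) := by
  simp only [hamShift, effFun, Matrix.mulVec_mulVec, symmFun_mul, ← Complex.exp_add]
  congr 2
  funext u
  congr 1
  push_cast; ring

theorem dotProduct_symmFun_mulVec {n : Type*} [Fintype n] [DecidableEq n] {A : Matrix n n ℝ}
    (hA : A.IsHermitian) (f g : ℝ → ℂ) (z : n → ℂ) :
    (symmFun hA g).mulVec z ⬝ᵥ (symmFun hA f).mulVec ((symmFun hA g).mulVec z) =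
      z ⬝ᵥ (symmFun hA fun u => g u * f u * g u).mulVec z := by
  rw [← symmFun_mul, ← symmFun_mul, ← Matrix.mulVec_mulVec, ← Matrix.mulVec_mulVec,
    Matrix.dotProduct_mulVec z, ← Matrix.mulVec_transpose, symmFun_transpose]

theorem hamPhase_add (s t : ℝ) (z : Λ → ℂ) : hamPhase lam k Λ (s + t) z =
    hamPhase lam k Λ s (hamShift lam k Λ t z) * hamPhase lam k Λ t z := by
  rw [hamPhase, hamPhase, hamPhase, hamShift, dotProduct_symmFun_mulVec, ← Complex.exp_add]
  congr 1
  have : (effFun lam k Λ fun u => (√u : ℂ)⁻¹ *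
      (1 - Complex.exp (-4 * Complex.I * √u * (s + t : ℝ)))) =
      (effFun lam k Λ fun u => Complex.exp (-2 * Complex.I * √u * t) * ((√u : ℂ)⁻¹ *
        (1 - Complex.exp (-4 * Complex.I * √u * s))) * Complex.exp (-2 * Complex.I * √u * t)) +
      effFun lam k Λ fun u => (√u : ℂ)⁻¹ * (1 - Complex.exp (-4 * Complex.I * √u * t)) := by
    rw [effFun, effFun, effFun, ← symmFun_add]
    congr 1
    funext u
    have h1 : Complex.exp (-4 * Complex.I * √u * t) =
        Complex.exp (-2 * Complex.I * √u * t) * Complex.exp (-2 * Complex.I * √u * t) := by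
      rw [← Complex.exp_add]; congr 1; ring
    have h2 : Complex.exp (-4 * Complex.I * √u * (s + t : ℝ)) =
        Complex.exp (-4 * Complex.I * √u * s) * Complex.exp (-4 * Complex.I * √u * t) := by
      rw [← Complex.exp_add]; congr 1; push_cast; ring
    rw [h2, h1]; ring
  rw [this, Matrix.add_mulVec, dotProduct_add]
  push_cast; ring

theorem hasDerivAt_symmFun_mulVec {n : Type*} [Fintype n] [DecidableEq n] {A : Matrix n n ℝ}
    (hA : A.IsHermitian) {f : ℝ → ℝ → ℂ} {f' : ℝ → ℂ} {t : ℝ}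
    (h : ∀ j, HasDerivAt (fun s => f s (hA.eigenvalues j)) (f' (hA.eigenvalues j)) t) (z : n → ℂ) :
    HasDerivAt (fun s => (symmFun hA (f s)).mulVec z) ((symmFun hA f').mulVec z) t := by
  rw [hasDerivAt_pi]
  intro x
  simp only [Matrix.mulVec, dotProduct]
  exact HasDerivAt.fun_sum fun y _ => (hasDerivAt_symmFun hA h x y).mul_const _

theorem hasDerivAt_cexp_mul (c : ℂ) :
    HasDerivAt (fun t : ℝ => Complex.exp (c * t)) c 0 := by
  have := ((hasDerivAt_ofReal 0).const_mul c).cexp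
  simpa using this

/-- Wave packets with matrix `√h` remain wave packets under the Schrödinger evolution. -/
theorem coreFlow_hamS (hpos : ∀ j, 0 < (effHam_isHermitian lam k Λ).eigenvalues j) :
    CoreFlow (S := 𝓢(Λ → ℝ, ℂ)) emb (hamS lam k Λ).toLinearMap
      (gauss (sqrtMat_coercive (effHam_isHermitian lam k Λ) hpos))
      (hamShift lam k Λ) (hamPhase lam k Λ) where
  total := total_gauss _
  symm := symmS_hamS lam k Λ
  φ_zero := hamShift_zero
  φ_add := hamShift_add
  κ_zero z := by
    rw [hamPhase]
    have : (effFun lam k Λ fun u => (√u : ℂ)⁻¹ *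
        (1 - Complex.exp (-4 * Complex.I * √u * (0 : ℝ)))) = 0 := by
      ext x y; simp [effFun, symmFun]
    rw [this]; simp
  κ_add := hamPhase_add
  deriv z := by
    set hA := effHam_isHermitian lam k Λ
    have h1 : HasDerivAt (fun t => hamShift lam k Λ t z)
        ((effFun lam k Λ fun u => -2 * Complex.I * √u).mulVec z) 0 :=
      hasDerivAt_symmFun_mulVec hA (fun j => hasDerivAt_cexp_mul _) z
    have h2 : HasDerivAt (fun t => hamPhase lam k Λ t z)
        (-Complex.I * (sqrtMat hA).trace + Complex.I * ∑ x, z x ^ 2) 0 := by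
      have h3 : HasDerivAt (fun t : ℝ => (effFun lam k Λ fun u => (√u : ℂ)⁻¹ *
          (1 - Complex.exp (-4 * Complex.I * √u * t))).mulVec z)
          ((effFun lam k Λ fun _ => 4 * Complex.I).mulVec z) 0 := by
        refine hasDerivAt_symmFun_mulVec hA (fun j => ?_) z
        have := ((hasDerivAt_cexp_mul (-4 * Complex.I * √(hA.eigenvalues j))).const_sub 1).const_mul
          (√(hA.eigenvalues j) : ℂ)⁻¹
        refine this.congr_deriv ?_
        have : (√(hA.eigenvalues j) : ℂ) ≠ 0 := by
          exact_mod_cast (Real.sqrt_pos.2 (hpos j)).ne'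
        field_simp
      have h4 : HasDerivAt (fun t : ℝ => z ⬝ᵥ (effFun lam k Λ fun u => (√u : ℂ)⁻¹ *
          (1 - Complex.exp (-4 * Complex.I * √u * t))).mulVec z)
          (z ⬝ᵥ (effFun lam k Λ fun _ => 4 * Complex.I).mulVec z) 0 := by
        simp only [dotProduct]
        exact HasDerivAt.fun_sum fun x _ => ((hasDerivAt_pi.1 h3) x).const_mul (z x)
      have h5 := (((hasDerivAt_ofReal 0).const_mul (-Complex.I * (sqrtMat hA).trace)).fun_add
        (h4.const_mul (1 / 4))).cexp
      have h6 : (effFun lam k Λ fun u => (√u : ℂ)⁻¹ *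
        (1 - Complex.exp (-4 * Complex.I * √u * (0 : ℝ)))) = 0 := by
        ext x y; simp [effFun, symmFun]
      have h7 : (effFun lam k Λ fun _ => 4 * Complex.I).mulVec z = (4 * Complex.I) • z := by
        have := symmFun_const_mul hA (4 * Complex.I) fun _ => 1
        rw [symmFun_one, mul_one] at this
        rw [effFun, this, Matrix.smul_mulVec, Matrix.one_mulVec]
      refine h5.congr_deriv ?_
      rw [h6, h7]
      simp [dotProduct, pow_two, Finset.mul_sum]
      refine Finset.sum_congr rfl fun x _ => by ring
    have h3 := hasDerivAt_smul_gauss (sqrtMat_coercive hA hpos) h2 h1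
    refine h3.congr_deriv ?_
    rw [← map_smul]
    congr 1
    show _ = -Complex.I • hamS lam k Λ (gauss _ z)
    rw [hamS_gauss lam k Λ _ (sqrtMat_isSymm hA) (sqrtMat_mul_self hA hpos), hamShift_zero]
    have h4 : hamPhase lam k Λ 0 z = 1 := by
      rw [hamPhase]
      have h6 : (effFun lam k Λ fun u => (√u : ℂ)⁻¹ *
        (1 - Complex.exp (-4 * Complex.I * √u * (0 : ℝ)))) = 0 := by
        ext x y; simp [effFun, symmFun]
      rw [h6]; simp
    have h5 : ∀ x, (effFun lam k Λ fun u => -2 * Complex.I * √u).mulVec z x =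
        -Complex.I * (2 * ∑ y, (sqrtMat hA x y : ℂ) * z y) := by
      intro x
      rw [effFun, symmFun_const_mul, ← sqrtMat_map, Matrix.smul_mulVec]
      simp [Matrix.mulVec, dotProduct]; ring
    rw [h4, one_smul, smul_add, smul_smul, Finset.smul_sum]
    congr 1
    · congr 1; ring
    · refine Finset.sum_congr rfl fun x _ => ?_
      rw [h5, smul_smul]

theorem isUnitaryGroup_ham (hpos : ∀ j, 0 < (effHam_isHermitian lam k Λ).eigenvalues j) :
    IsUnitaryGroup (ham lam k Λ) (expGroup (ham lam k Λ)) :=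
  (isUnitaryGroup_expGroup (coreFlow_hamS hpos)).1

theorem expGroup_ham_gauss (hpos : ∀ j, 0 < (effHam_isHermitian lam k Λ).eigenvalues j) (t : ℝ)
    (z : Λ → ℂ) :
    expGroup (ham lam k Λ) t
      (emb (gauss (sqrtMat_coercive (effHam_isHermitian lam k Λ) hpos) z)) =
      hamPhase lam k Λ t z • emb (gauss (sqrtMat_coercive (effHam_isHermitian lam k Λ) hpos)
        (hamShift lam k Λ t z)) :=
  (isUnitaryGroup_expGroup (coreFlow_hamS hpos)).2 t z

/-! ### Heisenberg evolution of positions and momenta -/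

variable (lam k Λ) in
/-- The matrix of the linear Hamiltonian flow generated by `p² + q·hq`. -/
def flowMatrix (t : ℝ) : Matrix (Λ ⊕ Λ) (Λ ⊕ Λ) ℂ :=
  Matrix.fromBlocks (effFun lam k Λ fun u => (Real.cos (2 * √u * t) : ℝ))
    (effFun lam k Λ fun u => ((√u)⁻¹ * Real.sin (2 * √u * t) : ℝ))
    (effFun lam k Λ fun u => (-√u * Real.sin (2 * √u * t) : ℝ))
    (effFun lam k Λ fun u => (Real.cos (2 * √u * t) : ℝ))

theorem star_symmFun_ofReal {n : Type*} [Fintype n] [DecidableEq n] {A : Matrix n n ℝ}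
    (hA : A.IsHermitian) (f : ℝ → ℝ) (x y : n) :
    (starRingEnd ℂ) (symmFun hA (fun u => (f u : ℂ)) x y) = symmFun hA (fun u => (f u : ℂ)) x y := by
  simp [symmFun]

theorem star_flowMatrix (t : ℝ) (a b : Λ ⊕ Λ) :
    (starRingEnd ℂ) (flowMatrix lam k Λ t a b) = flowMatrix lam k Λ t a b := by
  rcases a with a | a <;> rcases b with b | b <;>
  · simp only [flowMatrix, Matrix.fromBlocks_apply₁₁, Matrix.fromBlocks_apply₁₂,
      Matrix.fromBlocks_apply₂₁, Matrix.fromBlocks_apply₂₂]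
    exact star_symmFun_ofReal _ _ _ _

/-- The combination of positions given by row `x` of the matrix `N`, applied to `η`. -/
def posRow {ι : Type*} [Fintype ι] (N : Matrix ι ι ℂ) (η : 𝓢(ι → ℝ, ℂ)) (x : ι) : 𝓢(ι → ℝ, ℂ) :=
  ∑ y, N x y • posS y η

theorem posRow_add {ι : Type*} [Fintype ι] (N N' : Matrix ι ι ℂ) (η : 𝓢(ι → ℝ, ℂ)) (x : ι) :
    posRow (N + N') η x = posRow N η x + posRow N' η x := by
  simp [posRow, add_smul, Finset.sum_add_distrib]

theorem posRow_smul {ι : Type*} [Fintype ι] (c : ℂ) (N : Matrix ι ι ℂ) (η : 𝓢(ι → ℝ, ℂ)) (x : ι) :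
    posRow (c • N) η x = c • posRow N η x := by
  simp [posRow, mul_smul, Finset.smul_sum]

theorem sum_smul_posRow {ι : Type*} [Fintype ι] (M N : Matrix ι ι ℂ) (η : 𝓢(ι → ℝ, ℂ)) (x : ι) :
    ∑ y, M x y • posRow N η y = posRow (M * N) η x := by
  simp only [posRow, Finset.smul_sum, smul_smul, Matrix.mul_apply, Finset.sum_smul]
  rw [Finset.sum_comm]

theorem sum_smul_momS_gauss {ι : Type*} [Fintype ι] [DecidableEq ι] {B : Matrix ι ι ℝ}
    (hB : Coercive B) (hs : B.IsSymm) (N : Matrix ι ι ℂ) (z : ι → ℂ) (x : ι) :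
    ∑ y, N x y • momS y (gauss hB z) = -Complex.I • (N.mulVec z x • gauss hB z -
      posRow (N * B.map Complex.ofReal) (gauss hB z) x) := by
  have h : ∀ y, momS y (gauss hB z) = -Complex.I • (z y • gauss hB z -
      posRow (B.map Complex.ofReal) (gauss hB z) y) := fun y => by
    rw [momS_gauss hB hs]; rfl
  simp only [h, smul_comm (N x _) (-Complex.I), ← Finset.smul_sum, smul_sub,
    Finset.sum_sub_distrib, sum_smul_posRow]
  congr 2
  rw [Matrix.mulVec, dotProduct, Finset.sum_smul]
  simp only [smul_smul]

theorem expGroup_ham_posS_gauss (hpos : ∀ j, 0 < (effHam_isHermitian lam k Λ).eigenvalues j)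
    (t : ℝ) (z : Λ → ℂ) (x : Λ) :
    expGroup (ham lam k Λ) t
      (emb (posS x (gauss (sqrtMat_coercive (effHam_isHermitian lam k Λ) hpos) z))) =
      hamPhase lam k Λ t z • emb (((effFun lam k Λ fun u => (1 / 2) * ((√u : ℂ)⁻¹ *
        (1 - Complex.exp (-4 * Complex.I * √u * t)))).mulVec z x) •
          gauss (sqrtMat_coercive (effHam_isHermitian lam k Λ) hpos) (hamShift lam k Λ t z) +
        posRow (effFun lam k Λ fun u => Complex.exp (-2 * Complex.I * √u * t))
          (gauss (sqrtMat_coercive (effHam_isHermitian lam k Λ) hpos) (hamShift lam k Λ t z)) x) := by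
  set hA := effHam_isHermitian lam k Λ
  set hB := sqrtMat_coercive hA hpos
  -- differentiate `U t (emb (gauss hB z))` in direction `δ_x` of the parameter `z`
  have hcurve : HasDerivAt (fun s : ℝ => z + (s : ℂ) • (Pi.single x 1 : Λ → ℂ))
      (Pi.single x 1 : Λ → ℂ) 0 := by
    simpa using ((hasDerivAt_ofReal 0).smul_const (Pi.single x 1 : Λ → ℂ)).const_add z
  have h1 : HasDerivAt (fun s : ℝ => emb (gauss hB (z + (s : ℂ) • (Pi.single x 1 : Λ → ℂ))))
      (emb (posS x (gauss hB z))) 0 := by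
    have := hasDerivAt_smul_gauss hB (hasDerivAt_const (0 : ℝ) (1 : ℂ)) hcurve
    simpa [Pi.single_apply] using this
  have h2 := ((expGroup (ham lam k Λ) t).restrictScalars ℝ).hasFDerivAt.comp_hasDerivAt 0 h1
  set E := effFun lam k Λ fun u => Complex.exp (-2 * Complex.I * √u * t) with hE
  set F := effFun lam k Λ fun u => (√u : ℂ)⁻¹ * (1 - Complex.exp (-4 * Complex.I * √u * t)) with hF
  have h3 : HasDerivAt (fun s : ℝ => hamShift lam k Λ t (z + (s : ℂ) • (Pi.single x 1 : Λ → ℂ)))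
      (fun y => E x y) 0 := by
    have e : (fun s : ℝ => hamShift lam k Λ t (z + (s : ℂ) • (Pi.single x 1 : Λ → ℂ))) =
        fun s : ℝ => hamShift lam k Λ t z + (s : ℂ) • fun y => E x y := by
      funext s
      simp only [hamShift, Matrix.mulVec_add, Matrix.mulVec_smul]
      congr 2
      ext y
      rw [Matrix.mulVec_single_one, Matrix.col_apply, ← hE]
      exact congrFun (congrFun (symmFun_transpose hA _) y) x |>.symm
    rw [e]
    simpa using ((hasDerivAt_ofReal 0).smul_const (fun y => E x y)).const_add
      (hamShift lam k Λ t z)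
  have h4 : HasDerivAt (fun s : ℝ => hamPhase lam k Λ t (z + (s : ℂ) • (Pi.single x 1 : Λ → ℂ)))
      (hamPhase lam k Λ t z * ((1 / 2) * F.mulVec z x)) 0 := by
    have e : ∀ s : ℝ, (z + (s : ℂ) • (Pi.single x 1 : Λ → ℂ)) ⬝ᵥ
        F.mulVec (z + (s : ℂ) • (Pi.single x 1 : Λ → ℂ)) =
        z ⬝ᵥ F.mulVec z + (s : ℂ) * (2 * F.mulVec z x) + (s : ℂ) ^ 2 * F x x := by
      intro s
      have h5 : z ⬝ᵥ F.mulVec (Pi.single x 1) = F.mulVec z x := by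
        rw [Matrix.dotProduct_mulVec, ← Matrix.mulVec_transpose, hF, effFun, symmFun_transpose,
          dotProduct_single_one]
      simp only [Matrix.mulVec_add, Matrix.mulVec_smul, add_dotProduct, dotProduct_add,
        smul_dotProduct, dotProduct_smul, h5, single_one_dotProduct, smul_eq_mul]
      simp
      ring
    have h6 : HasDerivAt (fun s : ℝ => z ⬝ᵥ F.mulVec z + (s : ℂ) * (2 * F.mulVec z x) +
        (s : ℂ) ^ 2 * F x x) (2 * F.mulVec z x) 0 := by
      have := ((((hasDerivAt_ofReal 0).mul_const (2 * F.mulVec z x)).const_add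
        (z ⬝ᵥ F.mulVec z)).fun_add (((hasDerivAt_ofReal 0).fun_pow 2).mul_const (F x x)))
      simpa using this
    have h7 := ((h6.const_mul (1 / 4)).const_add (-Complex.I * (sqrtMat hA).trace * t)).cexp
    simp only [hamPhase, ← hF, e]
    refine h7.congr_deriv ?_
    simp; ring
  have h5 := hasDerivAt_smul_gauss hB h4 h3
  have h6 : (fun s : ℝ => hamPhase lam k Λ t (z + (s : ℂ) • (Pi.single x 1 : Λ → ℂ)) •
      emb (gauss hB (hamShift lam k Λ t (z + (s : ℂ) • (Pi.single x 1 : Λ → ℂ))))) =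
      ((expGroup (ham lam k Λ) t).restrictScalars ℝ) ∘
        fun s : ℝ => emb (gauss hB (z + (s : ℂ) • (Pi.single x 1 : Λ → ℂ))) := by
    funext s
    exact (expGroup_ham_gauss hpos t _).symm
  rw [h6] at h5
  have h7 := h2.unique h5
  refine h7.trans ?_
  rw [← map_smul, effFun, symmFun_const_mul, smul_add, smul_smul, Matrix.smul_mulVec]
  simp [posRow, hF]

theorem exp_two_mul (w : ℂ) : Complex.exp (2 * w) = Complex.exp w ^ 2 := by
  rw [← Complex.exp_nat_mul]; norm_num

/-- The Heisenberg equations of motion, on wave packets. -/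
theorem expGroup_ham_qpS_gauss (hpos : ∀ j, 0 < (effHam_isHermitian lam k Λ).eigenvalues j)
    (t : ℝ) (z : Λ → ℂ) (a : Λ ⊕ Λ) :
    expGroup (ham lam k Λ) (-t)
      (emb (qpS a (gauss (sqrtMat_coercive (effHam_isHermitian lam k Λ) hpos) z))) =
      hamPhase lam k Λ (-t) z • ∑ b, flowMatrix lam k Λ t a b • emb (qpS b
        (gauss (sqrtMat_coercive (effHam_isHermitian lam k Λ) hpos) (hamShift lam k Λ (-t) z))) := by
  set hA := effHam_isHermitian lam k Λ
  set hB := sqrtMat_coercive hA hpos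
  set G := gauss hB (hamShift lam k Λ (-t) z) with hG
  have hne : ∀ j, (√(hA.eigenvalues j) : ℂ) ≠ 0 := fun j => by
    exact_mod_cast (Real.sqrt_pos.2 (hpos j)).ne'
  have hexp : ∀ u : ℝ, Complex.exp (-4 * Complex.I * √u * (-t : ℝ)) =
      Complex.exp (-2 * Complex.I * √u * (-t : ℝ)) ^ 2 := fun u => by
    rw [← exp_two_mul]; congr 1; ring
  set e : ℝ → ℂ := fun u => Complex.exp (-2 * Complex.I * √u * (-t : ℝ)) with he
  have hcs : ∀ u : ℝ, e u =
      (Real.cos (2 * √u * t) : ℂ) + Complex.I * (Real.sin (2 * √u * t) : ℂ) := fun u => by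
    rw [Complex.ofReal_cos, Complex.ofReal_sin, mul_comm Complex.I, ← Complex.exp_mul_I]
    rw [he]; push_cast; ring_nf
  have hpy : ∀ u : ℝ, (Real.cos (2 * √u * t) : ℂ) ^ 2 + (Real.sin (2 * √u * t) : ℂ) ^ 2 = 1 :=
    fun u => by exact_mod_cast Real.cos_sq_add_sin_sq _
  have hI : Complex.I ^ 2 = -1 := Complex.I_sq
  have hshift : hamShift lam k Λ (-t) z = (symmFun hA e).mulVec z := rfl
  set N := symmFun hA fun u => (1 / 2) * ((√u : ℂ)⁻¹ * (1 - e u ^ 2)) with hN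
  have hpos_gauss : ∀ x, expGroup (ham lam k Λ) (-t) (emb (posS x (gauss hB z))) =
      hamPhase lam k Λ (-t) z • emb (N.mulVec z x • G + posRow (symmFun hA e) G x) := by
    intro x
    have := expGroup_ham_posS_gauss hpos (-t) z x
    simp only [hexp] at this
    exact this
  rcases a with x | x
  · have hrhs : ∑ b, flowMatrix lam k Λ t (Sum.inl x) b • emb (qpS b G) =
        emb (posRow (symmFun hA fun u => (Real.cos (2 * √u * t) : ℝ)) G x +
          ∑ y, symmFun hA (fun u => ((√u)⁻¹ * Real.sin (2 * √u * t) : ℝ)) x y • momS y G) := by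
      simp only [posRow, map_add, map_sum, map_smul, Fintype.sum_sum_type]
      rfl
    rw [hrhs]
    refine (hpos_gauss x).trans ?_
    congr 2
    rw [hG, sum_smul_momS_gauss hB (sqrtMat_isSymm hA), ← hG, sqrtMat_map, symmFun_mul, hshift,
      Matrix.mulVec_mulVec, symmFun_mul]
    have h1 : N = -Complex.I •
        symmFun hA fun u => ((√u)⁻¹ * Real.sin (2 * √u * t) : ℝ) * e u := by
      rw [← symmFun_const_mul, hN]
      congr 1; funext u
      rw [hcs, Complex.ofReal_mul, Complex.ofReal_inv]
      linear_combination ((√u : ℂ)⁻¹ / 2) * (-hpy u + (Real.sin (2 * √u * t) : ℂ) ^ 2 * hI)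
    have h2 : symmFun hA e = symmFun hA (fun u => (Real.cos (2 * √u * t) : ℝ)) + Complex.I •
        symmFun hA fun u => ((√u)⁻¹ * Real.sin (2 * √u * t) : ℝ) * (√u : ℝ) := by
      rw [← symmFun_const_mul, ← symmFun_add]
      refine symmFun_congr hA fun j => ?_
      rw [hcs]; push_cast
      have := hne j
      field_simp
    rw [h1, h2, Matrix.smul_mulVec, posRow_add, posRow_smul, Pi.smul_apply, smul_eq_mul]
    module
  · have hrhs : ∑ b, flowMatrix lam k Λ t (Sum.inr x) b • emb (qpS b G) =
        emb (posRow (symmFun hA fun u => (-√u * Real.sin (2 * √u * t) : ℝ)) G x +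
          ∑ y, symmFun hA (fun u => (Real.cos (2 * √u * t) : ℝ)) x y • momS y G) := by
      simp only [posRow, map_add, map_sum, map_smul, Fintype.sum_sum_type]
      rfl
    have hlhs : expGroup (ham lam k Λ) (-t) (emb (momS x (gauss hB z))) =
        hamPhase lam k Λ (-t) z • emb (-Complex.I • (z x • G -
          (((sqrtMat hA).map Complex.ofReal * N).mulVec z x • G +
            posRow ((sqrtMat hA).map Complex.ofReal * symmFun hA e) G x))) := by
      rw [momS_gauss hB (sqrtMat_isSymm hA)]
      simp only [map_smul, map_sub, map_sum, expGroup_ham_gauss hpos, hpos_gauss]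
      rw [← sum_smul_posRow, ← Matrix.mulVec_mulVec, Matrix.mulVec, dotProduct, Finset.sum_smul]
      simp only [← map_smul, ← map_sum, ← map_sub]
      congr 1
      rw [smul_comm _ (-Complex.I), smul_sub (hamPhase lam k Λ (-t) z), smul_comm _ (z x),
        ← Finset.sum_add_distrib, Finset.smul_sum]
      refine congrArg (fun η => -Complex.I • (z x • hamPhase lam k Λ (-t) z • G - η))
        (Finset.sum_congr rfl fun y _ => ?_)
      rw [Matrix.map_apply]
      module
    rw [hrhs]
    refine hlhs.trans ?_
    congr 2
    rw [hG, sum_smul_momS_gauss hB (sqrtMat_isSymm hA), ← hG, sqrtMat_map, symmFun_mul, hshift,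
      Matrix.mulVec_mulVec, symmFun_mul, symmFun_mul, symmFun_mul]
    have h1 : (symmFun hA fun u => (√u : ℝ) * ((1 / 2) * ((√u : ℂ)⁻¹ * (1 - e u ^ 2)))) =
        1 - symmFun hA fun u => (Real.cos (2 * √u * t) : ℝ) * e u := by
      rw [← symmFun_one hA, ← symmFun_sub]
      refine symmFun_congr hA fun j => ?_
      rw [hcs]
      have := hne j
      field_simp
      linear_combination hpy (hA.eigenvalues j) -
        (Real.sin (2 * √(hA.eigenvalues j) * t) : ℂ) ^ 2 * hI
    have h2 : (symmFun hA fun u => (√u : ℝ) * e u) = symmFun hA (fun u =>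
          (Real.cos (2 * √u * t) : ℝ) * ((√u : ℝ) : ℂ)) + -Complex.I •
        symmFun hA fun u => (-√u * Real.sin (2 * √u * t) : ℝ) := by
      rw [← symmFun_const_mul, ← symmFun_add]
      congr 1; funext u
      rw [hcs]; push_cast
      ring
    rw [h1, h2, posRow_add, posRow_smul, Matrix.sub_mulVec, Pi.sub_apply, Matrix.one_mulVec]
    have h3 : ∀ η : 𝓢(Λ → ℝ, ℂ), Complex.I • Complex.I • η = -η := fun η => by
      rw [smul_smul, Complex.I_mul_I, neg_one_smul]
    simp only [neg_smul, smul_sub, smul_add, sub_smul, smul_neg, h3]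
    abel

/-- The Heisenberg equations of motion `q(t) = cos(2t√h) q + h^{-1/2} sin(2t√h) p` and
`p(t) = -h^{1/2} sin(2t√h) q + cos(2t√h) p`, on the common domain of all positions and momenta. -/
theorem heisenberg (hpos : ∀ j, 0 < (effHam_isHermitian lam k Λ).eigenvalues j) (t : ℝ)
    {ψ : L2 Λ} {χ : Λ ⊕ Λ → L2 Λ} (h : ∀ b, (ψ, χ b) ∈ (qp b).graph) (a : Λ ⊕ Λ) :
    (expGroup (ham lam k Λ) t ψ,
      expGroup (ham lam k Λ) t (∑ b, flowMatrix lam k Λ t a b • χ b)) ∈ (qp a).graph := by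
  set hA := effHam_isHermitian lam k Λ
  set hB := sqrtMat_coercive hA hpos
  have hU := isUnitaryGroup_ham hpos
  refine mem_graph_qp_of_gauss hB (sqrtMat_isSymm hA) a fun z => ?_
  rw [hU.inner_left, hU.inner_left, expGroup_ham_qpS_gauss hpos, expGroup_ham_gauss hpos,
    inner_smul_left, inner_smul_left, inner_sum, sum_inner]
  congr 1
  refine Finset.sum_congr rfl fun b _ => ?_
  rw [inner_smul_left, inner_smul_right, star_flowMatrix, inner_emb_of_mem_graph_qp (h b)]

end HamiltonianFlow

/-! ### Hilbert-Schmidt operators -/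

section HilbertSchmidt

variable {E : Type*} [NormedAddCommGroup E] [InnerProductSpace ℂ E] [CompleteSpace E]

/-- Hilbert-Schmidt operators; the fixed basis `basis E` can be replaced by any other one, see
`HilbertSchmidt.summable`. -/
def HilbertSchmidt (S : E →L[ℂ] E) : Prop := Summable fun i => ‖S (basis E i)‖ ^ 2

/-- The Hilbert-Schmidt inner product `Tr[S^* T]`. -/
def hsInner (S T : E →L[ℂ] E) : ℂ := ∑' i, ⟪S (basis E i), T (basis E i)⟫_ℂ

theorem tsum_norm_sq_inner {I : Type*} (b : HilbertBasis I ℂ E) (ψ : E) :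
    ∑' i, ENNReal.ofReal (‖⟪b i, ψ⟫_ℂ‖ ^ 2) = ENNReal.ofReal (‖ψ‖ ^ 2) := by
  have h := b.hasSum_inner_mul_inner ψ ψ
  have h' : HasSum (fun i => ‖⟪b i, ψ⟫_ℂ‖ ^ 2) (‖ψ‖ ^ 2) := by
    rw [← Complex.hasSum_ofReal]
    rw [inner_self_eq_norm_sq_to_K] at h
    convert! h using 1
    · ext i
      rw [← inner_conj_symm ψ (b i), Complex.conj_mul']
      push_cast; rfl
    · push_cast; rfl
  rw [← ENNReal.ofReal_tsum_of_nonneg (fun _ => by positivity) h'.summable, h'.tsum_eq]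

theorem tsum_norm_sq_adjoint {I J : Type*} (b : HilbertBasis I ℂ E) (c : HilbertBasis J ℂ E)
    (S : E →L[ℂ] E) : ∑' i, ENNReal.ofReal (‖S (b i)‖ ^ 2) =
      ∑' j, ENNReal.ofReal (‖S.adjoint (c j)‖ ^ 2) := by
  simp_rw [← tsum_norm_sq_inner c (S _), ← tsum_norm_sq_inner b (S.adjoint _)]
  rw [ENNReal.tsum_comm]
  refine tsum_congr fun j => tsum_congr fun i => ?_
  rw [ContinuousLinearMap.adjoint_inner_right, ← inner_conj_symm, RCLike.norm_conj]

theorem summable_iff_tsum_ofReal_ne_top {I : Type*} {f : I → ℝ} (hf : ∀ i, 0 ≤ f i) :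
    Summable f ↔ ∑' i, ENNReal.ofReal (f i) ≠ ⊤ := by
  refine ⟨fun h => h.tsum_ofReal_ne_top, fun h => ?_⟩
  have := ENNReal.summable_toReal h
  simpa only [ENNReal.toReal_ofReal (hf _)] using this

variable {S T : E →L[ℂ] E}

theorem tsum_norm_sq_basis {I : Type*} (b : HilbertBasis I ℂ E) (S : E →L[ℂ] E) :
    ∑' i, ENNReal.ofReal (‖S (b i)‖ ^ 2) = ∑' i, ENNReal.ofReal (‖S (basis E i)‖ ^ 2) :=
  (tsum_norm_sq_adjoint b (basis E) S).trans (tsum_norm_sq_adjoint (basis E) (basis E) S).symm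

theorem hilbertSchmidt_iff {I : Type*} (b : HilbertBasis I ℂ E) :
    HilbertSchmidt S ↔ Summable fun i => ‖S (b i)‖ ^ 2 := by
  rw [HilbertSchmidt, summable_iff_tsum_ofReal_ne_top (fun _ => by positivity),
    summable_iff_tsum_ofReal_ne_top (fun _ => by positivity), tsum_norm_sq_basis b]

theorem HilbertSchmidt.summable (hS : HilbertSchmidt S) {I : Type*} (b : HilbertBasis I ℂ E) :
    Summable fun i => ‖S (b i)‖ ^ 2 := (hilbertSchmidt_iff b).1 hS

theorem HilbertSchmidt.tsum_norm_sq (hS : HilbertSchmidt S) {I : Type*} (b : HilbertBasis I ℂ E) :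
    ∑' i, ‖S (b i)‖ ^ 2 = ∑' i, ‖S (basis E i)‖ ^ 2 := by
  have h := tsum_norm_sq_basis b S
  rw [← ENNReal.ofReal_tsum_of_nonneg (fun _ => by positivity) (hS.summable b),
    ← ENNReal.ofReal_tsum_of_nonneg (fun _ => by positivity) hS] at h
  exact (ENNReal.ofReal_eq_ofReal_iff (tsum_nonneg fun _ => by positivity)
    (tsum_nonneg fun _ => by positivity)).1 h

theorem HilbertSchmidt.add (hS : HilbertSchmidt S) (hT : HilbertSchmidt T) :
    HilbertSchmidt (S + T) := by
  refine Summable.of_nonneg_of_le (fun _ => by positivity) (fun i => ?_)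
    ((Summable.add hS hT).mul_left 2)
  have h := norm_add_le (S (basis E i)) (T (basis E i))
  rw [add_apply]
  nlinarith [norm_nonneg (S (basis E i) + T (basis E i)), norm_nonneg (S (basis E i)),
    norm_nonneg (T (basis E i)), sq_nonneg (‖S (basis E i)‖ - ‖T (basis E i)‖)]

theorem HilbertSchmidt.zero : HilbertSchmidt (0 : E →L[ℂ] E) := by
  simp [HilbertSchmidt, summable_zero]

theorem HilbertSchmidt.mul_left (hS : HilbertSchmidt S) (B : E →L[ℂ] E) :
    HilbertSchmidt (B * S) := by
  refine Summable.of_nonneg_of_le (fun _ => by positivity) (fun i => ?_)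
    (Summable.mul_left (‖B‖ ^ 2) hS)
  rw [mul_apply_eq_comp, ← mul_pow]
  exact pow_le_pow_left₀ (norm_nonneg _) (B.le_opNorm _) 2

theorem HilbertSchmidt.smul (hS : HilbertSchmidt S) (r : ℂ) : HilbertSchmidt (r • S) := by
  simpa using hS.mul_left (r • 1)

theorem HilbertSchmidt.sum {α : Type*} (s : Finset α) {S : α → E →L[ℂ] E}
    (h : ∀ a, HilbertSchmidt (S a)) : HilbertSchmidt (∑ a ∈ s, S a) := by
  classical
  induction s using Finset.induction_on with
  | empty => simpa using HilbertSchmidt.zero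
  | insert a s ha ih => rw [Finset.sum_insert ha]; exact (h a).add ih

theorem summable_norm_inner {I : Type*} {f g : I → E} (hf : Summable fun i => ‖f i‖ ^ 2)
    (hg : Summable fun i => ‖g i‖ ^ 2) : Summable fun i => ‖⟪f i, g i⟫_ℂ‖ := by
  refine Summable.of_nonneg_of_le (fun _ => norm_nonneg _) (fun i => ?_) (hf.add hg)
  have h := norm_inner_le_norm (𝕜 := ℂ) (f i) (g i)
  nlinarith [sq_nonneg (‖f i‖ - ‖g i‖), norm_nonneg (f i), norm_nonneg (g i)]

theorem HilbertSchmidt.hasSum_inner (hS : HilbertSchmidt S) (hT : HilbertSchmidt T) {I : Type*}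
    (c : HilbertBasis I ℂ E) : HasSum (fun i => ⟪S (c i), T (c i)⟫_ℂ)
      (((((∑' i, ‖(S + T) (basis E i)‖ ^ 2 : ℝ) : ℂ) - (∑' i, ‖(S - T) (basis E i)‖ ^ 2 : ℝ)) +
        ((∑' i, ‖(S - Complex.I • T) (basis E i)‖ ^ 2 : ℝ) -
          (∑' i, ‖(S + Complex.I • T) (basis E i)‖ ^ 2 : ℝ)) * Complex.I) / 4) := by
  have hsub : ∀ {S T : E →L[ℂ] E}, HilbertSchmidt S → HilbertSchmidt T →
      HilbertSchmidt (S - T) := fun {S T} h h' => by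
    have := h.add (h'.smul (-1)); rwa [neg_one_smul, ← sub_eq_add_neg] at this
  have e : ∀ {V : E →L[ℂ] E}, HilbertSchmidt V → HasSum (fun i => ((‖V (c i)‖ : ℝ) : ℂ) ^ 2)
      ((∑' i, ‖V (basis E i)‖ ^ 2 : ℝ) : ℂ) := fun {V} hV => by
    rw [← hV.tsum_norm_sq c]
    have := Complex.hasSum_ofReal.2 (hV.summable c).hasSum
    simpa only [Complex.ofReal_pow] using this
  have := (((e (hS.add hT)).sub (e (hsub hS hT))).add
    (((e (hsub hS (hT.smul Complex.I))).sub (e (hS.add (hT.smul Complex.I)))).mul_right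
      Complex.I)).div_const 4
  convert! this using 1
  ext i
  rw [inner_eq_sum_norm_sq_div_four]
  simp only [add_apply, sub_apply, smul_apply]
  rfl

/-- The Hilbert-Schmidt inner product can be computed in any basis (polarization). -/
theorem hasSum_hsInner (hS : HilbertSchmidt S) (hT : HilbertSchmidt T) {I : Type*}
    (b : HilbertBasis I ℂ E) : HasSum (fun i => ⟪S (b i), T (b i)⟫_ℂ) (hsInner S T) := by
  rw [hsInner, (hS.hasSum_inner hT (basis E)).tsum_eq]
  exact hS.hasSum_inner hT b

theorem hsInner_add_right {T' : E →L[ℂ] E} (hS : HilbertSchmidt S) (hT : HilbertSchmidt T)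
    (hT' : HilbertSchmidt T') : hsInner S (T + T') = hsInner S T + hsInner S T' := by
  have h := (hasSum_hsInner hS hT (basis E)).add (hasSum_hsInner hS hT' (basis E))
  rw [hsInner, ← h.tsum_eq]
  simp only [add_apply, inner_add_right]

theorem hsInner_smul_right (S T : E →L[ℂ] E) (r : ℂ) : hsInner S (r • T) = r * hsInner S T := by
  simp only [hsInner, smul_apply, inner_smul_right, tsum_mul_left]

theorem hsInner_conj (S T : E →L[ℂ] E) : starRingEnd ℂ (hsInner S T) = hsInner T S := by
  rw [hsInner, hsInner, Complex.conj_tsum]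
  simp only [inner_conj_symm]

theorem hsInner_sum_right {α : Type*} (s : Finset α) {T : α → E →L[ℂ] E} (hS : HilbertSchmidt S)
    (hT : ∀ a, HilbertSchmidt (T a)) : hsInner S (∑ a ∈ s, T a) = ∑ a ∈ s, hsInner S (T a) := by
  classical
  induction s using Finset.induction_on with
  | empty => simp [hsInner]
  | insert a s ha ih =>
    rw [Finset.sum_insert ha, Finset.sum_insert ha,
      hsInner_add_right hS (hT a) (HilbertSchmidt.sum s hT), ih]

theorem hsInner_sum_sum {α : Type*} [Fintype α] (m n : α → ℂ) {S : α → E →L[ℂ] E}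
    (hS : ∀ a, HilbertSchmidt (S a)) : hsInner (∑ a, m a • S a) (∑ a, n a • S a) =
      ∑ a, ∑ b, starRingEnd ℂ (m a) * n b * hsInner (S a) (S b) := by
  rw [hsInner_sum_right _ (HilbertSchmidt.sum _ fun a => (hS a).smul _) fun a => (hS a).smul _,
    Finset.sum_comm]
  refine Finset.sum_congr rfl fun b _ => ?_
  rw [hsInner_smul_right, ← hsInner_conj, hsInner_sum_right _ (hS b) fun a => (hS a).smul _,
    map_sum, Finset.mul_sum]
  refine Finset.sum_congr rfl fun a _ => ?_
  rw [hsInner_smul_right, map_mul, hsInner_conj]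
  ring

variable {U V : E →L[ℂ] E}

/-- A unitary operator maps an orthonormal basis to an orthonormal basis. -/
theorem exists_hilbertBasis_unitary (h : U ∈ unitary (E →L[ℂ] E)) {I : Type*}
    (b : HilbertBasis I ℂ E) : ∃ c : HilbertBasis I ℂ E, ∀ i, c i = U (b i) := by
  let V := Unitary.linearIsometryEquiv (⟨U, h⟩ : unitary (E →L[ℂ] E))
  refine ⟨HilbertBasis.ofRepr (V.symm.trans b.repr), fun i => ?_⟩
  rfl

theorem star_mem_unitary (h : U ∈ unitary (E →L[ℂ] E)) : star U ∈ unitary (E →L[ℂ] E) :=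
  Unitary.star_mem h

theorem HilbertSchmidt.mul_unitary (hS : HilbertSchmidt S) (h : U ∈ unitary (E →L[ℂ] E)) :
    HilbertSchmidt (S * U) := by
  obtain ⟨c, hc⟩ := exists_hilbertBasis_unitary h (basis E)
  have := hS.summable c
  simp only [hc] at this
  exact this

theorem inner_map_of_unitary (h : U ∈ unitary (E →L[ℂ] E)) (ψ χ : E) :
    ⟪U ψ, U χ⟫_ℂ = ⟪ψ, χ⟫_ℂ := by
  rw [← ContinuousLinearMap.adjoint_inner_right, ← ContinuousLinearMap.star_eq_adjoint,
    ← mul_apply_eq_comp, Unitary.star_mul_self_of_mem h, one_apply_eq_self]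

/-- Unitary invariance of the Hilbert-Schmidt inner product. -/
theorem hsInner_unitary (hS : HilbertSchmidt S) (hT : HilbertSchmidt T)
    (h : U ∈ unitary (E →L[ℂ] E)) (h' : V ∈ unitary (E →L[ℂ] E)) :
    hsInner (U * S * V) (U * T * V) = hsInner S T := by
  obtain ⟨c, hc⟩ := exists_hilbertBasis_unitary h' (basis E)
  rw [← (hasSum_hsInner hS hT c).tsum_eq, hsInner]
  refine tsum_congr fun i => ?_
  rw [hc, mul_apply_eq_comp, mul_apply_eq_comp, mul_apply_eq_comp, mul_apply_eq_comp,
    inner_map_of_unitary h]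

end HilbertSchmidt

/-! ### Second moments -/

section Moments

variable {E : Type*} [NormedAddCommGroup E] [InnerProductSpace ℂ E] [CompleteSpace E]

/-- The square root of a density operator. -/
def rootOp (ρ : E →L[ℂ] E) : E →L[ℂ] E := CFC.sqrt ρ

/-- `S = A √ρ` as an everywhere defined Hilbert-Schmidt operator. -/
structure IsMoment (A : E →ₗ.[ℂ] E) (ρ S : E →L[ℂ] E) : Prop where
  graph : ∀ ψ, (rootOp ρ ψ, S ψ) ∈ A.graph
  hilbertSchmidt : HilbertSchmidt S

/-- By the closed graph theorem, `A √ρ` is bounded if it is everywhere defined. -/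
theorem HasSecondMoment.exists_isMoment {A : E →ₗ.[ℂ] E} {ρ : E →L[ℂ] E}
    (h : HasSecondMoment A ρ) (hA : IsClosed (A.graph : Set (E × E))) :
    ∃ S, IsMoment A ρ S := by
  let f : E →ₗ[ℂ] E :=
    A.toFun ∘ₗ ((rootOp ρ : E →L[ℂ] E) : E →ₗ[ℂ] E).codRestrict A.domain h.1
  have hg : ∀ ψ, (rootOp ρ ψ, f ψ) ∈ A.graph := fun ψ => A.mem_graph ⟨_, h.1 ψ⟩
  have hc : Continuous f := by
    refine LinearMap.continuous_of_isClosed_graph f ?_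
    have : (f.graph : Set (E × E)) =
        (fun z : E × E => (rootOp ρ z.1, z.2)) ⁻¹' (A.graph : Set (E × E)) := by
      ext ⟨ψ, χ⟩
      simp only [SetLike.mem_coe, LinearMap.mem_graph_iff, Set.mem_preimage]
      refine ⟨fun e => ?_, fun e => ?_⟩
      · rw [e]; exact hg ψ
      · exact LinearPMap.mem_graph_snd_inj A e (hg ψ) rfl
    rw [this]
    exact hA.preimage (by fun_prop)
  refine ⟨⟨f, hc⟩, hg, ?_⟩
  have := h.2
  have happ : ∀ ψ, app A (CFC.sqrt ρ ψ) = f ψ := fun ψ => (mem_graph_iff_app.1 (hg ψ)).2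
  simp only [happ] at this
  exact this

theorem IsMoment.app_eq {A : E →ₗ.[ℂ] E} {ρ S : E →L[ℂ] E} (h : IsMoment A ρ S) (ψ : E) :
    app A (CFC.sqrt ρ ψ) = S ψ := (mem_graph_iff_app.1 (h.graph ψ)).2

theorem IsMoment.hasSecondMoment {A : E →ₗ.[ℂ] E} {ρ S : E →L[ℂ] E} (h : IsMoment A ρ S) :
    HasSecondMoment A ρ := by
  refine ⟨fun ψ => (mem_graph_iff_app.1 (h.graph ψ)).1, ?_⟩
  simp only [h.app_eq]
  exact h.hilbertSchmidt

theorem IsMoment.expect_eq {A : E →ₗ.[ℂ] E} {ρ S : E →L[ℂ] E} (h : IsMoment A ρ S) :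
    expect ρ A = hsInner (rootOp ρ) S := by
  simp only [expect, hsInner, h.app_eq]
  rfl

theorem IsMoment.expectMul_eq {A A' : E →ₗ.[ℂ] E} {ρ S S' : E →L[ℂ] E} (h : IsMoment A ρ S)
    (h' : IsMoment A' ρ S') : expectMul ρ A A' = hsInner S S' := by
  simp only [expectMul, hsInner, h.app_eq, h'.app_eq]

theorem rootOp_mul_rootOp {ρ : E →L[ℂ] E} (h : ρ.IsPositive) : rootOp ρ * rootOp ρ = ρ :=
  CFC.sqrt_mul_sqrt_self ρ ((ContinuousLinearMap.nonneg_iff_isPositive _).2 h)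

theorem rootOp_unique {ρ R : E →L[ℂ] E} (h : R * R = ρ) (hR : R.IsPositive) : rootOp ρ = R :=
  CFC.sqrt_unique h ((ContinuousLinearMap.nonneg_iff_isPositive _).2 hR)

theorem rootOp_isPositive (ρ : E →L[ℂ] E) : (rootOp ρ).IsPositive :=
  (ContinuousLinearMap.nonneg_iff_isPositive _).1 (CFC.sqrt_nonneg ρ)

theorem inner_rootOp {ρ : E →L[ℂ] E} (h : ρ.IsPositive) (ψ χ : E) :
    ⟪rootOp ρ ψ, rootOp ρ χ⟫_ℂ = ⟪ψ, ρ χ⟫_ℂ := by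
  have e := rootOp_mul_rootOp h
  conv_rhs => rw [← e, mul_apply_eq_comp]
  exact (rootOp_isPositive ρ).isSymmetric ψ _

theorem IsState.hilbertSchmidt_rootOp {ρ : E →L[ℂ] E} (h : IsState ρ) :
    HilbertSchmidt (rootOp ρ) := by
  have := h.2.summable.norm
  simp only [← inner_rootOp h.1, inner_self_eq_norm_sq_to_K] at this
  simpa [HilbertSchmidt] using this

theorem IsState.hsInner_rootOp {ρ : E →L[ℂ] E} (h : IsState ρ) :
    hsInner (rootOp ρ) (rootOp ρ) = 1 := by
  simp only [hsInner, inner_rootOp h.1, h.2.tsum_eq]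

theorem rootOp_unitary_conj {ρ U : E →L[ℂ] E} (h : ρ.IsPositive) (hU : U ∈ unitary (E →L[ℂ] E)) :
    rootOp (U * ρ * star U) = U * rootOp ρ * star U := by
  refine rootOp_unique ?_ ?_
  · have e := rootOp_mul_rootOp h
    conv_rhs => rw [← e]
    have := Unitary.star_mul_self_of_mem hU
    calc _ = U * rootOp ρ * (star U * U) * rootOp ρ * star U := by simp only [mul_assoc]
      _ = _ := by rw [this, mul_one]; simp only [mul_assoc]
  · have := (rootOp_isPositive ρ).conj_adjoint U
    exact this

end Moments

/-! ### Evolution of the correlation matrix -/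

section Evolution

variable {d : ℕ} {lam : ℝ} {k : (Fin d → ℤ) → ℝ} {Λ : Finset (Fin d → ℤ)}

theorem IsMoment.evolve (hpos : ∀ j, 0 < (effHam_isHermitian lam k Λ).eigenvalues j)
    {ρ : L2 Λ →L[ℂ] L2 Λ} (hρ : ρ.IsPositive) {S : Λ ⊕ Λ → L2 Λ →L[ℂ] L2 Λ}
    (hS : ∀ a, IsMoment (qp a) ρ (S a)) (t : ℝ) (a : Λ ⊕ Λ) :
    IsMoment (qp a) (evolve lam k Λ ρ t) (expGroup (ham lam k Λ) t *
      (∑ b, flowMatrix lam k Λ t a b • S b) * star (expGroup (ham lam k Λ) t)) := by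
  have hU := isUnitaryGroup_ham hpos
  have hs : expGroup (ham lam k Λ) (-t) = star (expGroup (ham lam k Λ) t) :=
    (hU.adjoint_eq t).symm
  refine ⟨fun ψ => ?_, ?_⟩
  · rw [QuenchedOscillators.evolve, hs, rootOp_unitary_conj hρ (hU.unitary t)]
    have := heisenberg hpos t (ψ := rootOp ρ (star (expGroup (ham lam k Λ) t) ψ))
      (χ := fun b => S b (star (expGroup (ham lam k Λ) t) ψ)) (fun b => (hS b).graph _) a
    simpa only [mul_apply_eq_comp, sum_apply, smul_apply] using this
  · exact ((HilbertSchmidt.sum _ fun b => ((hS b).hilbertSchmidt.smul _)).mul_left _).mul_unitary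
      (star_mem_unitary (hU.unitary t))

theorem hasSecondMoments_evolve (hpos : ∀ j, 0 < (effHam_isHermitian lam k Λ).eigenvalues j)
    {ρ : L2 Λ →L[ℂ] L2 Λ} (hρ : ρ.IsPositive) {S : Λ ⊕ Λ → L2 Λ →L[ℂ] L2 Λ}
    (hS : ∀ a, IsMoment (qp a) ρ (S a)) (t : ℝ) : HasSecondMoments (evolve lam k Λ ρ t) :=
  fun a => (IsMoment.evolve hpos hρ hS t a).hasSecondMoment

theorem corrMatrix_eq {ι : Type*} [Fintype ι] [DecidableEq ι] {ρ : L2 ι →L[ℂ] L2 ι}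
    {S : ι ⊕ ι → L2 ι →L[ℂ] L2 ι} (hS : ∀ a, IsMoment (qp a) ρ (S a)) (a b : ι ⊕ ι) :
    corrMatrix ρ a b =
      hsInner (S a) (S b) - hsInner (rootOp ρ) (S a) * hsInner (rootOp ρ) (S b) := by
  rw [corrMatrix, (hS a).expectMul_eq (hS b), (hS a).expect_eq, (hS b).expect_eq]

/-- The quadratic evolution acts on correlation matrices by `Γ ↦ M(t) Γ M(t)ᵀ`. -/
theorem corrMatrix_evolve (hpos : ∀ j, 0 < (effHam_isHermitian lam k Λ).eigenvalues j)
    {ρ : L2 Λ →L[ℂ] L2 Λ} (hρ : ρ.IsPositive) (hR : HilbertSchmidt (rootOp ρ))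
    {S : Λ ⊕ Λ → L2 Λ →L[ℂ] L2 Λ} (hS : ∀ a, IsMoment (qp a) ρ (S a)) (t : ℝ) :
    corrMatrix (evolve lam k Λ ρ t) =
      flowMatrix lam k Λ t * corrMatrix ρ * (flowMatrix lam k Λ t).transpose := by
  have hU := isUnitaryGroup_ham hpos
  have hs : expGroup (ham lam k Λ) (-t) = star (expGroup (ham lam k Λ) t) :=
    (hU.adjoint_eq t).symm
  have hS' : ∀ a, HilbertSchmidt (∑ b, flowMatrix lam k Λ t a b • S b) := fun a =>
    HilbertSchmidt.sum _ fun b => ((hS b).hilbertSchmidt.smul _)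
  ext a b
  rw [corrMatrix_eq (IsMoment.evolve hpos hρ hS t), QuenchedOscillators.evolve, hs,
    rootOp_unitary_conj hρ (hU.unitary t)]
  have hst := star_mem_unitary (hU.unitary t)
  rw [hsInner_unitary (hS' a) (hS' b) (hU.unitary t) hst,
    hsInner_unitary hR (hS' a) (hU.unitary t) hst, hsInner_unitary hR (hS' b) (hU.unitary t) hst,
    hsInner_sum_sum _ _ fun c => (hS c).hilbertSchmidt,
    hsInner_sum_right _ hR fun c => (hS c).hilbertSchmidt.smul _,
    hsInner_sum_right _ hR fun c => (hS c).hilbertSchmidt.smul _]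
  simp only [hsInner_smul_right]
  simp only [Matrix.mul_apply, Matrix.transpose_apply, corrMatrix_eq hS, Finset.sum_mul]
  rw [Finset.sum_comm]
  simp_rw [Finset.mul_sum]
  rw [Finset.sum_comm (γ := Λ ⊕ Λ) (s := Finset.univ) (t := Finset.univ)
    (f := fun i j => flowMatrix lam k Λ t a i * hsInner (rootOp ρ) (S i) *
      (flowMatrix lam k Λ t b j * hsInner (rootOp ρ) (S j))), ← Finset.sum_sub_distrib]
  refine Finset.sum_congr rfl fun j _ => ?_
  rw [← Finset.sum_sub_distrib]
  refine Finset.sum_congr rfl fun i _ => ?_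
  have hstar : starRingEnd ℂ (flowMatrix lam k Λ t a i) = flowMatrix lam k Λ t a i :=
    star_flowMatrix t a i
  rw [hstar]
  ring

end Evolution

/-! ### Hilbert space tensor products -/

section TensorMap

variable {κ : Type*} [Fintype κ] [DecidableEq κ] {E : κ → Type*} [∀ l, NormedAddCommGroup (E l)]
  [∀ l, InnerProductSpace ℂ (E l)] [∀ l, CompleteSpace (E l)]
  {H : Type*} [NormedAddCommGroup H] [InnerProductSpace ℂ H] [CompleteSpace H]

/-- `τ` exhibits the Hilbert space `H` as the tensor product of the Hilbert spaces `E l`. -/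
structure IsTensorMap (τ : (∀ l, E l) → H) : Prop where
  inner : ∀ ψ φ, ⟪τ ψ, τ φ⟫_ℂ = ∏ l, ⟪ψ l, φ l⟫_ℂ
  total : Total τ

namespace IsTensorMap

variable {τ : (∀ l, E l) → H} (hτ : IsTensorMap τ)

include hτ

theorem norm_sq (ψ : ∀ l, E l) : ‖τ ψ‖ ^ 2 = ∏ l, ‖ψ l‖ ^ 2 := by
  have h := hτ.inner ψ ψ
  simp only [inner_self_eq_norm_sq_to_K] at h
  exact_mod_cast h

theorem norm_eq (ψ : ∀ l, E l) : ‖τ ψ‖ = ∏ l, ‖ψ l‖ := by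
  have h := hτ.norm_sq ψ
  rw [Finset.prod_pow] at h
  exact (pow_left_inj₀ (norm_nonneg _) (Finset.prod_nonneg fun _ _ => norm_nonneg _)
    two_ne_zero).1 h

theorem inner_update (φ ψ : ∀ l, E l) (l : κ) (χ : E l) :
    ⟪τ φ, τ (Function.update ψ l χ)⟫_ℂ =
      ⟪φ l, χ⟫_ℂ * ∏ l' ∈ Finset.univ.erase l, ⟪φ l', ψ l'⟫_ℂ := by
  rw [hτ.inner, ← Finset.mul_prod_erase _ _ (Finset.mem_univ l), Function.update_self]
  congr 1
  refine Finset.prod_congr rfl fun l' hl => ?_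
  rw [Function.update_of_ne (Finset.ne_of_mem_erase hl)]

theorem norm_update (ψ : ∀ l, E l) (l : κ) (χ : E l) :
    ‖τ (Function.update ψ l χ)‖ = (∏ l' ∈ Finset.univ.erase l, ‖ψ l'‖) * ‖χ‖ := by
  rw [hτ.norm_eq, ← Finset.mul_prod_erase _ _ (Finset.mem_univ l), Function.update_self, mul_comm]
  congr 1
  refine Finset.prod_congr rfl fun l' hl => ?_
  rw [Function.update_of_ne (Finset.ne_of_mem_erase hl)]

theorem update_add (ψ : ∀ l, E l) (l : κ) (χ χ' : E l) :
    τ (Function.update ψ l (χ + χ')) =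
      τ (Function.update ψ l χ) + τ (Function.update ψ l χ') := by
  refine hτ.total.ext_inner fun φ => ?_
  rw [inner_add_right, hτ.inner_update, hτ.inner_update, hτ.inner_update, inner_add_right, add_mul]

theorem update_smul (ψ : ∀ l, E l) (l : κ) (c : ℂ) (χ : E l) :
    τ (Function.update ψ l (c • χ)) = c • τ (Function.update ψ l χ) := by
  refine hτ.total.ext_inner fun φ => ?_
  rw [inner_smul_right, hτ.inner_update, hτ.inner_update, inner_smul_right, mul_assoc]

/-- The tensor product as a function of one factor. -/
theorem exists_slot (ψ : ∀ l, E l) (l : κ) :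
    ∃ L : E l →L[ℂ] H, ∀ χ, L χ = τ (Function.update ψ l χ) :=
  ⟨LinearMap.mkContinuous
    { toFun := fun χ => τ (Function.update ψ l χ)
      map_add' := hτ.update_add ψ l
      map_smul' := hτ.update_smul ψ l } _ fun χ => (hτ.norm_update ψ l χ).le, fun _ => rfl⟩

/-- A bounded operator on one tensor factor extends to the tensor product. With
`R = √(‖T‖² - T^* T)`, the vectors `∑ f (T ⊗ 1) τ` and `∑ f (R ⊗ 1) τ` have squared norms that add
up to `‖T‖² ‖∑ f τ‖²`. -/
theorem exists_single (l : κ) (T : E l →L[ℂ] E l) :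
    ∃ S : H →L[ℂ] H, ∀ ψ, S (τ ψ) = τ (Function.update ψ l (T (ψ l))) := by
  refine hτ.total.exists_clm _ ‖T‖ fun f => ?_
  obtain ⟨R, hR⟩ : ∃ R : E l →L[ℂ] E l, ∀ χ χ',
      ⟪T χ, T χ'⟫_ℂ + ⟪R χ, R χ'⟫_ℂ = (‖T‖ ^ 2 : ℝ) * ⟪χ, χ'⟫_ℂ := by
    have hpos : (((‖T‖ ^ 2 : ℝ) : ℂ) • (1 : E l →L[ℂ] E l) - T.adjoint * T).IsPositive := by
      rw [ContinuousLinearMap.isPositive_iff_complex]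
      intro χ
      have e : ⟪(((‖T‖ ^ 2 : ℝ) : ℂ) • (1 : E l →L[ℂ] E l) - T.adjoint * T) χ, χ⟫_ℂ =
          ((‖T‖ ^ 2 * ‖χ‖ ^ 2 - ‖T χ‖ ^ 2 : ℝ) : ℂ) := by
        rw [sub_apply, smul_apply, one_apply_eq_self, mul_apply_eq_comp, inner_sub_left,
          inner_smul_left, ContinuousLinearMap.adjoint_inner_left, inner_self_eq_norm_sq_to_K,
          inner_self_eq_norm_sq_to_K, Complex.conj_ofReal]
        push_cast; rfl
      rw [e]
      refine ⟨by simp only [RCLike.re_to_complex, Complex.ofReal_re], ?_⟩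
      have := pow_le_pow_left₀ (norm_nonneg _) (T.le_opNorm χ) 2
      rw [mul_pow] at this
      simp only [Complex.ofReal_re, RCLike.re_to_complex]
      linarith
    refine ⟨rootOp (((‖T‖ ^ 2 : ℝ) : ℂ) • (1 : E l →L[ℂ] E l) - T.adjoint * T),
      fun χ χ' => ?_⟩
    rw [inner_rootOp hpos, sub_apply, inner_sub_right, smul_apply, one_apply_eq_self,
      inner_smul_right, mul_apply_eq_comp, ContinuousLinearMap.adjoint_inner_right]
    ring
  have key : ‖Finsupp.linearCombination ℂ (fun ψ => τ (Function.update ψ l (T (ψ l)))) f‖ ^ 2 +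
      ‖Finsupp.linearCombination ℂ (fun ψ => τ (Function.update ψ l (R (ψ l)))) f‖ ^ 2 =
      ‖T‖ ^ 2 * ‖Finsupp.linearCombination ℂ τ f‖ ^ 2 := by
    have : ((‖Finsupp.linearCombination ℂ (fun ψ => τ (Function.update ψ l (T (ψ l)))) f‖ ^ 2 +
      ‖Finsupp.linearCombination ℂ (fun ψ => τ (Function.update ψ l (R (ψ l)))) f‖ ^ 2 : ℝ) : ℂ) =
      ((‖T‖ ^ 2 * ‖Finsupp.linearCombination ℂ τ f‖ ^ 2 : ℝ) : ℂ) := by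
      rw [Complex.ofReal_add, Complex.ofReal_mul]
      rw [norm_sq_linearCombination, norm_sq_linearCombination, norm_sq_linearCombination,
        ← Finset.sum_add_distrib, Finset.mul_sum]
      refine Finset.sum_congr rfl fun ψ _ => ?_
      rw [← Finset.sum_add_distrib, Finset.mul_sum]
      refine Finset.sum_congr rfl fun φ _ => ?_
      have h1 : ∀ V : E l →L[ℂ] E l,
          ⟪τ (Function.update ψ l (V (ψ l))), τ (Function.update φ l (V (φ l)))⟫_ℂ =
            ⟪V (ψ l), V (φ l)⟫_ℂ * ∏ l' ∈ Finset.univ.erase l, ⟪ψ l', φ l'⟫_ℂ := fun V => by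
        rw [hτ.inner_update, Function.update_self]
        congr 1
        refine Finset.prod_congr rfl fun l' hl => ?_
        rw [Function.update_of_ne (Finset.ne_of_mem_erase hl)]
      rw [h1, h1, hτ.inner, ← Finset.mul_prod_erase _ _ (Finset.mem_univ l)]
      linear_combination (starRingEnd ℂ (f ψ) * f φ *
        ∏ l' ∈ Finset.univ.erase l, ⟪ψ l', φ l'⟫_ℂ) * hR (ψ l) (φ l)
    exact_mod_cast this
  refine le_of_sq_le_sq ?_ (by positivity)
  rw [mul_pow, ← key]
  exact le_add_of_nonneg_right (by positivity)

/-- Bounded operators on all factors are extended to the tensor product one factor at a time. -/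
theorem exists_map (T : ∀ l, E l →L[ℂ] E l) :
    ∃ S : H →L[ℂ] H, ∀ ψ, S (τ ψ) = τ (fun l => T l (ψ l)) := by
  have h : ∀ s : Finset κ, ∃ S : H →L[ℂ] H, ∀ ψ,
      S (τ ψ) = τ (fun l => if l ∈ s then T l (ψ l) else ψ l) := by
    intro s
    induction s using Finset.induction_on with
    | empty => exact ⟨1, fun ψ => by simp⟩
    | insert a s ha ih =>
      obtain ⟨S, hS⟩ := ih
      obtain ⟨S', hS'⟩ := hτ.exists_single a (T a)
      refine ⟨S' * S, fun ψ => ?_⟩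
      rw [mul_apply_eq_comp, hS, hS']
      congr 1
      ext l
      rcases eq_or_ne l a with rfl | hl
      · simp [ha]
      · simp [hl]
  simpa using h Finset.univ

omit hτ in
/-- The tensor product of operators. -/
def map (hτ : IsTensorMap τ) (T : ∀ l, E l →L[ℂ] E l) : H →L[ℂ] H := (hτ.exists_map T).choose

theorem map_apply (T : ∀ l, E l →L[ℂ] E l) (ψ : ∀ l, E l) :
    hτ.map T (τ ψ) = τ (fun l => T l (ψ l)) := (hτ.exists_map T).choose_spec ψ

theorem map_mul (S T : ∀ l, E l →L[ℂ] E l) : hτ.map S * hτ.map T = hτ.map (S * T) := by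
  refine hτ.total.clm_ext fun ψ => ?_
  rw [mul_apply_eq_comp, hτ.map_apply, hτ.map_apply, hτ.map_apply]
  rfl

theorem adjoint_map (T : ∀ l, E l →L[ℂ] E l) :
    (hτ.map T).adjoint = hτ.map (fun l => (T l).adjoint) := by
  refine hτ.total.clm_ext fun ψ => hτ.total.ext_inner fun φ => ?_
  rw [ContinuousLinearMap.adjoint_inner_right, hτ.map_apply, hτ.map_apply, hτ.inner, hτ.inner]
  simp only [ContinuousLinearMap.adjoint_inner_right]

/-- `⨂ R_l = (⨂ √R_l)^* (⨂ √R_l)` is positive. -/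
theorem map_isPositive {R : ∀ l, E l →L[ℂ] E l} (hR : ∀ l, (R l).IsPositive) :
    (hτ.map R).IsPositive := by
  have h : hτ.map R = (hτ.map fun l => rootOp (R l)).adjoint * hτ.map fun l => rootOp (R l) := by
    rw [hτ.adjoint_map, hτ.map_mul]
    congr 1
    ext1 l
    rw [Pi.mul_apply, (rootOp_isPositive (R l)).isSelfAdjoint.adjoint_eq, rootOp_mul_rootOp (hR l)]
  rw [h]
  exact ContinuousLinearMap.isPositive_adjoint_comp_self _

theorem rootOp_map {ρ : ∀ l, E l →L[ℂ] E l} (hρ : ∀ l, (ρ l).IsPositive) :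
    rootOp (hτ.map ρ) = hτ.map fun l => rootOp (ρ l) := by
  refine rootOp_unique ?_ (hτ.map_isPositive fun l => rootOp_isPositive _)
  rw [hτ.map_mul]
  congr 1
  ext1 l
  exact rootOp_mul_rootOp (hρ l)

end IsTensorMap

end TensorMap

/-! ### Product bases -/

/-- An absolutely convergent sum of products over a product of index sets is the product of the sums. -/
theorem summable_hasSum_pi_prod {n : ℕ} {I : Fin n → Type*} (f : ∀ l, I l → ℂ)
    (hf : ∀ l, Summable fun i => ‖f l i‖) :
    (Summable fun i : ∀ l, I l => ‖∏ l, f l (i l)‖) ∧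
      HasSum (fun i : ∀ l, I l => ∏ l, f l (i l)) (∏ l, ∑' i, f l i) := by
  induction n with
  | zero =>
    refine ⟨Summable.of_finite, ?_⟩
    simp
  | succ n ih =>
    obtain ⟨h1, h2⟩ := ih (fun l => f l.succ) fun l => hf l.succ
    have e : ∀ p : I 0 × (∀ l : Fin n, I l.succ),
        ∏ l, f l (Fin.consEquiv I p l) = f 0 p.1 * ∏ l : Fin n, f l.succ (p.2 l) := fun p => by
      rw [Fin.prod_univ_succ]
      rfl
    constructor
    · rw [← (Fin.consEquiv I).summable_iff]
      have := (hf 0).mul_of_nonneg h1 (fun _ => norm_nonneg _) (fun _ => norm_nonneg _)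
      refine this.congr fun p => ?_
      rw [Function.comp_apply, e, norm_mul]
    · rw [← (Fin.consEquiv I).hasSum_iff, Fin.prod_univ_succ]
      have hs := summable_mul_of_summable_norm (hf 0) h1
      have := (Summable.of_norm (hf 0)).hasSum.mul h2 hs
      refine this.congr_fun ?_ 
      intro p
      rw [Function.comp_apply, e]

section ProductBasis

variable {n : ℕ} {E : Fin n → Type*} [∀ l, NormedAddCommGroup (E l)]
  [∀ l, InnerProductSpace ℂ (E l)] [∀ l, CompleteSpace (E l)]
  {H : Type*} [NormedAddCommGroup H] [InnerProductSpace ℂ H] [CompleteSpace H]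
  {τ : (∀ l, E l) → H} (hτ : IsTensorMap τ)

namespace IsTensorMap

include hτ

/-- The tensor products of basis vectors form an orthonormal basis. A vector orthogonal to them is
orthogonal to all `τ ψ`, by replacing basis vectors by arbitrary ones in one factor at a time. -/
theorem exists_productBasis {I : Fin n → Type*} (b : ∀ l, HilbertBasis (I l) ℂ (E l)) :
    ∃ c : HilbertBasis (∀ l, I l) ℂ H, ∀ i, c i = τ fun l => b l (i l) := by
  classical
  have ho : Orthonormal ℂ fun i : ∀ l, I l => τ fun l => b l (i l) := by
    rw [orthonormal_iff_ite]
    intro i j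
    rw [hτ.inner]
    have hb := fun l => orthonormal_iff_ite.1 (b l).orthonormal
    simp only [hb]
    rw [Finset.prod_ite_zero]
    simp [funext_iff]
  suffices hsp : (Submodule.span ℂ (Set.range fun i : ∀ l, I l => τ fun l => b l (i l)))ᗮ = ⊥ from
    ⟨HilbertBasis.mkOfOrthogonalEqBot ho hsp, fun i => by
      rw [HilbertBasis.coe_mkOfOrthogonalEqBot]⟩
  rw [Submodule.eq_bot_iff]
  intro v hv
  have hv' : ∀ i : ∀ l, I l, ⟪v, τ fun l => b l (i l)⟫_ℂ = 0 := fun i =>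
    Submodule.inner_left_of_mem_orthogonal (Submodule.subset_span (Set.mem_range_self i)) hv
  have key : ∀ s : Finset (Fin n), ∀ ψ : ∀ l, E l, (∀ l ∉ s, ∃ i, ψ l = b l i) →
      ⟪v, τ ψ⟫_ℂ = 0 := by
    intro s
    induction s using Finset.induction_on with
    | empty =>
      intro ψ h
      choose i hi using fun l => h l (Finset.notMem_empty l)
      rw [show ψ = fun l => b l (i l) from funext hi]
      exact hv' i
    | insert a s ha ih =>
      intro ψ h
      obtain ⟨L, hL⟩ := hτ.exists_slot ψ a
      have hb : Total (b a) := by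
        have := (b a).dense_span
        exact (Submodule.dense_iff_topologicalClosure_eq_top).2 this
      have h0 : (innerSL ℂ v).comp L = 0 := by
        refine hb.clm_ext fun i => ?_
        simp only [ContinuousLinearMap.comp_apply, innerSL_apply_apply, zero_apply, hL]
        refine ih _ fun l hl => ?_
        rcases eq_or_ne l a with rfl | hla
        · exact ⟨i, Function.update_self ..⟩
        · rw [Function.update_of_ne hla]
          exact h l (by simp [hla, hl])
      have := DFunLike.congr_fun h0 (ψ a)
      simpa [hL] using this
  exact hτ.total.eq_zero fun ψ => by
    rw [← inner_conj_symm, key Finset.univ ψ (by simp), map_zero]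

theorem hilbertSchmidt_map {S : ∀ l, E l →L[ℂ] E l} (hS : ∀ l, HilbertSchmidt (S l)) :
    HilbertSchmidt (hτ.map S) := by
  obtain ⟨c, hc⟩ := hτ.exists_productBasis fun l => basis (E l)
  rw [hilbertSchmidt_iff c]
  have h := (summable_hasSum_pi_prod (fun l i => ((‖S l (basis (E l) i)‖ ^ 2 : ℝ) : ℂ)) fun l => by
    simpa [HilbertSchmidt] using hS l).1
  refine h.congr fun i => ?_
  rw [hc, hτ.map_apply, hτ.norm_sq, ← Complex.ofReal_prod, Complex.norm_real, Real.norm_of_nonneg]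
  exact Finset.prod_nonneg fun _ _ => by positivity

theorem hsInner_map {S T : ∀ l, E l →L[ℂ] E l} (hS : ∀ l, HilbertSchmidt (S l))
    (hT : ∀ l, HilbertSchmidt (T l)) :
    hsInner (hτ.map S) (hτ.map T) = ∏ l, hsInner (S l) (T l) := by
  obtain ⟨c, hc⟩ := hτ.exists_productBasis fun l => basis (E l)
  have h := (summable_hasSum_pi_prod
    (fun l i => ⟪S l (basis (E l) i), T l (basis (E l) i)⟫_ℂ) fun l =>
      summable_norm_inner (hS l) (hT l)).2
  refine (hasSum_hsInner (hτ.hilbertSchmidt_map hS) (hτ.hilbertSchmidt_map hT) c).unique ?_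
  simp only [hc, hτ.map_apply, hτ.inner]
  exact h

end IsTensorMap

end ProductBasis

/-! ### The tensor product decomposition of `L²(ℝ^Λ)` -/

namespace BoxDecomposition

variable {d : ℕ} {Λ : Finset (Fin d → ℤ)} {M : ℕ} (D : BoxDecomposition Λ M)

/-- The inclusion of a sub-box. -/
def incl (l : Fin M) (y : D.part l) : Λ := ⟨y.1, D.part_subset l y.2⟩

/-- The restriction of a configuration to a sub-box. -/
abbrev res (l : Fin M) (u : Λ → ℝ) : D.part l → ℝ :=
  Finset.restrict₂ (π := fun _ => ℝ) (D.part_subset l) u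

theorem exists_mem_part (x : Λ) : ∃ l, x.1 ∈ D.part l := by
  have h : ∀ y ∈ Λ, ∃ l, y ∈ D.part l := by
    intro y hy
    rw [← D.union] at hy
    simpa using hy
  exact h x.1 x.2

/-- The sub-box containing a given site. -/
def idx (x : Λ) : Fin M := (D.exists_mem_part x).choose

theorem mem_idx (x : Λ) : x.1 ∈ D.part (D.idx x) := (D.exists_mem_part x).choose_spec

theorem idx_incl (l : Fin M) (y : D.part l) : D.idx (D.incl l y) = l := by
  by_contra h
  exact Finset.disjoint_left.1 (D.disjoint h) (D.mem_idx (D.incl l y)) y.2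

/-- The sites of the sub-boxes are the sites of the box. -/
def sigmaEquiv : (Σ l, D.part l) ≃ Λ where
  toFun p := D.incl p.1 p.2
  invFun x := ⟨D.idx x, ⟨x.1, D.mem_idx x⟩⟩
  left_inv p := by
    obtain ⟨l, y⟩ := p
    have : ∀ l' (h' : y.1 ∈ D.part l'), l' = l →
        (⟨l', ⟨y.1, h'⟩⟩ : Σ l, D.part l) = ⟨l, y⟩ := by
      rintro l' h' rfl; rfl
    exact this _ _ (D.idx_incl l y)
  right_inv x := rfl

/-- `ℝ^Λ = ∏_l ℝ^{Λ_l}`. -/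
def split : (Λ → ℝ) ≃ᵐ (∀ l, D.part l → ℝ) where
  toFun u l := D.res l u
  invFun w x := w (D.sigmaEquiv.symm x).1 (D.sigmaEquiv.symm x).2
  left_inv u := by
    ext x
    exact congrArg u (D.sigmaEquiv.apply_symm_apply x)
  right_inv w := by
    ext l y
    have := D.sigmaEquiv.symm_apply_apply ⟨l, y⟩
    change w (D.sigmaEquiv.symm (D.sigmaEquiv ⟨l, y⟩)).1 (D.sigmaEquiv.symm _).2 = _
    rw [this]
  measurable_toFun := by
    refine measurable_pi_iff.2 fun l => measurable_pi_iff.2 fun y => ?_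
    exact measurable_pi_apply (D.incl l y)
  measurable_invFun := by
    refine measurable_pi_iff.2 fun x => ?_
    exact (measurable_pi_apply (D.sigmaEquiv.symm x).2).comp
      (measurable_pi_apply (D.sigmaEquiv.symm x).1)

theorem split_symm_incl (w : ∀ l, D.part l → ℝ) (l : Fin M) (y : D.part l) :
    D.split.symm w (D.incl l y) = w l y :=
  congrFun (congrFun (D.split.apply_symm_apply w) l) y

theorem prod_sites {R : Type*} [CommMonoid R] (f : Λ → R) :
    ∏ x, f x = ∏ l, ∏ y, f (D.incl l y) := by
  rw [← D.sigmaEquiv.prod_comp, Fintype.prod_sigma]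
  rfl

theorem sum_sites {R : Type*} [AddCommMonoid R] (f : Λ → R) :
    ∑ x, f x = ∑ l, ∑ y, f (D.incl l y) := by
  rw [← D.sigmaEquiv.sum_comp, Fintype.sum_sigma]
  rfl

theorem measurePreserving_split :
    MeasurePreserving D.split volume (Measure.pi fun _ => volume) := by
  refine MeasurePreserving.symm D.split.symm ⟨D.split.symm.measurable, ?_⟩
  rw [volume_pi]
  refine (Measure.pi_eq fun s hs => ?_).symm
  rw [MeasurableEquiv.map_apply]
  have : D.split.symm ⁻¹' (Set.univ.pi s) =
      Set.univ.pi fun l => Set.univ.pi fun y => s (D.incl l y) := by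
    ext w
    simp only [Set.mem_preimage, Set.mem_univ_pi]
    refine ⟨fun h l y => ?_, fun h x => ?_⟩
    · rw [← D.split_symm_incl w l y]; exact h _
    · obtain ⟨⟨l, y⟩, rfl⟩ := D.sigmaEquiv.surjective x
      change D.split.symm w (D.incl l y) ∈ s (D.incl l y)
      rw [D.split_symm_incl]; exact h l y
  rw [this, Measure.pi_pi, D.prod_sites]
  simp only [volume_pi, Measure.pi_pi]

theorem quasiMeasurePreserving_res (l : Fin M) :
    Measure.QuasiMeasurePreserving (D.res l) volume volume :=
  (Measure.quasiMeasurePreserving_eval (μ := fun l => (volume : Measure (D.part l → ℝ))) l).comp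
    D.measurePreserving_split.quasiMeasurePreserving

theorem ae_res {l : Fin M} {p : (D.part l → ℝ) → Prop} (h : ∀ᵐ v, p v) :
    ∀ᵐ u, p (D.res l u) := (D.quasiMeasurePreserving_res l).ae h

theorem memLp_prod (ψ : ∀ l, L2 (D.part l)) :
    MemLp (fun u => ∏ l, ψ l (D.res l u)) 2 (volume : Measure (Λ → ℝ)) := by
  have hm : AEStronglyMeasurable (fun u => ∏ l, ψ l (D.res l u)) (volume : Measure (Λ → ℝ)) := by
    refine Finset.aestronglyMeasurable_fun_prod _ fun l _ => ?_
    exact (Lp.aestronglyMeasurable (ψ l)).comp_quasiMeasurePreserving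
      (D.quasiMeasurePreserving_res l)
  rw [memLp_two_iff_integrable_sq_norm hm]
  have h : Integrable (fun w : ∀ l, D.part l → ℝ => ∏ l, ‖ψ l (w l)‖ ^ 2)
      (Measure.pi fun _ => volume) :=
    Integrable.fintype_prod_dep fun l =>
      (memLp_two_iff_integrable_sq_norm (Lp.aestronglyMeasurable (ψ l))).1 (Lp.memLp (ψ l))
  have h' := (D.measurePreserving_split.integrable_comp_emb D.split.measurableEmbedding).2 h
  refine h'.congr (Filter.Eventually.of_forall fun u => ?_)
  simp only [Function.comp_apply, norm_prod, Finset.prod_pow]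
  rfl

/-- The vector `⨂_l ψ_l`. -/
def tens (ψ : ∀ l, L2 (D.part l)) : L2 Λ := (D.memLp_prod ψ).toLp

theorem isTensor_tens (ψ : ∀ l, L2 (D.part l)) : D.IsTensor ψ (D.tens ψ) :=
  (D.memLp_prod ψ).coeFn_toLp

theorem IsTensor.eq_tens {ψ : ∀ l, L2 (D.part l)} {Ψ : L2 Λ} (h : D.IsTensor ψ Ψ) :
    Ψ = D.tens ψ := by
  refine Lp.ext ?_
  filter_upwards [h, D.isTensor_tens ψ] with u h1 h2
  rw [h1, h2]

/-- Tensor products can be identified using arbitrary representatives of the factors. -/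
theorem eq_tens_of_ae {ψ : ∀ l, L2 (D.part l)} {Ψ : L2 Λ} (f : ∀ l, (D.part l → ℝ) → ℂ)
    (hψ : ∀ l, ψ l =ᵐ[volume] f l) (hΨ : ∀ᵐ u, Ψ u = ∏ l, f l (D.res l u)) : Ψ = D.tens ψ := by
  refine IsTensor.eq_tens D ?_
  have h := ae_all_iff.2 fun l => D.ae_res (hψ l)
  filter_upwards [hΨ, h] with u h1 h2
  rw [h1]
  exact Finset.prod_congr rfl fun l _ => (h2 l).symm

theorem inner_tens (ψ φ : ∀ l, L2 (D.part l)) :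
    ⟪D.tens ψ, D.tens φ⟫_ℂ = ∏ l, ⟪ψ l, φ l⟫_ℂ := by
  have h1 : ⟪D.tens ψ, D.tens φ⟫_ℂ =
      ∫ u, (fun w : ∀ l, D.part l → ℝ => ∏ l, ⟪ψ l (w l), φ l (w l)⟫_ℂ) (D.split u) := by
    rw [L2.inner_def]
    refine integral_congr_ae ?_
    filter_upwards [D.isTensor_tens ψ, D.isTensor_tens φ] with u h1 h2
    rw [h1, h2]
    simp only [RCLike.inner_apply, map_prod, Finset.prod_mul_distrib]
    rfl
  rw [h1, D.measurePreserving_split.integral_comp' (fun w : ∀ l, D.part l → ℝ =>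
      ∏ l, ⟪ψ l (w l), φ l (w l)⟫_ℂ), integral_fintype_prod_eq_prod fun l v => ⟪ψ l v, φ l v⟫_ℂ]
  rfl

/-- The restriction of the parameter of a wave packet to a sub-box. -/
def resC (z : Λ → ℂ) (l : Fin M) : D.part l → ℂ := fun y => z (D.incl l y)

/-- Wave packets with matrix `1` are product functions. -/
theorem gauss_eq_prod (z : Λ → ℂ) (u : Λ → ℝ) : gauss coercive_one z u =
    ∏ l, gauss (coercive_one (ι := D.part l)) (D.resC z l) (D.res l u) := by
  simp only [gauss_apply, ← Complex.exp_sum]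
  congr 1
  have e : ∀ {ι : Type} [Fintype ι] [DecidableEq ι] (z : ι → ℂ) (u : ι → ℝ),
      gaussExp (1 : Matrix ι ι ℝ) z u = ∑ x, (-(1 / 2) * (u x * u x : ℂ) + z x * u x) := by
    intro ι _ _ z u
    simp [gaussExp, Matrix.one_apply, Finset.sum_add_distrib, Finset.mul_sum, apply_ite Complex.ofReal]
  rw [e, D.sum_sites]
  refine Finset.sum_congr rfl fun l _ => ?_
  rw [e]
  rfl

theorem emb_gauss_eq_tens (z : Λ → ℂ) : emb (gauss coercive_one z) =
    D.tens fun l => emb (gauss (coercive_one (ι := D.part l)) (D.resC z l)) := by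
  refine D.eq_tens_of_ae (fun l => gauss (coercive_one (ι := D.part l)) (D.resC z l))
    (fun l => coeFn_emb _) ?_
  filter_upwards [coeFn_emb (gauss (coercive_one (ι := Λ)) z)] with u hu
  rw [hu, D.gauss_eq_prod]

theorem isTensorMap_tens : IsTensorMap D.tens := by
  refine ⟨D.inner_tens, ?_⟩
  refine Total.of_forall_eq_zero fun ψ hψ => ?_
  exact (total_gauss (coercive_one (ι := Λ))).eq_zero fun z => by
    rw [D.emb_gauss_eq_tens]; exact hψ _

theorem tensorOp_eq (T : ∀ l, L2 (D.part l) →L[ℂ] L2 (D.part l)) :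
    D.tensorOp T = D.isTensorMap_tens.map T := by
  have h : ∃ S, D.IsTensorOp T S := ⟨D.isTensorMap_tens.map T, fun ψ Ψ Ψ' h h' => by
    rw [IsTensor.eq_tens D h, IsTensor.eq_tens D h', D.isTensorMap_tens.map_apply]⟩
  rw [tensorOp, dif_pos h]
  refine D.isTensorMap_tens.total.clm_ext fun ψ => ?_
  rw [D.isTensorMap_tens.map_apply]
  exact h.choose_spec ψ _ _ (D.isTensor_tens ψ) (D.isTensor_tens _)

/-- The position or momentum index of a sub-box as an index of the box. -/
def lift (l : Fin M) (a : D.part l ⊕ D.part l) : Λ ⊕ Λ := Sum.map (D.incl l) (D.incl l) a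

theorem emb_posS_gauss (z : Λ → ℂ) (l : Fin M) (y : D.part l) :
    emb (posS (D.incl l y) (gauss coercive_one z)) = D.tens (Function.update
      (fun l => emb (gauss (coercive_one (ι := D.part l)) (D.resC z l))) l
      (emb (posS y (gauss coercive_one (D.resC z l))))) := by
  refine D.eq_tens_of_ae (Function.update
    (fun l v => gauss (coercive_one (ι := D.part l)) (D.resC z l) v) l
      fun v => posS y (gauss coercive_one (D.resC z l)) v) (fun l' => ?_) ?_
  · rcases eq_or_ne l' l with rfl | hl
    · simp only [Function.update_self]; exact coeFn_emb _
    · simp only [Function.update_of_ne hl]; exact coeFn_emb _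
  · filter_upwards [coeFn_emb (posS (D.incl l y) (gauss (coercive_one (ι := Λ)) z))] with u hu
    rw [hu, posS_apply, D.gauss_eq_prod, ← Finset.mul_prod_erase _ _ (Finset.mem_univ l),
      ← Finset.mul_prod_erase _ _ (Finset.mem_univ l), Function.update_self, posS_apply, ← mul_assoc]
    congr 1
    refine Finset.prod_congr rfl fun l' hl => ?_
    rw [Function.update_of_ne (Finset.ne_of_mem_erase hl)]

/-- Positions and momenta of a sub-box act on the corresponding tensor factor only. -/
theorem emb_qpS_gauss (z : Λ → ℂ) (l : Fin M) (a : D.part l ⊕ D.part l) :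
    emb (qpS (D.lift l a) (gauss coercive_one z)) = D.tens (Function.update
      (fun l => emb (gauss (coercive_one (ι := D.part l)) (D.resC z l))) l
      (emb (qpS a (gauss coercive_one (D.resC z l))))) := by
  have hm : ∀ {ι : Type} [Fintype ι] [DecidableEq ι] (z : ι → ℂ) (x : ι),
      emb (momS x (gauss (coercive_one (ι := ι)) z)) =
        -Complex.I • (z x • emb (gauss coercive_one z) +
          (-1 : ℂ) • emb (posS x (gauss coercive_one z))) := by
    intro ι _ _ z x
    rw [momS_gauss coercive_one Matrix.isSymm_one, map_smul, map_sub, map_smul, sub_eq_add_neg,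
      neg_one_smul]
    simp [Matrix.one_apply]
  cases a with
  | inl y => exact D.emb_posS_gauss z l y
  | inr y =>
    change emb (momS (D.incl l y) _) = D.tens (Function.update _ l (emb (momS y _)))
    rw [hm, hm, D.isTensorMap_tens.update_smul, D.isTensorMap_tens.update_add,
      D.isTensorMap_tens.update_smul, D.isTensorMap_tens.update_smul, ← D.emb_posS_gauss,
      D.emb_gauss_eq_tens, Function.update_eq_self]
    rfl

end BoxDecomposition

/-! ### Correlations of product states -/

theorem corrMatrix_apply {ι : Type*} [Fintype ι] [DecidableEq ι] {ρ S T : L2 ι →L[ℂ] L2 ι}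
    {a b : ι ⊕ ι} (hS : IsMoment (qp a) ρ S) (hT : IsMoment (qp b) ρ T) :
    corrMatrix ρ a b = hsInner S T - hsInner (rootOp ρ) S * hsInner (rootOp ρ) T := by
  rw [corrMatrix, hS.expectMul_eq hT, hS.expect_eq, hT.expect_eq]

/-- Expectations of positions and momenta are real. -/
theorem IsMoment.hsInner_comm {ι : Type*} [Fintype ι] [DecidableEq ι] {ρ S : L2 ι →L[ℂ] L2 ι}
    {a : ι ⊕ ι} (hS : IsMoment (qp a) ρ S) : hsInner S (rootOp ρ) = hsInner (rootOp ρ) S :=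
  tsum_congr fun _ => qp_symm (hS.graph _) (hS.graph _)

namespace BoxDecomposition

variable {d : ℕ} {Λ : Finset (Fin d → ℤ)} {M : ℕ} (D : BoxDecomposition Λ M)
  {ρ : ∀ l, L2 (D.part l) →L[ℂ] L2 (D.part l)}

theorem exists_lift (a : Λ ⊕ Λ) : ∃ l b, D.lift l b = a := by
  rcases a with x | x <;> obtain ⟨⟨l, y⟩, rfl⟩ := D.sigmaEquiv.surjective x
  · exact ⟨l, Sum.inl y, rfl⟩
  · exact ⟨l, Sum.inr y, rfl⟩

theorem hilbertSchmidt_update (hρ : ∀ l, IsState (ρ l)) {l : Fin M}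
    {S : L2 (D.part l) →L[ℂ] L2 (D.part l)} (hS : HilbertSchmidt S) (l' : Fin M) :
    HilbertSchmidt (Function.update (fun l => rootOp (ρ l)) l S l') := by
  rcases eq_or_ne l' l with rfl | hl
  · rw [Function.update_self]; exact hS
  · rw [Function.update_of_ne hl]; exact (hρ l').hilbertSchmidt_rootOp

/-- `A √ρ = ⨂_l T_l` with `T_l = A √ρ_l` in the factor on which `A` acts and `T_l = √ρ_l` in the
other ones. -/
theorem isMoment_tensorOp (hρ : ∀ l, IsState (ρ l)) {l : Fin M} {a : D.part l ⊕ D.part l}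
    {S : L2 (D.part l) →L[ℂ] L2 (D.part l)} (hS : IsMoment (qp a) (ρ l) S) :
    IsMoment (qp (D.lift l a)) (D.tensorOp ρ)
      (D.isTensorMap_tens.map (Function.update (fun l => rootOp (ρ l)) l S)) := by
  have hτ := D.isTensorMap_tens
  refine ⟨fun Ψ => ?_, hτ.hilbertSchmidt_map (D.hilbertSchmidt_update hρ hS.hilbertSchmidt)⟩
  · rw [tensorOp_eq, hτ.rootOp_map fun l => (hρ l).1]
    refine mem_graph_qp_of_gauss coercive_one Matrix.isSymm_one _ fun z => ?_
    have h : (innerSL ℂ (emb (gauss (coercive_one (ι := Λ)) z))).comp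
          (hτ.map (Function.update (fun l => rootOp (ρ l)) l S)) =
        (innerSL ℂ (emb (qpS (D.lift l a) (gauss (coercive_one (ι := Λ)) z)))).comp
          (hτ.map fun l => rootOp (ρ l)) := by
      refine hτ.total.clm_ext fun ψ => ?_
      simp only [ContinuousLinearMap.comp_apply, innerSL_apply_apply, hτ.map_apply]
      rw [D.emb_gauss_eq_tens, D.emb_qpS_gauss, hτ.inner, hτ.inner,
        ← Finset.mul_prod_erase _ _ (Finset.mem_univ l),
        ← Finset.mul_prod_erase (a := l) _ _ (Finset.mem_univ l),
        Function.update_self, Function.update_self]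
      congr 1
      · exact inner_emb_of_mem_graph_qp (hS.graph (ψ l)) _
      · refine Finset.prod_congr rfl fun l' hl => ?_
        rw [Function.update_of_ne (Finset.ne_of_mem_erase hl),
          Function.update_of_ne (Finset.ne_of_mem_erase hl)]
    exact DFunLike.congr_fun h Ψ

theorem hilbertSchmidt_rootOp_tensorOp (hρ : ∀ l, IsState (ρ l)) :
    HilbertSchmidt (rootOp (D.tensorOp ρ)) := by
  rw [tensorOp_eq, D.isTensorMap_tens.rootOp_map fun l => (hρ l).1]
  exact D.isTensorMap_tens.hilbertSchmidt_map fun l => (hρ l).hilbertSchmidt_rootOp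

theorem isPositive_tensorOp (hρ : ∀ l, IsState (ρ l)) : (D.tensorOp ρ).IsPositive := by
  rw [tensorOp_eq]
  exact D.isTensorMap_tens.map_isPositive fun l => (hρ l).1

theorem hsInner_rootOp_update (hρ : ∀ l, IsState (ρ l)) {l : Fin M}
    {S : L2 (D.part l) →L[ℂ] L2 (D.part l)} (hS : HilbertSchmidt S) :
    hsInner (rootOp (D.tensorOp ρ))
      (D.isTensorMap_tens.map (Function.update (fun l => rootOp (ρ l)) l S)) =
      hsInner (rootOp (ρ l)) S := by
  rw [tensorOp_eq, D.isTensorMap_tens.rootOp_map fun l => (hρ l).1,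
    D.isTensorMap_tens.hsInner_map (fun l => (hρ l).hilbertSchmidt_rootOp)
      (D.hilbertSchmidt_update hρ hS), ← Finset.mul_prod_erase _ _ (Finset.mem_univ l),
    Function.update_self, Finset.prod_eq_one, mul_one]
  intro l' hl
  rw [Function.update_of_ne (Finset.ne_of_mem_erase hl), (hρ l').hsInner_rootOp]

/-- Within a sub-box, a product state has the correlations of the corresponding factor. -/
theorem corrMatrix_tensorOp_self (hρ : ∀ l, IsState (ρ l))
    (h2 : ∀ l, HasSecondMoments (ρ l)) (l : Fin M) (a b : D.part l ⊕ D.part l) :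
    corrMatrix (D.tensorOp ρ) (D.lift l a) (D.lift l b) = corrMatrix (ρ l) a b := by
  obtain ⟨S, hS⟩ := (h2 l a).exists_isMoment (isClosed_graph_qp a)
  obtain ⟨T, hT⟩ := (h2 l b).exists_isMoment (isClosed_graph_qp b)
  rw [corrMatrix_apply hS hT, corrMatrix_apply (D.isMoment_tensorOp hρ hS)
    (D.isMoment_tensorOp hρ hT), D.hsInner_rootOp_update hρ hS.hilbertSchmidt,
    D.hsInner_rootOp_update hρ hT.hilbertSchmidt,
    D.isTensorMap_tens.hsInner_map (D.hilbertSchmidt_update hρ hS.hilbertSchmidt)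
      (D.hilbertSchmidt_update hρ hT.hilbertSchmidt),
    ← Finset.mul_prod_erase _ _ (Finset.mem_univ l),
    Function.update_self, Function.update_self, Finset.prod_eq_one, mul_one]
  intro l' hl
  rw [Function.update_of_ne (Finset.ne_of_mem_erase hl),
    Function.update_of_ne (Finset.ne_of_mem_erase hl), (hρ l').hsInner_rootOp]

/-- Different sub-boxes are uncorrelated in a product state. -/
theorem corrMatrix_tensorOp_of_ne (hρ : ∀ l, IsState (ρ l))
    (h2 : ∀ l, HasSecondMoments (ρ l)) {l l' : Fin M} (hl : l ≠ l') (a : D.part l ⊕ D.part l)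
    (b : D.part l' ⊕ D.part l') :
    corrMatrix (D.tensorOp ρ) (D.lift l a) (D.lift l' b) = 0 := by
  obtain ⟨S, hS⟩ := (h2 l a).exists_isMoment (isClosed_graph_qp a)
  obtain ⟨T, hT⟩ := (h2 l' b).exists_isMoment (isClosed_graph_qp b)
  have hmem : l' ∈ Finset.univ.erase l := Finset.mem_erase.2 ⟨hl.symm, Finset.mem_univ _⟩
  rw [corrMatrix_apply (D.isMoment_tensorOp hρ hS)
    (D.isMoment_tensorOp hρ hT), D.hsInner_rootOp_update hρ hS.hilbertSchmidt,
    D.hsInner_rootOp_update hρ hT.hilbertSchmidt,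
    D.isTensorMap_tens.hsInner_map (D.hilbertSchmidt_update hρ hS.hilbertSchmidt)
      (D.hilbertSchmidt_update hρ hT.hilbertSchmidt),
    ← Finset.mul_prod_erase _ _ (Finset.mem_univ l), ← Finset.mul_prod_erase _ _ hmem,
    Function.update_self, Function.update_self, Function.update_of_ne hl,
    Function.update_of_ne hl.symm, Finset.prod_eq_one, mul_one, hS.hsInner_comm, sub_self]
  intro m hm
  have h1 := Finset.ne_of_mem_erase hm
  have h3 := Finset.ne_of_mem_erase (Finset.mem_of_mem_erase hm)
  rw [Function.update_of_ne h1, Function.update_of_ne h3, (hρ m).hsInner_rootOp]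

/-- A product of states with second moments has second moments. -/
theorem exists_isMoment_tensorOp (hρ : ∀ l, IsState (ρ l)) (h2 : ∀ l, HasSecondMoments (ρ l)) :
    ∃ S : Λ ⊕ Λ → L2 Λ →L[ℂ] L2 Λ, ∀ a, IsMoment (qp a) (D.tensorOp ρ) (S a) := by
  have h : ∀ a, ∃ S, IsMoment (qp a) (D.tensorOp ρ) S := fun a => by
    obtain ⟨l, b, rfl⟩ := D.exists_lift a
    obtain ⟨S, hS⟩ := (h2 l b).exists_isMoment (isClosed_graph_qp b)
    exact ⟨_, D.isMoment_tensorOp hρ hS⟩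
  exact ⟨fun a => (h a).choose, fun a => (h a).choose_spec⟩

end BoxDecomposition

/-! ### Norms of `2 × 2` blocks -/

section Blocks

variable {ι : Type*} [Fintype ι]

theorem blockNorm_nonneg (M : Matrix (ι ⊕ ι) (ι ⊕ ι) ℂ) (x y : ι) : 0 ≤ blockNorm M x y :=
  norm_nonneg _

theorem block_mul (M N : Matrix (ι ⊕ ι) (ι ⊕ ι) ℂ) (x y : ι) :
    block (M * N) x y = ∑ z, block M x z * block N z y := by
  ext i j
  rw [Matrix.sum_apply]
  fin_cases i <;> fin_cases j <;>
    simp [block, Matrix.mul_apply, Finset.sum_add_distrib]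

theorem blockNorm_mul_le (M N : Matrix (ι ⊕ ι) (ι ⊕ ι) ℂ) (x y : ι) :
    blockNorm (M * N) x y ≤ ∑ z, blockNorm M x z * blockNorm N z y := by
  rw [blockNorm, block_mul, map_sum]
  refine (norm_sum_le _ _).trans (Finset.sum_le_sum fun z _ => ?_)
  rw [map_mul]
  exact norm_mul_le _ _

/-- A constant for the equivalence of the operator norm and the maximum norm of `2 × 2`
matrices. -/
def blockConst : ℝ :=
  ∑ i, ∑ j, ‖Matrix.toEuclideanCLM (n := Fin 2) (𝕜 := ℂ) (Matrix.single i j 1)‖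

theorem blockConst_nonneg : 0 ≤ blockConst :=
  Finset.sum_nonneg fun _ _ => Finset.sum_nonneg fun _ _ => norm_nonneg _

theorem norm_toEuclideanCLM_le (A : Matrix (Fin 2) (Fin 2) ℂ) {m : ℝ} (h : ∀ i j, ‖A i j‖ ≤ m) :
    ‖Matrix.toEuclideanCLM (n := Fin 2) (𝕜 := ℂ) A‖ ≤ blockConst * m := by
  conv_lhs => rw [Matrix.matrix_eq_sum_single A]
  simp only [map_sum, blockConst, Finset.sum_mul]
  refine (norm_sum_le _ _).trans (Finset.sum_le_sum fun i _ => (norm_sum_le _ _).trans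
    (Finset.sum_le_sum fun j _ => ?_))
  have : Matrix.single i j (A i j) = A i j • Matrix.single i j (1 : ℂ) := by
    rw [Matrix.smul_single, smul_eq_mul, mul_one]
  rw [this, map_smul, norm_smul, mul_comm]
  exact mul_le_mul_of_nonneg_left (h i j) (norm_nonneg _)

theorem ofReal_blockNorm_rpow_le (M : Matrix (ι ⊕ ι) (ι ⊕ ι) ℂ) (x y : ι) {s : ℝ} (hs : 0 ≤ s)
    {c : ℝ≥0∞} (h : ∀ i j, ENNReal.ofReal (‖block M x y i j‖ ^ s) ≤ c) :
    ENNReal.ofReal (blockNorm M x y ^ s) ≤ ENNReal.ofReal (blockConst ^ s) * c := by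
  obtain ⟨⟨i, j⟩, hij⟩ := Finite.exists_max fun p : Fin 2 × Fin 2 => ‖block M x y p.1 p.2‖
  have h1 : blockNorm M x y ≤ blockConst * ‖block M x y i j‖ :=
    norm_toEuclideanCLM_le _ fun i' j' => hij (i', j')
  have h2 := Real.rpow_le_rpow (blockNorm_nonneg M x y) h1 hs
  rw [Real.mul_rpow blockConst_nonneg (norm_nonneg _)] at h2
  refine (ENNReal.ofReal_le_ofReal h2).trans ?_
  rw [ENNReal.ofReal_mul (Real.rpow_nonneg blockConst_nonneg _)]
  gcongr
  exact h i j

theorem continuous_blockNorm (x y : ι) :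
    Continuous fun M : Matrix (ι ⊕ ι) (ι ⊕ ι) ℂ => blockNorm M x y := by
  have h : Continuous fun A : Matrix (Fin 2) (Fin 2) ℂ =>
      Matrix.toEuclideanCLM (n := Fin 2) (𝕜 := ℂ) A :=
    LinearMap.continuous_of_finiteDimensional
      { toFun := fun A : Matrix (Fin 2) (Fin 2) ℂ => Matrix.toEuclideanCLM (n := Fin 2) (𝕜 := ℂ) A
        map_add' := fun _ _ => map_add _ _ _
        map_smul' := fun _ _ => map_smul _ _ _ }
  refine (h.comp (continuous_matrix fun i j => ?_)).norm
  fin_cases i <;> fin_cases j <;> simp only [block] <;>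
  exact Continuous.matrix_elem continuous_id _ _

theorem aemeasurable_blockNorm {Ω : Type*} [MeasurableSpace Ω] {P : Measure Ω}
    {G : Ω → Matrix (ι ⊕ ι) (ι ⊕ ι) ℂ} (hG : ∀ a b, AEMeasurable (fun ω => G ω a b) P) (x y : ι) :
    AEMeasurable (fun ω => blockNorm (G ω) x y) P := by
  have h1 : AEMeasurable (fun ω => (fun a b => G ω a b : ι ⊕ ι → ι ⊕ ι → ℂ)) P :=
    aemeasurable_pi_lambda _ fun a => aemeasurable_pi_lambda _ fun b => hG a b
  have h2 : Continuous fun M : ι ⊕ ι → ι ⊕ ι → ℂ => blockNorm (Matrix.of M) x y :=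
    continuous_blockNorm x y
  exact h2.measurable.comp_aemeasurable h1

/-- The supremum over all times can be restricted to a countable set. -/
theorem aemeasurable_iSup_blockNorm {Ω : Type*} [MeasurableSpace Ω] {P : Measure Ω}
    {G : Ω → ℝ → Matrix (ι ⊕ ι) (ι ⊕ ι) ℂ} (hG : ∀ t a b, AEMeasurable (fun ω => G ω t a b) P)
    (hc : ∀ ω, Continuous (G ω)) (x y : ι) {p : ℝ} (hp : 0 < p) :
    AEMeasurable (fun ω => ⨆ t : ℝ, ENNReal.ofReal (blockNorm (G ω t) x y ^ p)) P := by
  have e : ∀ ω, ⨆ t : ℝ, ENNReal.ofReal (blockNorm (G ω t) x y ^ p) =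
      ⨆ r : ℚ, ENNReal.ofReal (blockNorm (G ω r) x y ^ p) := by
    intro ω
    have hcont : Continuous fun t => ENNReal.ofReal (blockNorm (G ω t) x y ^ p) :=
      ENNReal.continuous_ofReal.comp
        ((Real.continuous_rpow_const hp.le).comp ((continuous_blockNorm x y).comp (hc ω)))
    refine le_antisymm (iSup_le fun t => ?_) (iSup_le fun r => le_iSup
      (fun t : ℝ => ENNReal.ofReal (blockNorm (G ω t) x y ^ p)) (r : ℝ))
    have hcl : IsClosed {t : ℝ | ENNReal.ofReal (blockNorm (G ω t) x y ^ p) ≤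
        ⨆ r : ℚ, ENNReal.ofReal (blockNorm (G ω r) x y ^ p)} :=
      isClosed_le hcont continuous_const
    have : closure (Set.range ((↑) : ℚ → ℝ)) ⊆ _ := closure_minimal (by
      rintro _ ⟨r, rfl⟩
      exact le_iSup (fun r : ℚ => ENNReal.ofReal (blockNorm (G ω r) x y ^ p)) r) hcl
    rw [Rat.denseRange_cast.closure_range] at this
    exact this (Set.mem_univ t)
  simp only [e]
  exact AEMeasurable.iSup fun r =>
    ((aemeasurable_blockNorm (hG r) x y).pow_const p).ennreal_ofReal

end Blocks

/-! ### Spectral bounds and measurability of the flow matrix -/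

section Spectrum

variable {d : ℕ} {lam : ℝ} {k : (Fin d → ℤ) → ℝ} {Λ : Finset (Fin d → ℤ)}

/-- An eigenvalue is the value of the quadratic form of `h` at a normalized eigenvector. -/
theorem eigenvalues_effHam (j : Λ) : (effHam_isHermitian lam k Λ).eigenvalues j =
    ∑ x : Λ, k x / 2 * (effHam_isHermitian lam k Λ).eigenvectorBasis j x ^ 2 +
      (1 / 2) * ∑ x : Λ, ∑ y : Λ, (if (nnGraph Λ).Adj x y then
        lam * ((effHam_isHermitian lam k Λ).eigenvectorBasis j x -
          (effHam_isHermitian lam k Λ).eigenvectorBasis j y) ^ 2 else 0) := by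
  rw [effHam_quadratic, Matrix.IsHermitian.eigenvalues_eq]
  simp only [dotProduct, Matrix.mulVec, Finset.mul_sum, star_trivial, RCLike.re_to_real,
    Pi.star_apply]
  refine Finset.sum_congr rfl fun x _ => Finset.sum_congr rfl fun y _ => by ring

theorem sum_sq_eigenvectorBasis (j : Λ) :
    ∑ x : Λ, (effHam_isHermitian lam k Λ).eigenvectorBasis j x ^ 2 = 1 := by
  have h := (effHam_isHermitian lam k Λ).eigenvectorBasis.norm_eq_one j
  have h2 := EuclideanSpace.norm_sq_eq ((effHam_isHermitian lam k Λ).eigenvectorBasis j)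
  rw [h] at h2
  simpa using h2.symm

theorem eigenvalues_effHam_pos (hlam : 0 < lam) (hk : ∀ x : Λ, 0 < k x) (j : Λ) :
    0 < (effHam_isHermitian lam k Λ).eigenvalues j := by
  rw [eigenvalues_effHam]
  refine add_pos_of_pos_of_nonneg ?_ ?_
  · obtain ⟨x, -, hx⟩ : ∃ x ∈ Finset.univ,
        (effHam_isHermitian lam k Λ).eigenvectorBasis j x ^ 2 ≠ 0 := by
      refine Finset.exists_ne_zero_of_sum_ne_zero ?_
      rw [sum_sq_eigenvectorBasis]; exact one_ne_zero
    refine Finset.sum_pos' (fun x _ => ?_) ⟨x, Finset.mem_univ x, ?_⟩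
    · have := hk x; positivity
    · have := hk x; positivity
  · refine mul_nonneg (by norm_num) (Finset.sum_nonneg fun x _ => Finset.sum_nonneg fun y _ => ?_)
    split_ifs <;> positivity

/-- A crude bound on the degree: all neighbours lie in a cube of side length `3`. -/
theorem card_filter_adj_le (x : Λ) :
    (Finset.univ.filter fun y => (nnGraph Λ).Adj x y).card ≤ 3 ^ d := by
  have h1 : (Finset.Icc (fun i => x.1 i - 1) (fun i => x.1 i + 1)).card = 3 ^ d := by
    rw [Pi.card_Icc]
    have : ∀ i, (Finset.Icc (x.1 i - 1) (x.1 i + 1)).card = 3 := fun i => by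
      rw [Int.card_Icc]; ring_nf; rfl
    simp [this]
  rw [← h1]
  refine Finset.card_le_card_of_injOn (fun y => y.1) (fun y hy => ?_) Subtype.val_injective.injOn
  have hy' : l1dist x.1 y.1 = 1 := (Finset.mem_filter.1 hy).2
  have h : ∀ i, |x.1 i - y.1 i| ≤ 1 := fun i => by
    rw [← hy']
    exact Finset.single_le_sum (f := fun i => |x.1 i - y.1 i|) (fun _ _ => abs_nonneg _)
      (Finset.mem_univ i)
  rw [Finset.mem_coe, Finset.mem_Icc]
  exact ⟨fun i => by have := abs_le.1 (h i); linarith,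
    fun i => by have := abs_le.1 (h i); linarith⟩

theorem eigenvalues_effHam_le (hlam : 0 < lam) {kmax : ℝ} (hk : ∀ x : Λ, k x ≤ kmax) (j : Λ) :
    (effHam_isHermitian lam k Λ).eigenvalues j ≤ kmax / 2 + 2 * lam * 3 ^ d := by
  rw [eigenvalues_effHam]
  set v := (effHam_isHermitian lam k Λ).eigenvectorBasis j
  have hv : ∑ x : Λ, v x ^ 2 = 1 := sum_sq_eigenvectorBasis j
  refine add_le_add ?_ ?_
  · calc _ ≤ ∑ x : Λ, kmax / 2 * v x ^ 2 := Finset.sum_le_sum fun x _ => by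
          have := hk x; gcongr
      _ = kmax / 2 := by rw [← Finset.mul_sum, hv, mul_one]
  · have hle : ∀ x y : Λ, (if (nnGraph Λ).Adj x y then lam * (v x - v y) ^ 2 else 0) ≤
        2 * lam * (if (nnGraph Λ).Adj x y then v x ^ 2 else 0) +
          2 * lam * (if (nnGraph Λ).Adj y x then v y ^ 2 else 0) := by
      intro x y
      by_cases h : (nnGraph Λ).Adj x y
      · rw [if_pos h, if_pos h, if_pos h.symm]
        nlinarith [mul_nonneg hlam.le (sq_nonneg (v x + v y))]
      · rw [if_neg h, if_neg h, if_neg fun h' => h h'.symm]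
        simp
    have hdeg : ∑ x : Λ, ∑ y : Λ, (if (nnGraph Λ).Adj x y then v x ^ 2 else 0) ≤ 3 ^ d := by
      calc _ ≤ ∑ x : Λ, (3 : ℝ) ^ d * v x ^ 2 := Finset.sum_le_sum fun x _ => by
            rw [← Finset.sum_filter, Finset.sum_const, nsmul_eq_mul]
            gcongr
            exact_mod_cast card_filter_adj_le x
        _ = 3 ^ d := by rw [← Finset.mul_sum, hv, mul_one]
    calc _ ≤ 1 / 2 * ∑ x : Λ, ∑ y : Λ, (2 * lam * (if (nnGraph Λ).Adj x y then v x ^ 2 else 0) +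
          2 * lam * (if (nnGraph Λ).Adj y x then v y ^ 2 else 0)) := by
          gcongr with x _ y _
          exact hle x y
      _ = 2 * lam * ∑ x : Λ, ∑ y : Λ, (if (nnGraph Λ).Adj x y then v x ^ 2 else 0) := by
          simp only [Finset.sum_add_distrib, ← Finset.mul_sum]
          rw [Finset.sum_comm (f := fun x y => if (nnGraph Λ).Adj y x then v y ^ 2 else 0)]
          ring
      _ ≤ _ := by gcongr

variable (lam Λ) in
/-- Weierstrass approximation: continuous functions of a random symmetric matrix are random
variables. -/
theorem measurable_effFun {Ω : Type*} [MeasurableSpace Ω] {k : (Fin d → ℤ) → Ω → ℝ}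
    (hk : ∀ x, Measurable (k x)) {f : ℝ → ℝ} (hf : Continuous f) (x y : Λ) :
    Measurable fun ω => effFun lam (fun z => k z ω) Λ (fun u => (f u : ℂ)) x y := by
  have hid : ∀ x y : Λ, Measurable fun ω => effFun lam (fun z => k z ω) Λ (fun u => (u : ℂ)) x y := by
    intro x y
    simp only [effFun, symmFun_ofReal, Matrix.map_apply]
    refine Complex.measurable_ofReal.comp ?_
    simp only [effHam, Matrix.add_apply, Matrix.diagonal_apply]
    refine measurable_const.add ?_
    split_ifs
    · exact (hk _).div_const 2
    · exact measurable_const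
  have hpow : ∀ n : ℕ, ∀ x y : Λ,
      Measurable fun ω => effFun lam (fun z => k z ω) Λ (fun u => (u : ℂ) ^ n) x y := by
    intro n
    induction n with
    | zero =>
      intro x y
      simp only [pow_zero, effFun, symmFun_one]
      exact measurable_const
    | succ n ih =>
      intro x y
      simp only [pow_succ, effFun, ← symmFun_mul, Matrix.mul_apply]
      exact Finset.measurable_sum _ fun z _ => (ih x z).mul (hid z y)
  have hpoly : ∀ p : Polynomial ℝ, ∀ x y : Λ,
      Measurable fun ω => effFun lam (fun z => k z ω) Λ (fun u => (p.eval u : ℝ)) x y := by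
    intro p
    induction p using Polynomial.induction_on' with
    | add p q hp hq =>
      intro x y
      simp only [Polynomial.eval_add, Complex.ofReal_add, effFun, symmFun_add, Matrix.add_apply]
      exact (hp x y).add (hq x y)
    | monomial n c =>
      intro x y
      simp only [Polynomial.eval_monomial, Complex.ofReal_mul, Complex.ofReal_pow, effFun,
        symmFun_const_mul, Matrix.smul_apply, smul_eq_mul]
      exact (hpow n x y).const_mul _
  choose p hp using fun n : ℕ => exists_polynomial_near_of_continuousOn (-(n : ℝ)) n f
    hf.continuousOn (1 / ((n : ℝ) + 1)) (by positivity)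
  refine measurable_of_tendsto_metrizable (fun n => hpoly (p n) x y) ?_
  rw [tendsto_pi_nhds]
  intro ω
  simp only [effFun, symmFun]
  refine tendsto_finsetSum _ fun j _ => ((Filter.Tendsto.const_mul _ ?_).mul_const _)
  refine (Complex.continuous_ofReal.tendsto _).comp ?_
  set e := (effHam_isHermitian lam (fun z => k z ω) Λ).eigenvalues j
  rw [tendsto_iff_norm_sub_tendsto_zero]
  refine squeeze_zero' (Filter.Eventually.of_forall fun _ => norm_nonneg _) ?_
    tendsto_one_div_add_atTop_nhds_zero_nat
  obtain ⟨N, hN⟩ := exists_nat_ge |e|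
  filter_upwards [Filter.eventually_ge_atTop N] with n hn
  have hn' : (N : ℝ) ≤ n := by exact_mod_cast hn
  exact (hp n e (Set.mem_Icc.2 (abs_le.1 (hN.trans hn')))).le

theorem continuous_flowMatrix : Continuous (flowMatrix lam k Λ) := by
  refine continuous_matrix fun a b => ?_
  rcases a with a | a <;> rcases b with b | b <;>
  · simp only [flowMatrix, Matrix.fromBlocks_apply₁₁, Matrix.fromBlocks_apply₁₂,
      Matrix.fromBlocks_apply₂₁, Matrix.fromBlocks_apply₂₂, effFun, symmFun]
    fun_prop

theorem aemeasurable_flowMatrix {Ω : Type*} [MeasurableSpace Ω] {P : Measure Ω}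
    {k : (Fin d → ℤ) → Ω → ℝ} (hk : ∀ x, Measurable (k x))
    (hpos : ∀ᵐ ω ∂P, ∀ j, 0 < (effHam_isHermitian lam (fun z => k z ω) Λ).eigenvalues j) (t : ℝ)
    (a b : Λ ⊕ Λ) : AEMeasurable (fun ω => flowMatrix lam (fun z => k z ω) Λ t a b) P := by
  have h1 : ∀ x y : Λ, Measurable fun ω => effFun lam (fun z => k z ω) Λ
      (fun u => (Real.cos (2 * √u * t) : ℝ)) x y :=
    measurable_effFun lam Λ hk (by fun_prop)
  rcases a with a | a <;> rcases b with b | b <;>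
    simp only [flowMatrix, Matrix.fromBlocks_apply₁₁, Matrix.fromBlocks_apply₁₂,
      Matrix.fromBlocks_apply₂₁, Matrix.fromBlocks_apply₂₂]
  · exact (h1 a b).aemeasurable
  -- `sinc` continues `u ↦ (√u)⁻¹ sin (2√u t)` continuously to `u = 0`, where the original is a junk
  -- value
  · have h2 := measurable_effFun lam Λ hk (f := fun u => 2 * t * Real.sinc (2 * √u * t))
      (continuous_const.mul (Real.continuous_sinc.comp (by fun_prop))) a b
    refine h2.aemeasurable.congr ?_
    filter_upwards [hpos] with ω hω
    refine congrFun (congrFun (symmFun_congr _ fun j => ?_) a) b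
    have h3 : √((effHam_isHermitian lam (fun z => k z ω) Λ).eigenvalues j) ≠ 0 :=
      (Real.sqrt_pos.2 (hω j)).ne'
    congr 1
    rcases eq_or_ne t 0 with rfl | ht
    · simp
    · rw [Real.sinc_of_ne_zero (by simp [h3, ht])]
      field_simp
  · exact (measurable_effFun lam Λ hk (f := fun u => -√u * Real.sin (2 * √u * t))
      (by fun_prop) a b).aemeasurable
  · exact (h1 a b).aemeasurable

end Spectrum

/-! ### The flow matrix and the singular eigenfunction correlators -/

section FlowBound

variable {d : ℕ} {lam s : ℝ} {k : (Fin d → ℤ) → ℝ} {Λ : Finset (Fin d → ℤ)}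

/-- Functions of the form `u^{-1/2} g(u)` with `|g| ≤ κ` on the spectrum are controlled by the
singular correlator. -/
theorem ofReal_norm_effFun_le {e κ : ℝ} (hκ : 0 < κ)
    (hpos : ∀ j, 0 < (effHam_isHermitian lam k Λ).eigenvalues j)
    (hle : ∀ j, (effHam_isHermitian lam k Λ).eigenvalues j ≤ e) {f : ℝ → ℝ}
    (hf : ∀ u, 0 < u → u ≤ e → |√u * f u| ≤ κ) (x y : Λ) :
    ENNReal.ofReal (‖effFun lam k Λ (fun u => (f u : ℂ)) x y‖ ^ s) ≤
      ENNReal.ofReal (κ ^ s) * singularCorrelator lam s k Λ x y := by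
  classical
  let g : ℝ → ℂ := fun u => if 0 < u ∧ u ≤ e then ((√u * f u / κ : ℝ) : ℂ) else 0
  have hg : ∀ u, ‖g u‖ ≤ 1 := by
    intro u
    simp only [g]
    split_ifs with h
    · rw [Complex.norm_real, Real.norm_eq_abs, abs_div, abs_of_pos hκ, div_le_one hκ]
      exact hf u h.1 h.2
    · simp
  have h1 : effFun lam k Λ (fun u => (f u : ℂ)) = (κ : ℂ) • effFun lam k Λ
      (fun u => ((u ^ (-(1 / 2) : ℝ) : ℝ) : ℂ) * g u) := by
    rw [effFun, effFun, ← symmFun_const_mul]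
    refine symmFun_congr _ fun j => ?_
    have h2 := Real.sqrt_pos.2 (hpos j)
    simp only [g]
    rw [if_pos ⟨hpos j, hle j⟩, Real.rpow_neg (hpos j).le, ← Real.sqrt_eq_rpow]
    have h3 : ((√((effHam_isHermitian lam k Λ).eigenvalues j) : ℝ) : ℂ) ≠ 0 := by
      exact_mod_cast h2.ne'
    have h4 : (κ : ℂ) ≠ 0 := by exact_mod_cast hκ.ne'
    push_cast
    field_simp
  rw [h1, Matrix.smul_apply, smul_eq_mul, norm_mul, Complex.norm_real, Real.norm_of_nonneg hκ.le,
    Real.mul_rpow hκ.le (norm_nonneg _), ENNReal.ofReal_mul (Real.rpow_nonneg hκ.le _)]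
  gcongr
  exact le_iSup (fun g : {g : ℝ → ℂ // ∀ u, ‖g u‖ ≤ 1} =>
    ENNReal.ofReal (‖symmFun (effHam_isHermitian lam k Λ)
      (fun u => ((u ^ (-(1 / 2) : ℝ) : ℝ) : ℂ) * g.1 u) x y‖ ^ s)) ⟨g, hg⟩

/-- The entries of `M(t)` are `u^{-1/2} g(u)` with `g(u) = √u cos(2√u t)`, `sin(2√u t)` and
`-u sin(2√u t)`, so they are bounded by the singular correlator uniformly in time. -/
theorem ofReal_blockNorm_flowMatrix_le (hs : 0 ≤ s) {e : ℝ} (he : 0 ≤ e)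
    (hpos : ∀ j, 0 < (effHam_isHermitian lam k Λ).eigenvalues j)
    (hle : ∀ j, (effHam_isHermitian lam k Λ).eigenvalues j ≤ e) (t : ℝ) (x y : Λ) :
    ENNReal.ofReal (blockNorm (flowMatrix lam k Λ t) x y ^ s) ≤
        ENNReal.ofReal (blockConst ^ s * (1 + e) ^ s) * singularCorrelator lam s k Λ x y ∧
      ENNReal.ofReal (blockNorm (flowMatrix lam k Λ t).transpose x y ^ s) ≤
        ENNReal.ofReal (blockConst ^ s * (1 + e) ^ s) * singularCorrelator lam s k Λ x y := by
  have hsq : ∀ u : ℝ, u ≤ e → √u ≤ 1 + e := fun u hu => by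
    refine Real.sqrt_le_iff.2 ⟨by linarith, ?_⟩
    nlinarith
  have hκ : 0 < 1 + e := by linarith
  have b1 := ofReal_norm_effFun_le (s := s) (f := fun u => Real.cos (2 * √u * t)) hκ hpos hle
    (fun u h0 hu => by
      rw [abs_mul, abs_of_nonneg (Real.sqrt_nonneg u)]
      exact (mul_le_of_le_one_right (Real.sqrt_nonneg _) (Real.abs_cos_le_one _)).trans (hsq u hu))
    x y
  have b2 := ofReal_norm_effFun_le (s := s) (f := fun u => (√u)⁻¹ * Real.sin (2 * √u * t)) hκ hpos hle
    (fun u h0 hu => by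
      rw [← mul_assoc, mul_inv_cancel₀ (Real.sqrt_pos.2 h0).ne', one_mul]
      exact (Real.abs_sin_le_one _).trans (by linarith))
    x y
  have b3 := ofReal_norm_effFun_le (s := s) (f := fun u => -√u * Real.sin (2 * √u * t)) hκ hpos hle
    (fun u h0 hu => by
      rw [neg_mul, mul_neg, abs_neg, ← mul_assoc, Real.mul_self_sqrt h0.le, abs_mul, abs_of_pos h0]
      exact (mul_le_of_le_one_right h0.le (Real.abs_sin_le_one _)).trans (by linarith))
    x y
  have hsymm : ∀ f : ℝ → ℂ, effFun lam k Λ f y x = effFun lam k Λ f x y := fun f =>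
    congrFun (congrFun (symmFun_transpose (effHam_isHermitian lam k Λ) f) x) y
  rw [ENNReal.ofReal_mul (Real.rpow_nonneg blockConst_nonneg _), mul_assoc]
  refine ⟨ofReal_blockNorm_rpow_le _ x y hs fun i j => ?_,
    ofReal_blockNorm_rpow_le _ x y hs fun i j => ?_⟩
  · fin_cases i <;> fin_cases j
    · exact b1
    · exact b2
    · exact b3
    · exact b1
  · have e : block (flowMatrix lam k Λ t).transpose x y =
        !![effFun lam k Λ (fun u => (Real.cos (2 * √u * t) : ℝ)) x y,
          effFun lam k Λ (fun u => (-√u * Real.sin (2 * √u * t) : ℝ)) x y;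
          effFun lam k Λ (fun u => ((√u)⁻¹ * Real.sin (2 * √u * t) : ℝ)) x y,
          effFun lam k Λ (fun u => (Real.cos (2 * √u * t) : ℝ)) x y] := by
      simp only [block, flowMatrix, Matrix.transpose_apply, Matrix.fromBlocks_apply₁₁,
        Matrix.fromBlocks_apply₁₂, Matrix.fromBlocks_apply₂₁, Matrix.fromBlocks_apply₂₂, hsymm]
    rw [e]
    fin_cases i <;> fin_cases j
    · exact b1
    · exact b3
    · exact b2
    · exact b1

end FlowBound

/-! ### Lattice sums -/

section LatticeSums

variable {d : ℕ}

theorem l1dist_triangle (x y z : Fin d → ℤ) : l1dist x z ≤ l1dist x y + l1dist y z := by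
  rw [l1dist, l1dist, l1dist, ← Finset.sum_add_distrib]
  exact Finset.sum_le_sum fun i _ => abs_sub_le _ _ _

theorem l1dist_comm (x y : Fin d → ℤ) : l1dist x y = l1dist y x :=
  Finset.sum_congr rfl fun _ _ => abs_sub_comm _ _

theorem l1dist_nonneg (x y : Fin d → ℤ) : 0 ≤ l1dist x y :=
  Finset.sum_nonneg fun _ _ => abs_nonneg _

theorem summable_exp_neg_abs {η : ℝ} (hη : 0 < η) :
    Summable fun n : ℤ => Real.exp (-η * |(n : ℝ)|) := by
  have h : Summable fun n : ℕ => Real.exp (-η * n) := by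
    have := Real.summable_exp_nat_mul_iff (a := -η)
    simpa [mul_comm] using this.2 (by linarith)
  refine Summable.of_nat_of_neg ?_ ?_ <;> simpa using h

/-- The left side is at most the same sum over all of `ℤ^d`, which factorizes. -/
theorem sum_exp_l1dist_le {η : ℝ} (hη : 0 < η) (Λ : Finset (Fin d → ℤ)) (x : Fin d → ℤ) :
    ∑ z : Λ, Real.exp (-η * l1dist x z.1) ≤ (∑' n : ℤ, Real.exp (-η * |(n : ℝ)|)) ^ d := by
  classical
  have h1 : ∀ z : Fin d → ℤ, Real.exp (-η * l1dist x z) =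
      ∏ i, Real.exp (-η * |((x i - z i : ℤ) : ℝ)|) := fun z => by
    rw [← Real.exp_sum, ← Finset.mul_sum, l1dist]
    push_cast; rfl
  have hsub : Λ ⊆ Fintype.piFinset fun i => Λ.image fun z => z i := fun z hz =>
    Fintype.mem_piFinset.2 fun i => Finset.mem_image_of_mem _ hz
  rw [Finset.sum_coe_sort Λ fun z => Real.exp (-η * l1dist x z)]
  refine (Finset.sum_le_sum_of_subset_of_nonneg hsub fun _ _ _ => (Real.exp_pos _).le).trans ?_
  simp only [h1]
  rw [← Finset.prod_univ_sum (fun i => Λ.image fun z => z i)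
    fun i n => Real.exp (-η * |((x i - n : ℤ) : ℝ)|)]
  refine (Finset.prod_le_prod (fun i _ => Finset.sum_nonneg fun _ _ => (Real.exp_pos _).le)
    fun i _ => ?_).trans (by rw [Finset.prod_const, Finset.card_univ, Fintype.card_fin])
  have hs := (Equiv.subLeft (x i)).summable_iff.2 (summable_exp_neg_abs hη)
  rw [← (Equiv.subLeft (x i)).tsum_eq]
  exact hs.sum_le_tsum _ fun _ _ => (Real.exp_pos _).le

end LatticeSums

/-! ### Moments of products -/

section Holder

theorem rpow_sum_le {α : Type*} (t : Finset α) (f : α → ℝ≥0∞) {p : ℝ} (hp : 0 < p) (hp1 : p ≤ 1) :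
    (∑ a ∈ t, f a) ^ p ≤ ∑ a ∈ t, f a ^ p := by
  classical
  induction t using Finset.induction_on with
  | empty => simp [ENNReal.zero_rpow_of_pos hp]
  | insert a t ha ih =>
    rw [Finset.sum_insert ha, Finset.sum_insert ha]
    exact (ENNReal.rpow_add_le_add_rpow _ _ hp.le hp1).trans (by gcongr)

theorem lintegral_mul_mul_rpow_third_le {Ω : Type*} [MeasurableSpace Ω] {P : Measure Ω}
    {f g h : Ω → ℝ≥0∞} (hf : AEMeasurable f P) (hg : AEMeasurable g P) (hh : AEMeasurable h P) :
    ∫⁻ ω, f ω ^ (1 / 3 : ℝ) * g ω ^ (1 / 3 : ℝ) * h ω ^ (1 / 3 : ℝ) ∂P ≤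
      (∫⁻ ω, f ω ∂P) ^ (1 / 3 : ℝ) * (∫⁻ ω, g ω ∂P) ^ (1 / 3 : ℝ) *
        (∫⁻ ω, h ω ∂P) ^ (1 / 3 : ℝ) := by
  have := ENNReal.lintegral_prod_norm_pow_le (μ := P) (Finset.univ : Finset (Fin 3))
    (f := ![f, g, h]) (p := fun _ => 1 / 3) (fun i _ => by fin_cases i <;> assumption)
    (by norm_num) (fun _ _ => by norm_num)
  simpa [Fin.prod_univ_three] using this

theorem ofReal_rpow_third {b s : ℝ} (hb : 0 ≤ b) :
    ENNReal.ofReal (b ^ (s / 3)) = ENNReal.ofReal (b ^ s) ^ (1 / 3 : ℝ) := by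
  rw [ENNReal.ofReal_rpow_of_nonneg (Real.rpow_nonneg hb _) (by norm_num), ← Real.rpow_mul hb]
  congr 2
  ring

/-- `‖(M Γ N)_{xy}‖^{s/3}` is bounded by a sum of cubic roots of products of `s`-th powers. -/
theorem ofReal_blockNorm_mul_mul_le {ι : Type*} [Fintype ι] (M G N : Matrix (ι ⊕ ι) (ι ⊕ ι) ℂ)
    (x y : ι) {s : ℝ} (hs : 0 < s) (hs1 : s ≤ 1) :
    ENNReal.ofReal (blockNorm (M * G * N) x y ^ (s / 3)) ≤
      ∑ w, ∑ z, ENNReal.ofReal (blockNorm M x z ^ s) ^ (1 / 3 : ℝ) *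
        ENNReal.ofReal (blockNorm G z w ^ s) ^ (1 / 3 : ℝ) *
        ENNReal.ofReal (blockNorm N w y ^ s) ^ (1 / 3 : ℝ) := by
  have hp : 0 < s / 3 := by linarith
  have hp1 : s / 3 ≤ 1 := by linarith
  have hb : blockNorm (M * G * N) x y ≤
      ∑ w, ∑ z, blockNorm M x z * blockNorm G z w * blockNorm N w y := by
    refine (blockNorm_mul_le _ _ _ _).trans (Finset.sum_le_sum fun w _ => ?_)
    rw [← Finset.sum_mul]
    exact mul_le_mul_of_nonneg_right (blockNorm_mul_le _ _ _ _) (blockNorm_nonneg _ _ _)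
  have hnn : ∀ w z, 0 ≤ blockNorm M x z * blockNorm G z w * blockNorm N w y := fun w z =>
    mul_nonneg (mul_nonneg (blockNorm_nonneg _ _ _) (blockNorm_nonneg _ _ _))
      (blockNorm_nonneg _ _ _)
  rw [← ENNReal.ofReal_rpow_of_nonneg (blockNorm_nonneg _ _ _) hp.le]
  refine (ENNReal.rpow_le_rpow (ENNReal.ofReal_le_ofReal hb) hp.le).trans ?_
  rw [ENNReal.ofReal_sum_of_nonneg fun w _ => Finset.sum_nonneg fun z _ => hnn w z]
  refine (rpow_sum_le _ _ hp hp1).trans (Finset.sum_le_sum fun w _ => ?_)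
  rw [ENNReal.ofReal_sum_of_nonneg fun z _ => hnn w z]
  refine (rpow_sum_le _ _ hp hp1).trans (Finset.sum_le_sum fun z _ => le_of_eq ?_)
  rw [ENNReal.ofReal_rpow_of_nonneg (hnn w z) hp.le,
    Real.mul_rpow (mul_nonneg (blockNorm_nonneg _ _ _) (blockNorm_nonneg _ _ _))
      (blockNorm_nonneg _ _ _),
    Real.mul_rpow (blockNorm_nonneg _ _ _) (blockNorm_nonneg _ _ _),
    ENNReal.ofReal_mul (mul_nonneg (Real.rpow_nonneg (blockNorm_nonneg _ _ _) _)
      (Real.rpow_nonneg (blockNorm_nonneg _ _ _) _)),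
    ENNReal.ofReal_mul (Real.rpow_nonneg (blockNorm_nonneg _ _ _) _),
    ofReal_rpow_third (blockNorm_nonneg _ _ _), ofReal_rpow_third (blockNorm_nonneg _ _ _),
    ofReal_rpow_third (blockNorm_nonneg _ _ _)]

theorem ofReal_mul_exp_rpow_third {a r : ℝ} (ha : 0 ≤ a) :
    ENNReal.ofReal (a * Real.exp r) ^ (1 / 3 : ℝ) =
      ENNReal.ofReal (a ^ (1 / 3 : ℝ) * Real.exp (r / 3)) := by
  rw [ENNReal.ofReal_rpow_of_nonneg (by positivity) (by norm_num),
    Real.mul_rpow ha (Real.exp_pos _).le, ← Real.exp_mul]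
  congr 3
  ring

/-- Exponential decay of three families of random variables is inherited by the sum over the
intermediate sites of the cubic roots of their products, by Hölder's inequality. -/
theorem lintegral_sum_sum_le {d : ℕ} {Λ : Finset (Fin d → ℤ)} {Ω : Type*} [MeasurableSpace Ω]
    {P : Measure Ω} {A G B : Λ → Λ → Ω → ℝ≥0∞} (hA : ∀ x y, AEMeasurable (A x y) P)
    (hG : ∀ x y, AEMeasurable (G x y) P) (hB : ∀ x y, AEMeasurable (B x y) P)
    {a c η η' μ : ℝ} (ha : 0 ≤ a) (hc : 0 ≤ c) (hμ : 0 < μ) (h1 : 6 * μ ≤ η) (h2 : 6 * μ ≤ η')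
    (hA' : ∀ x y, ∫⁻ ω, A x y ω ∂P ≤ ENNReal.ofReal (a * Real.exp (-η * l1dist x.1 y.1)))
    (hG' : ∀ x y, ∫⁻ ω, G x y ω ∂P ≤ ENNReal.ofReal (c * Real.exp (-η' * l1dist x.1 y.1)))
    (hB' : ∀ x y, ∫⁻ ω, B x y ω ∂P ≤ ENNReal.ofReal (a * Real.exp (-η * l1dist x.1 y.1)))
    (x y : Λ) :
    ∫⁻ ω, ∑ w, ∑ z, A x z ω ^ (1 / 3 : ℝ) * G z w ω ^ (1 / 3 : ℝ) * B w y ω ^ (1 / 3 : ℝ) ∂P ≤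
      ENNReal.ofReal (c ^ (1 / 3 : ℝ) * ((a ^ (1 / 3 : ℝ)) ^ 2 *
        ((∑' n : ℤ, Real.exp (-μ * |(n : ℝ)|)) ^ d) ^ 2) * Real.exp (-μ * l1dist x.1 y.1)) := by
  have hm : ∀ w z, AEMeasurable (fun ω => A x z ω ^ (1 / 3 : ℝ) * G z w ω ^ (1 / 3 : ℝ) *
      B w y ω ^ (1 / 3 : ℝ)) P := fun w z =>
    (((hA x z).pow_const _).mul ((hG z w).pow_const _)).mul ((hB w y).pow_const _)
  rw [lintegral_finsetSum' _ fun w _ => Finset.aemeasurable_fun_sum _ fun z _ => hm w z]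
  simp only [fun w => lintegral_finsetSum' (μ := P) Finset.univ fun z _ => hm w z]
  set E : Λ → Λ → ℝ := fun x y => Real.exp (-μ * l1dist x.1 y.1)
  have hterm : ∀ w z, ∫⁻ ω, A x z ω ^ (1 / 3 : ℝ) * G z w ω ^ (1 / 3 : ℝ) *
      B w y ω ^ (1 / 3 : ℝ) ∂P ≤ ENNReal.ofReal (c ^ (1 / 3 : ℝ) * (a ^ (1 / 3 : ℝ)) ^ 2 *
        (E x y * E x z * E y w)) := by
    intro w z
    refine (lintegral_mul_mul_rpow_third_le (hA x z) (hG z w) (hB w y)).trans ?_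
    have b : ∀ {I : ℝ≥0∞} {a r : ℝ}, 0 ≤ a → I ≤ ENNReal.ofReal (a * Real.exp r) →
        I ^ (1 / 3 : ℝ) ≤ ENNReal.ofReal (a ^ (1 / 3 : ℝ) * Real.exp (r / 3)) :=
      fun ha h => by
        rw [← ofReal_mul_exp_rpow_third ha]
        exact ENNReal.rpow_le_rpow h (by norm_num)
    refine (mul_le_mul' (mul_le_mul' (b ha (hA' x z)) (b hc (hG' z w))) (b ha (hB' w y))).trans ?_
    rw [← ENNReal.ofReal_mul (by positivity), ← ENNReal.ofReal_mul (by positivity)]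
    refine ENNReal.ofReal_le_ofReal ?_
    have hexp : Real.exp (-η * l1dist x.1 z.1 / 3) * Real.exp (-η' * l1dist z.1 w.1 / 3) *
        Real.exp (-η * l1dist w.1 y.1 / 3) ≤ E x y * E x z * E y w := by
      simp only [E, ← Real.exp_add]
      refine Real.exp_le_exp.2 ?_
      have t1 := l1dist_triangle x.1 z.1 y.1
      have t2 := l1dist_triangle z.1 w.1 y.1
      have t3 : (l1dist x.1 y.1 : ℝ) ≤ l1dist x.1 z.1 + l1dist z.1 w.1 + l1dist w.1 y.1 := by
        exact_mod_cast by linarith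
      rw [l1dist_comm y.1 w.1]
      have n1 : (0 : ℝ) ≤ l1dist x.1 z.1 := by exact_mod_cast l1dist_nonneg _ _
      have n2 : (0 : ℝ) ≤ l1dist z.1 w.1 := by exact_mod_cast l1dist_nonneg _ _
      have n3 : (0 : ℝ) ≤ l1dist w.1 y.1 := by exact_mod_cast l1dist_nonneg _ _
      have m1 := mul_le_mul_of_nonneg_right h1 n1
      have m2 := mul_le_mul_of_nonneg_right h2 n2
      have m3 := mul_le_mul_of_nonneg_right h1 n3
      have m4 := mul_le_mul_of_nonneg_left t3 hμ.le
      have m5 := mul_nonneg hμ.le n2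
      linarith
    calc _ = c ^ (1 / 3 : ℝ) * (a ^ (1 / 3 : ℝ)) ^ 2 * (Real.exp (-η * l1dist x.1 z.1 / 3) *
          Real.exp (-η' * l1dist z.1 w.1 / 3) * Real.exp (-η * l1dist w.1 y.1 / 3)) := by ring
      _ ≤ _ := by gcongr
  refine (Finset.sum_le_sum fun w _ => Finset.sum_le_sum fun z _ => hterm w z).trans ?_
  have hE : ∀ x y, 0 ≤ E x y := fun x y => (Real.exp_pos _).le
  have hnn : ∀ w z, 0 ≤ c ^ (1 / 3 : ℝ) * (a ^ (1 / 3 : ℝ)) ^ 2 * (E x y * E x z * E y w) :=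
    fun w z => mul_nonneg (by positivity) (mul_nonneg (mul_nonneg (hE _ _) (hE _ _)) (hE _ _))
  simp only [← ENNReal.ofReal_sum_of_nonneg fun z _ => hnn _ z]
  rw [← ENNReal.ofReal_sum_of_nonneg fun w _ => Finset.sum_nonneg fun z _ => hnn w z]
  refine ENNReal.ofReal_le_ofReal ?_
  have e : ∑ w, ∑ z, c ^ (1 / 3 : ℝ) * (a ^ (1 / 3 : ℝ)) ^ 2 * (E x y * E x z * E y w) =
      c ^ (1 / 3 : ℝ) * (a ^ (1 / 3 : ℝ)) ^ 2 * E x y * ((∑ z, E x z) * ∑ w, E y w) := by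
    rw [Finset.sum_mul_sum, Finset.sum_comm, Finset.mul_sum]
    refine Finset.sum_congr rfl fun z _ => ?_
    rw [Finset.mul_sum]
    exact Finset.sum_congr rfl fun w _ => by ring
  rw [e]
  have s1 := sum_exp_l1dist_le hμ Λ x.1
  have s2 := sum_exp_l1dist_le hμ Λ y.1
  have s3 := mul_le_mul s1 s2 (Finset.sum_nonneg fun _ _ => (Real.exp_pos _).le)
    (le_trans (Finset.sum_nonneg fun _ _ => (Real.exp_pos _).le) s1)
  calc _ ≤ c ^ (1 / 3 : ℝ) * (a ^ (1 / 3 : ℝ)) ^ 2 * E x y * _ :=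
        mul_le_mul_of_nonneg_left s3 (mul_nonneg (by positivity) (hE _ _))
    _ = _ := by ring

end Holder

/-! ### The disorder -/

/-- The spring constants are almost surely in `(0, kmax]`; the value `0` is excluded by absolute
continuity. -/
theorem ae_mem_Ioc {Ω : Type*} [MeasurableSpace Ω] {P : Measure Ω} {ν : ℝ → ℝ≥0∞} {kmax : ℝ}
    {k : Ω → ℝ} (hsupp : (volume.withDensity ν).support = Set.Icc 0 kmax) (hk : Measurable k)
    (hmap : P.map k = volume.withDensity ν) : ∀ᵐ ω ∂P, 0 < k ω ∧ k ω ≤ kmax := by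
  have h1 : ∀ᵐ u ∂(P.map k), u ∈ Set.Icc 0 kmax := by
    rw [hmap, ← hsupp]; exact Measure.support_mem_ae
  have h2 : ∀ᵐ u ∂(P.map k), u ≠ 0 := by
    rw [hmap]
    exact (withDensity_absolutelyContinuous volume ν).ae_le (Measure.ae_ne volume 0)
  filter_upwards [ae_of_ae_map hk.aemeasurable h1, ae_of_ae_map hk.aemeasurable h2] with ω a b
  exact ⟨lt_of_le_of_ne a.1 (Ne.symm b), a.2⟩

/-! ### Correlation matrices of random product states -/

namespace BoxDecomposition

variable {d : ℕ} {Λ : Finset (Fin d → ℤ)} {M : ℕ} (D : BoxDecomposition Λ M)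
  {Ω : Type*} [MeasurableSpace Ω] {P : Measure Ω}
  {ρ : ∀ l, Ω → L2 (D.part l) →L[ℂ] L2 (D.part l)}

theorem aemeasurable_corrMatrix_tensorOp (hρ : ∀ l ω, IsState (ρ l ω))
    (h2 : ∀ l, ∀ᵐ ω ∂P, HasSecondMoments (ρ l ω))
    (hm : ∀ l a b, AEMeasurable (fun ω => corrMatrix (ρ l ω) a b) P) (a b : Λ ⊕ Λ) :
    AEMeasurable (fun ω => corrMatrix (D.tensorOp fun l => ρ l ω) a b) P := by
  obtain ⟨l, a, rfl⟩ := D.exists_lift a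
  obtain ⟨l', b, rfl⟩ := D.exists_lift b
  rcases eq_or_ne l l' with rfl | hl
  · refine (hm l a b).congr ?_
    filter_upwards [ae_all_iff.2 h2] with ω hω
    rw [D.corrMatrix_tensorOp_self (fun l => hρ l ω) hω]
  · refine (aemeasurable_const (b := (0 : ℂ))).congr ?_
    filter_upwards [ae_all_iff.2 h2] with ω hω
    rw [D.corrMatrix_tensorOp_of_ne (fun l => hρ l ω) hω hl]

theorem lintegral_blockNorm_corrMatrix_tensorOp_le {s C' η' : ℝ} (hs : 0 < s)
    (hρ : ∀ l ω, IsState (ρ l ω)) (h2 : ∀ l, ∀ᵐ ω ∂P, HasSecondMoments (ρ l ω))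
    (hle : ∀ l, ∀ x y : D.part l,
      ∫⁻ ω, ENNReal.ofReal (blockNorm (corrMatrix (ρ l ω)) x y ^ s) ∂P ≤
        ENNReal.ofReal (C' * Real.exp (-η' * l1dist x.1 y.1))) (x y : Λ) :
    ∫⁻ ω, ENNReal.ofReal (blockNorm (corrMatrix (D.tensorOp fun l => ρ l ω)) x y ^ s) ∂P ≤
      ENNReal.ofReal (C' * Real.exp (-η' * l1dist x.1 y.1)) := by
  obtain ⟨⟨l, x⟩, rfl⟩ := D.sigmaEquiv.surjective x
  obtain ⟨⟨l', y⟩, rfl⟩ := D.sigmaEquiv.surjective y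
  rcases eq_or_ne l l' with rfl | hl
  · refine le_trans (le_of_eq (lintegral_congr_ae ?_)) (hle l x y)
    filter_upwards [ae_all_iff.2 h2] with ω hω
    have e := D.corrMatrix_tensorOp_self (fun l => hρ l ω) hω l
    have : block (corrMatrix (D.tensorOp fun l => ρ l ω)) (D.incl l x) (D.incl l y) =
        block (corrMatrix (ρ l ω)) x y := by
      rw [block, block, ← e, ← e, ← e, ← e]
      rfl
    change ENNReal.ofReal (blockNorm _ (D.incl l x) (D.incl l y) ^ s) = _
    rw [blockNorm, this, blockNorm]
  · refine le_trans (le_of_eq ((lintegral_congr_ae ?_).trans lintegral_zero)) zero_le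
    filter_upwards [ae_all_iff.2 h2] with ω hω
    have e := D.corrMatrix_tensorOp_of_ne (fun l => hρ l ω) hω hl
    have : block (corrMatrix (D.tensorOp fun l => ρ l ω)) (D.incl l x) (D.incl l' y) = 0 := by
      ext i j
      fin_cases i <;> fin_cases j
      · exact e (Sum.inl x) (Sum.inl y)
      · exact e (Sum.inl x) (Sum.inr y)
      · exact e (Sum.inr x) (Sum.inl y)
      · exact e (Sum.inr x) (Sum.inr y)
    change ENNReal.ofReal (blockNorm _ (D.incl l x) (D.incl l' y) ^ s) = _
    rw [blockNorm, this, map_zero, norm_zero, Real.zero_rpow hs.ne', ENNReal.ofReal_zero]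

end BoxDecomposition

end

end QuenchedOscillators

open QuenchedOscillators

theorem theorem2p2 (d : ℕ) (hd : 1 ≤ d) (lam s kmax C etat : ℝ) (hlam : 0 < lam)
    (hs : 0 < s) (hs1 : s ≤ 1) (hetat : 0 < etat) :
    ∃ C'' : ℝ, 0 < C'' ∧
      ∀ (eta eta' : ℝ), 0 < eta → 0 < eta' → etat = min eta eta' / 6 →
      -- the disorder: i.i.d. spring constants with bounded density `ν`, `supp ν = [0, kmax]`
      ∀ (Ω : Type*) [MeasurableSpace Ω] (P : Measure Ω) [IsProbabilityMeasure P]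
        (ν : ℝ → ℝ≥0∞) (k : (Fin d → ℤ) → Ω → ℝ),
        Measurable ν → essSup ν volume < ⊤ →
        (volume.withDensity ν).support = Set.Icc 0 kmax →
        (∀ x, Measurable (k x)) → iIndepFun k P →
        (∀ x, P.map (k x) = volume.withDensity ν) →
      -- exponential decay of the singular eigenfunction correlators, uniformly in the box
      (∀ Λ : Finset (Fin d → ℤ), QuenchedOscillators.IsBox Λ → ∀ x y : Λ,
        ∫⁻ ω, QuenchedOscillators.singularCorrelator lam s (fun z => k z ω) Λ x y ∂P ≤
          ENNReal.ofReal (C * Real.exp (-eta * QuenchedOscillators.l1dist x.1 y.1))) →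
      -- a box, its decomposition, and the (random) local states
      ∀ (Λ : Finset (Fin d → ℤ)), QuenchedOscillators.IsBox Λ →
      ∀ (M : ℕ) (D : QuenchedOscillators.BoxDecomposition Λ M)
        (ρ : ∀ l : Fin M, Ω →
          QuenchedOscillators.L2 (D.part l) →L[ℂ] QuenchedOscillators.L2 (D.part l))
        (C' : ℝ),
        0 ≤ C' →
        (∀ l ω, QuenchedOscillators.IsState (ρ l ω)) →
        (∀ l, ∀ᵐ ω ∂P, QuenchedOscillators.HasSecondMoments (ρ l ω)) →
        (∀ l a b, AEMeasurable (fun ω => QuenchedOscillators.corrMatrix (ρ l ω) a b) P) →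
        (∀ l, ∀ x y : D.part l,
          ∫⁻ ω, ENNReal.ofReal
            (QuenchedOscillators.blockNorm (QuenchedOscillators.corrMatrix (ρ l ω)) x y ^ s) ∂P ≤
            ENNReal.ofReal (C' * Real.exp (-eta' * QuenchedOscillators.l1dist x.1 y.1))) →
      -- the quenched correlations are well-defined and decay, uniformly in time
      (∀ᵐ ω ∂P, ∀ t : ℝ, QuenchedOscillators.HasSecondMoments
        (QuenchedOscillators.evolve lam (fun z => k z ω) Λ (D.tensorOp (fun l => ρ l ω)) t)) ∧
      ∀ x y : Λ,
        AEMeasurable (fun ω => ⨆ t : ℝ, ENNReal.ofReal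
          (QuenchedOscillators.blockNorm (QuenchedOscillators.corrMatrix
            (QuenchedOscillators.evolve lam (fun z => k z ω) Λ
              (D.tensorOp (fun l => ρ l ω)) t)) x y ^ (s / 3))) P ∧
        ∫⁻ ω, ⨆ t : ℝ, ENNReal.ofReal
          (QuenchedOscillators.blockNorm (QuenchedOscillators.corrMatrix
            (QuenchedOscillators.evolve lam (fun z => k z ω) Λ
              (D.tensorOp (fun l => ρ l ω)) t)) x y ^ (s / 3)) ∂P ≤
          ENNReal.ofReal (C' ^ (1 / 3 : ℝ) * C'' *
            Real.exp (-etat * QuenchedOscillators.l1dist x.1 y.1)) := by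
  -- an upper bound for the spectrum of `h`
  set e : ℝ := |kmax| / 2 + 2 * lam * 3 ^ d with he
  have he0 : 0 ≤ e := by positivity
  set a : ℝ := blockConst ^ s * (1 + e) ^ s * max C 0 with ha
  have hbc := blockConst_nonneg
  have ha0 : 0 ≤ a := by positivity
  set S : ℝ := (∑' n : ℤ, Real.exp (-etat * |(n : ℝ)|)) ^ d
  -- `a` is the prefactor in the decay of `sup_t ‖M(t)_{xz}‖^s` and `S` bounds the sum over one site; the
  -- summand `1` only makes the constant positive
  refine ⟨(a ^ (1 / 3 : ℝ)) ^ 2 * S ^ 2 + 1, by positivity, ?_⟩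
  intro eta eta' heta heta' hmin Ω _ P _ ν k _ _ hsupp hk _ hmap hcorr Λ hΛ M D ρ C' hC' hρ h2 hm hle
  have h6 : 6 * etat ≤ eta := by rw [hmin]; linarith [min_le_left eta eta']
  have h6' : 6 * etat ≤ eta' := by rw [hmin]; linarith [min_le_right eta eta']
  have hdis : ∀ᵐ ω ∂P, ∀ x : Λ, 0 < k x.1 ω ∧ k x.1 ω ≤ kmax :=
    ae_all_iff.2 fun x => ae_mem_Ioc hsupp (hk x.1) (hmap x.1)
  have hpos : ∀ᵐ ω ∂P, ∀ j, 0 < (effHam_isHermitian lam (fun z => k z ω) Λ).eigenvalues j := by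
    filter_upwards [hdis] with ω hω j
    exact eigenvalues_effHam_pos hlam (fun x => (hω x).1) j
  have hup : ∀ᵐ ω ∂P, ∀ j, (effHam_isHermitian lam (fun z => k z ω) Λ).eigenvalues j ≤ e := by
    filter_upwards [hdis] with ω hω j
    exact eigenvalues_effHam_le hlam (fun x => (hω x).2.trans (le_abs_self kmax)) j
  have h2' : ∀ᵐ ω ∂P, ∀ l, HasSecondMoments (ρ l ω) := ae_all_iff.2 h2
  refine ⟨?_, fun x y => ?_⟩
  · filter_upwards [hpos, h2'] with ω h1 h2 t
    obtain ⟨S, hS⟩ := D.exists_isMoment_tensorOp (fun l => hρ l ω) h2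
    exact hasSecondMoments_evolve h1 (D.isPositive_tensorOp fun l => hρ l ω) hS t
  have hev : ∀ᵐ ω ∂P, ∀ t, corrMatrix (evolve lam (fun z => k z ω) Λ (D.tensorOp fun l => ρ l ω) t) =
      flowMatrix lam (fun z => k z ω) Λ t * corrMatrix (D.tensorOp fun l => ρ l ω) *
        (flowMatrix lam (fun z => k z ω) Λ t).transpose := by
    filter_upwards [hpos, h2'] with ω h1 h2 t
    obtain ⟨S, hS⟩ := D.exists_isMoment_tensorOp (fun l => hρ l ω) h2
    exact corrMatrix_evolve h1 (D.isPositive_tensorOp fun l => hρ l ω)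
      (D.hilbertSchmidt_rootOp_tensorOp fun l => hρ l ω) hS t
  have hGm := D.aemeasurable_corrMatrix_tensorOp hρ h2 hm
  have hFm := fun t a b => aemeasurable_flowMatrix (lam := lam) (Λ := Λ) hk hpos t a b
  constructor
  · have h := aemeasurable_iSup_blockNorm (P := P)
      (G := fun ω t => flowMatrix lam (fun z => k z ω) Λ t * corrMatrix (D.tensorOp fun l => ρ l ω) *
        (flowMatrix lam (fun z => k z ω) Λ t).transpose) (fun t a b => by
        simp only [Matrix.mul_apply, Matrix.transpose_apply]
        exact Finset.aemeasurable_fun_sum _ fun w _ => (Finset.aemeasurable_fun_sum _ fun z _ =>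
          (hFm t a z).mul (hGm z w)).mul (hFm t b w))
      (fun ω => (continuous_flowMatrix.matrix_mul continuous_const).matrix_mul
        continuous_flowMatrix.matrix_transpose) x y (by positivity : 0 < s / 3)
    refine h.congr ?_
    filter_upwards [hev] with ω hω
    simp only [hω]
  let A : Λ → Λ → Ω → ℝ≥0∞ := fun x y ω =>
    ⨆ t, ENNReal.ofReal (blockNorm (flowMatrix lam (fun z => k z ω) Λ t) x y ^ s)
  let B : Λ → Λ → Ω → ℝ≥0∞ := fun x y ω =>
    ⨆ t, ENNReal.ofReal (blockNorm (flowMatrix lam (fun z => k z ω) Λ t).transpose x y ^ s)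
  let G : Λ → Λ → Ω → ℝ≥0∞ := fun x y ω =>
    ENNReal.ofReal (blockNorm (corrMatrix (D.tensorOp fun l => ρ l ω)) x y ^ s)
  have hA : ∀ x y, AEMeasurable (A x y) P := fun x y =>
    aemeasurable_iSup_blockNorm hFm (fun ω => continuous_flowMatrix) x y hs
  have hB : ∀ x y, AEMeasurable (B x y) P := fun x y =>
    aemeasurable_iSup_blockNorm (fun t a b => hFm t b a)
      (fun ω => continuous_flowMatrix.matrix_transpose) x y hs
  have hG : ∀ x y, AEMeasurable (G x y) P := fun x y =>
    ((aemeasurable_blockNorm hGm x y).pow_const s).ennreal_ofReal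
  -- The singular correlator need not be measurable, but it dominates `A` and `B`.
  have hdom : ∀ F : Ω → ℝ≥0∞, ∀ x y : Λ, (∀ᵐ ω ∂P, F ω ≤
      ENNReal.ofReal (blockConst ^ s * (1 + e) ^ s) *
        singularCorrelator lam s (fun z => k z ω) Λ x y) →
      ∫⁻ ω, F ω ∂P ≤ ENNReal.ofReal (a * Real.exp (-eta * l1dist x.1 y.1)) := by
    intro F x y hF
    refine (lintegral_mono_ae hF).trans ?_
    rw [lintegral_const_mul' _ _ ENNReal.ofReal_ne_top, ha, mul_assoc,
      ENNReal.ofReal_mul (p := blockConst ^ s * (1 + e) ^ s) (by positivity)]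
    gcongr
    refine (hcorr Λ hΛ x y).trans (ENNReal.ofReal_le_ofReal ?_)
    gcongr
    exact le_max_left _ _
  have hA' : ∀ x y, ∫⁻ ω, A x y ω ∂P ≤ ENNReal.ofReal (a * Real.exp (-eta * l1dist x.1 y.1)) :=
    fun x y => hdom _ x y (by
      filter_upwards [hpos, hup] with ω h1 h2
      exact iSup_le fun t => (ofReal_blockNorm_flowMatrix_le hs.le he0 h1 h2 t x y).1)
  have hB' : ∀ x y, ∫⁻ ω, B x y ω ∂P ≤ ENNReal.ofReal (a * Real.exp (-eta * l1dist x.1 y.1)) :=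
    fun x y => hdom _ x y (by
      filter_upwards [hpos, hup] with ω h1 h2
      exact iSup_le fun t => (ofReal_blockNorm_flowMatrix_le hs.le he0 h1 h2 t x y).2)
  have hG' := D.lintegral_blockNorm_corrMatrix_tensorOp_le hs hρ h2 hle
  calc _ ≤ ∫⁻ ω, ∑ w, ∑ z, A x z ω ^ (1 / 3 : ℝ) * G z w ω ^ (1 / 3 : ℝ) *
        B w y ω ^ (1 / 3 : ℝ) ∂P := by
        refine lintegral_mono_ae ?_
        filter_upwards [hev] with ω hω
        refine iSup_le fun t => ?_
        rw [hω t]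
        refine (ofReal_blockNorm_mul_mul_le _ _ _ x y hs hs1).trans ?_
        gcongr with w _ z _
        · exact le_iSup (fun t => ENNReal.ofReal
            (blockNorm (flowMatrix lam (fun z => k z ω) Λ t) x z ^ s)) t
        · exact le_iSup (fun t => ENNReal.ofReal
            (blockNorm (flowMatrix lam (fun z => k z ω) Λ t).transpose w y ^ s)) t
    _ ≤ _ := lintegral_sum_sum_le hA hG hB ha0 hC' hetat h6 h6' hA' hG' hB' x y
    _ ≤ _ := by
        refine ENNReal.ofReal_le_ofReal ?_
        gcongr
        linarith
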